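/- Let $S$ be a set of $N\ge 2$ points in the plane in general position (no three collinear), and let $h$ be the number of points of $S$ on the boundary of the convex hull of $S$. A *crossing-free straight-edge graph* on $S$ is a graph with vertex set $S$ whose edges, drawn as straight segments, pass through no other point of $S$ and meet pairwise only in common endpoints. A *triangulation* $T$ of $S$ is a crossing-free straight-edge graph on $S$ to which no edge can be added without losing this property. An edge of $T$ is *interior* if it does not lie on the boundary of the convex hull of $S$. A set $F$ of interior edges of $T$ is *pseudo-simultaneously flippable* (ps-flippable) if, after deleting the edges of $F$ from $T$, every bounded face of the remaining graph (bounded connected component of the complement of the union of its edges) is convex and no vertex has degree $0$. **Lemma.** Every triangulation $T$ of such a set $S$ contains a ps-flippable set of at least $\max\{N/2-2,\;h-3\}$ edges. This bound is tight in the worst case, in both terms: 1. For every even $N\ge 4$ there are a set $S$ of $N$ points in general position and a triangulation $T$ of $S$ such that $\max\{N/2-2,h-3\}=N/2-2$ and the largest ps-flippable set of edges of $T$ has exactly $N/2-2$ edges. 2. For every $N\ge 3$ there are sets of $N$ points in general and convex position (no point lies in the convex hull of the others). Every such set has a triangulation, and for every triangulation $T$ of it, $\max\{N/2-2,h-3\}=h-3$,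 the set of all interior edges of $T$ is ps-flippable and consists of exactly $h-3$ edges, and the largest ps-flippable set of edges of $T$ has exactly $h-3$ edges. -/

import Mathlib

/-- The Euclidean plane. -/
abbrev Plane : Type := EuclideanSpace ℝ (Fin 2)

/-- General position: no three distinct points of `S` are collinear. -/
def InGeneralPosition (S : Finset Plane) : Prop :=
  ∀ a ∈ S, ∀ b ∈ S, ∀ c ∈ S, a ≠ b → a ≠ c → b ≠ c → ¬ Collinear ℝ ({a, b, c} : Set Plane)

/-- Convex position: no point of `S` lies in the convex hull of the other points of `S`. -/
def InConvexPosition (S : Finset Plane) : Prop :=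
  ConvexIndependent ℝ (fun p : S => (p : Plane))

/-- The boundary of the convex hull of `S`. -/
def hullBoundary (S : Finset Plane) : Set Plane :=
  frontier (convexHull ℝ (S : Set Plane))

open Classical in
/-- The points of `S` that lie on the boundary of its convex hull. -/
noncomputable def hullVertices (S : Finset Plane) : Finset Plane :=
  S.filter (fun p => p ∈ hullBoundary S)

/-- The closed segment that represents a pair of points of `S`. -/
def edgeSegment {S : Finset Plane} (e : Sym2 S) : Set Plane :=
  Sym2.lift ⟨fun a b : S => segment ℝ (a : Plane) (b : Plane),
    fun a b => segment_symm ℝ (a : Plane) (b : Plane)⟩ e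

/-- The relative interior of the segment that represents a pair of points of `S`. -/
def edgeInterior {S : Finset Plane} (e : Sym2 S) : Set Plane :=
  Sym2.lift ⟨fun a b : S => openSegment ℝ (a : Plane) (b : Plane),
    fun a b => openSegment_symm ℝ (a : Plane) (b : Plane)⟩ e

/-- A graph on `S`, drawn with straight edges, is crossing-free: no edge passes through a point
of `S` other than its endpoints, and two distinct edges meet at most in common endpoints. -/
def IsCrossingFree {S : Finset Plane} (G : SimpleGraph S) : Prop :=
  (∀ e ∈ G.edgeSet, ∀ p ∈ S, p ∉ edgeInterior e) ∧
    ∀ e ∈ G.edgeSet, ∀ e' ∈ G.edgeSet, e ≠ e' → Disjoint (edgeInterior e) (edgeInterior e')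

/-- A triangulation of `S`: a crossing-free straight-edge graph on `S` that is maximal with
respect to inclusion of edge sets. -/
def IsTriangulation {S : Finset Plane} (T : SimpleGraph S) : Prop :=
  Maximal IsCrossingFree T

/-- The edges of `T` that are not edges of the convex hull of `S`. -/
def interiorEdges {S : Finset Plane} (T : SimpleGraph S) : Set (Sym2 S) :=
  {e | e ∈ T.edgeSet ∧ ¬ edgeSegment e ⊆ hullBoundary S}

/-- The subset of the plane covered by the edges of `G`. -/
def drawing {S : Finset Plane} (G : SimpleGraph S) : Set Plane :=
  ⋃ e ∈ G.edgeSet, edgeSegment e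

/-- The faces of `G`: the connected components of the complement of its drawing. -/
def IsFace {S : Finset Plane} (G : SimpleGraph S) (A : Set Plane) : Prop :=
  ∃ x ∈ (drawing G)ᶜ, A = connectedComponentIn (drawing G)ᶜ x

/-- A set `F` of interior edges of `T` is pseudo-simultaneously flippable if, after the deletion
of these edges, every bounded face is convex and no vertex has degree `0`. -/
def IsPsFlippable {S : Finset Plane} (T : SimpleGraph S) (F : Finset (Sym2 S)) : Prop :=
  (F : Set (Sym2 S)) ⊆ interiorEdges T ∧
    (∀ A : Set Plane, IsFace (T.deleteEdges F) A → Bornology.IsBounded A → Convex ℝ A) ∧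
    ∀ v : S, ∃ w : S, (T.deleteEdges F).Adj v w

/-- The sizes (as real numbers) of the pseudo-simultaneously flippable sets of edges of `T`. -/
def psFlippableSizes {S : Finset Plane} (T : SimpleGraph S) : Set ℝ :=
  {r | ∃ F : Finset (Sym2 S), IsPsFlippable T F ∧ r = (F.card : ℝ)}

/-- The quantity `max {N/2 - 2, h - 3}`, where `N` is the number of points of `S` and `h` is the
number of those on the boundary of the convex hull. -/
noncomputable def psBound (S : Finset Plane) : ℝ :=
  max ((S.card : ℝ) / 2 - 2) (((hullVertices S).card : ℝ) - 3)

/-! Call a point of `S` inner if it is interior to the hull, and call a vertex surrounded in a graph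
if its neighbours meet every open half-plane bounded by a line through it. For a set `F` of interior
edges, ps-flippability is equivalent to all inner points staying surrounded when `F` is deleted. If
they stay surrounded, the points of a bounded face visible from a point `x` of it are open and
closed in the face: a sight line that is newly blocked would contain a vertex with an edge pointing
back into the region just swept (`convex_face`). Conversely, a vertex that is not surrounded is the
midpoint of two points of a single bounded face (`IsPsFlippable.surrounded`).

For the lower bound take `F` of maximum size among the sets that keep inner points surrounded. Each
kept interior edge is then needed at an inner end: without it, an open half-plane there would
contain no neighbour. Call an inner point cubic if it keeps exactly three edges; any other inner
point needs at most two of its edges (`card_needs_le_two`). This bounds the number of kept edges and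
settles `h - 3`. For `N / 2 - 2` the triangles are counted as well. A triangle with a deleted side
is charged to that side. A surviving one is charged to a hull edge or to a side whose ends are both
cubic or both not cubic, and it can avoid the sides of the angle at any vertex that is responsible
for two edges (`exists_charge`). The two counts combine linearly in `exists_large_keepsSurrounded`.

The numbers of triangles and edges come from a sweep instead of Euler's formula: a generic direction
or its opposite enters each triangle at its middle vertex (`card_midFaces`). That faces are
triangles is derived from maximality by following a ray from a vertex to the first edge it meets
(`exists_isTri`).

For tightness, points in convex position have no inner points, so all `h - 3` interior edges can go.
In the other example all inner points have degree three and are pairwise nonadjacent, so their `3 (N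
- h)` edges must stay and only `h - 3 = N / 2 - 2` remain. -/

/-! ### Signed areas, general position and crossing segments -/

/-- Twice the signed area of the triangle `a b c`. -/
def ori (a b c : Plane) : ℝ := (b 0 - a 0) * (c 1 - a 1) - (b 1 - a 1) * (c 0 - a 0)

theorem ori_rotate (a b c : Plane) : ori b c a = ori a b c := by unfold ori; ring

theorem ori_swap (a b c : Plane) : ori b a c = - ori a b c := by unfold ori; ring

theorem ori_swap_right (a b c : Plane) : ori a c b = - ori a b c := by unfold ori; ring

@[simp] theorem ori_self_left (a b : Plane) : ori a b a = 0 := by unfold ori; ring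

@[simp] theorem ori_self_right (a b : Plane) : ori a b b = 0 := by unfold ori; ring

@[simp] theorem ori_self (a b : Plane) : ori a a b = 0 := by unfold ori; ring

theorem plane_ext {a b : Plane} (h0 : a 0 = b 0) (h1 : a 1 = b 1) : a = b := by
  ext i; fin_cases i <;> assumption

theorem collinear_of_ori_eq_zero {a b c : Plane} (hab : a ≠ b) (h : ori a b c = 0) :
    Collinear ℝ ({a, b, c} : Set Plane) := by
  rw [collinear_iff_of_mem (p₀ := a) (by simp)]
  refine ⟨b - a, ?_⟩
  have key : ∃ t : ℝ, c = t • (b - a) + a := by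
    unfold ori at h
    by_cases h0 : b 0 - a 0 = 0
    · have h1 : b 1 - a 1 ≠ 0 := by
        intro h1
        exact hab (plane_ext (by linarith) (by linarith))
      refine ⟨(c 1 - a 1) / (b 1 - a 1), plane_ext ?_ ?_⟩
      · simp only [PiLp.add_apply, PiLp.smul_apply, PiLp.sub_apply, smul_eq_mul]
        rw [h0] at h
        have : c 0 - a 0 = 0 := by
          have := mul_eq_zero.1 (show (b 1 - a 1) * (c 0 - a 0) = 0 by linarith)
          tauto
        rw [h0]; linarith
      · simp only [PiLp.add_apply, PiLp.smul_apply, PiLp.sub_apply, smul_eq_mul]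
        field_simp; ring
    · refine ⟨(c 0 - a 0) / (b 0 - a 0), plane_ext ?_ ?_⟩
      · simp only [PiLp.add_apply, PiLp.smul_apply, PiLp.sub_apply, smul_eq_mul]
        field_simp; ring
      · simp only [PiLp.add_apply, PiLp.smul_apply, PiLp.sub_apply, smul_eq_mul]
        field_simp; linarith
  rintro p (rfl | rfl | rfl)
  · exact ⟨0, by simp⟩
  · exact ⟨1, by simp⟩
  · obtain ⟨t, ht⟩ := key
    exact ⟨t, by simpa using ht⟩

theorem ori_ne_zero {S : Finset Plane} (hS : InGeneralPosition S) {a b c : S} (hab : a ≠ b)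
    (hac : a ≠ c) (hbc : b ≠ c) : ori a b c ≠ 0 := fun h =>
  hS a a.2 b b.2 c c.2 (fun h => hab (Subtype.ext h)) (fun h => hac (Subtype.ext h))
    (fun h => hbc (Subtype.ext h))
    (collinear_of_ori_eq_zero (fun h => hab (Subtype.ext h)) h)

theorem eq_or_eq_of_ori_eq_zero {S : Finset Plane} (hS : InGeneralPosition S) {a b c : S}
    (hab : a ≠ b) (h : ori a b c = 0) : c = a ∨ c = b := by
  by_contra hc
  push Not at hc
  exact ori_ne_zero hS hab (Ne.symm hc.1) (Ne.symm hc.2) h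

theorem mem_openSegment_iff' {a b z : Plane} : z ∈ openSegment ℝ a b ↔
    ∃ s t : ℝ, 0 < s ∧ 0 < t ∧ s + t = 1 ∧ z 0 = s * a 0 + t * b 0 ∧ z 1 = s * a 1 + t * b 1 := by
  constructor
  · rintro ⟨s, t, hs, ht, hst, rfl⟩
    exact ⟨s, t, hs, ht, hst, by simp, by simp⟩
  · rintro ⟨s, t, hs, ht, hst, h0, h1⟩
    exact ⟨s, t, hs, ht, hst, plane_ext (by simp [h0]) (by simp [h1])⟩

theorem mem_segment_iff' {a b z : Plane} : z ∈ segment ℝ a b ↔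
    ∃ s t : ℝ, 0 ≤ s ∧ 0 ≤ t ∧ s + t = 1 ∧ z 0 = s * a 0 + t * b 0 ∧ z 1 = s * a 1 + t * b 1 := by
  constructor
  · rintro ⟨s, t, hs, ht, hst, rfl⟩
    exact ⟨s, t, hs, ht, hst, by simp, by simp⟩
  · rintro ⟨s, t, hs, ht, hst, h0, h1⟩
    exact ⟨s, t, hs, ht, hst, plane_ext (by simp [h0]) (by simp [h1])⟩

theorem ori_combo {a b z : Plane} {s t : ℝ} (hst : s + t = 1) (h0 : z 0 = s * a 0 + t * b 0)
    (h1 : z 1 = s * a 1 + t * b 1) (p q : Plane) : ori p q z = s * ori p q a + t * ori p q b := by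
  unfold ori
  rw [h0, h1]
  obtain rfl : s = 1 - t := by linarith
  ring

section
variable {S : Finset Plane} {T : SimpleGraph S}

@[simp] theorem edgeSegment_mk (a b : S) :
    edgeSegment s(a, b) = segment ℝ (a : Plane) (b : Plane) := rfl

theorem edge_eq_of_mem (hT : IsCrossingFree T) {a b c d : S} (hab : T.Adj a b) (hcd : T.Adj c d)
    {z : Plane} (h1 : z ∈ openSegment ℝ (a : Plane) b) (h2 : z ∈ openSegment ℝ (c : Plane) d) :
    s(a, b) = s(c, d) := by
  by_contra h
  exact Set.disjoint_left.1 (hT.2 s(a, b) hab s(c, d) hcd h) h1 h2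

theorem notMem_openSegment (hS : InGeneralPosition S) {a b : S} (hab : a ≠ b) (c : S) :
    (c : Plane) ∉ openSegment ℝ (a : Plane) b := by
  intro h
  obtain ⟨s, t, hs, ht, hst, h0, h1⟩ := mem_openSegment_iff'.1 h
  have h2 : ori a b c = 0 := by rw [ori_combo hst h0 h1]; simp
  rcases eq_or_eq_of_ori_eq_zero hS hab h2 with rfl | rfl
  · refine hab (Subtype.ext (plane_ext ?_ ?_)) <;> apply mul_left_cancel₀ ht.ne' <;>
      obtain rfl : s = 1 - t := by linarith
    · linarith
    · linarith
  · refine hab (Subtype.ext (plane_ext ?_ ?_)) <;> apply mul_left_cancel₀ hs.ne' <;>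
      obtain rfl : t = 1 - s := by linarith
    · linarith
    · linarith

/-- If `c` were on the line `a b`, the common point would put `d` on it too, and general position
would make both pairs consist of the same two points. -/
theorem ori_sign_of_crossing (hS : InGeneralPosition S) {a b c d : S} (hab : a ≠ b) (hcd : c ≠ d)
    (hne : s(a, b) ≠ s(c, d)) {z : Plane}
    (h1 : z ∈ openSegment ℝ (a : Plane) b) (h2 : z ∈ openSegment ℝ (c : Plane) d) :
    (ori a b c < 0 ∧ 0 < ori a b d) ∨ (0 < ori a b c ∧ ori a b d < 0) := by
  obtain ⟨s, t, hs, ht, hst, h0, h1⟩ := mem_openSegment_iff'.1 h1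
  obtain ⟨s', t', hs', ht', hst', h0', h1'⟩ := mem_openSegment_iff'.1 h2
  have e1 : ori a b z = 0 := by rw [ori_combo hst h0 h1]; simp
  have e2 := ori_combo hst' h0' h1' (a : Plane) b
  rw [e1] at e2
  rcases lt_trichotomy (ori a b c) 0 with hc | hc | hc
  · left
    refine ⟨hc, ?_⟩
    by_contra hd
    nlinarith [mul_neg_of_pos_of_neg hs' hc, mul_nonneg ht'.le (neg_nonneg.2 (not_lt.1 hd))]
  · exfalso
    have hd : ori a b d = 0 := by
      rw [hc] at e2
      have := mul_eq_zero.1 (show t' * ori a b d = 0 by linarith)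
      rcases this with h | h
      · linarith
      · exact h
    rcases eq_or_eq_of_ori_eq_zero hS hab hc with rfl | rfl <;>
      rcases eq_or_eq_of_ori_eq_zero hS hab hd with rfl | rfl
    · exact hcd rfl
    · exact hne rfl
    · exact hne Sym2.eq_swap
    · exact hcd rfl
  · right
    refine ⟨hc, ?_⟩
    by_contra hd
    nlinarith [mul_pos hs' hc, mul_nonneg ht'.le (not_lt.1 hd)]

/-- A pair of points that no edge of a triangulation crosses is an edge. -/
theorem adj_of_uncrossed (hS : InGeneralPosition S) (hT : IsTriangulation T) {a b : S} (hab : a ≠ b)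
    (h : ∀ c d : S, T.Adj c d → s(a, b) ≠ s(c, d) → ∀ z ∈ openSegment ℝ (a : Plane) b,
      z ∈ openSegment ℝ (c : Plane) d → ori a b c < 0 → 0 < ori a b d → False) : T.Adj a b := by
  -- The hypothesis covers crossings from the right of `a b` to its left; swapping `c` and `d`
  -- covers the others.
  have h' : ∀ c d : S, T.Adj c d → s(a, b) ≠ s(c, d) →
      Disjoint (openSegment ℝ (a : Plane) b) (openSegment ℝ (c : Plane) d) := by
    intro c d hcd hne
    rw [Set.disjoint_left]
    intro z h1 h2
    rcases ori_sign_of_crossing hS hab hcd.ne hne h1 h2 with ⟨hc, hd⟩ | ⟨hc, hd⟩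
    · exact h c d hcd hne z h1 h2 hc hd
    · refine h d c hcd.symm ?_ z h1 ?_ hd hc
      · rwa [Sym2.eq_swap (a := d)]
      · rwa [openSegment_symm]
  have hcf : IsCrossingFree (T ⊔ SimpleGraph.edge a b) := by
    have hmem : ∀ e ∈ (T ⊔ SimpleGraph.edge a b).edgeSet, e ∈ T.edgeSet ∨ e = s(a, b) := by
      intro e he
      rw [SimpleGraph.edgeSet_sup, SimpleGraph.edgeSet_edge_of_ne hab] at he
      simpa [or_comm] using he
    constructor
    · intro e he p hp
      rcases hmem e he with h1 | rfl
      · exact hT.1.1 e h1 p hp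
      · exact notMem_openSegment hS hab ⟨p, hp⟩
    · intro e he e' he' hne
      rcases hmem e he with h1 | rfl <;> rcases hmem e' he' with h2 | rfl
      · exact hT.1.2 e h1 e' h2 hne
      · induction e with
        | _ c d => exact (h' c d h1 hne.symm).symm
      · induction e' with
        | _ c d => exact h' c d h2 hne
      · exact absurd rfl hne
  exact hT.2 hcf le_sup_left (by simp [SimpleGraph.edge_adj, hab])

end

/-! ### What a vertex sees in a given direction -/

/-- The signed distance, up to scale, of `s` from the line through `v` with direction `(d₀, d₁)`,
positive on the right. -/
def dev (d₀ d₁ : ℝ) (v s : Plane) : ℝ := (s 0 - v 0) * d₁ - (s 1 - v 1) * d₀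

@[simp] theorem dev_self (d₀ d₁ : ℝ) (v : Plane) : dev d₀ d₁ v v = 0 := by unfold dev; ring

theorem dev_combo {a b z : Plane} {s t : ℝ} (hst : s + t = 1) (h0 : z 0 = s * a 0 + t * b 0)
    (h1 : z 1 = s * a 1 + t * b 1) (d₀ d₁ : ℝ) (v : Plane) :
    dev d₀ d₁ v z = s * dev d₀ d₁ v a + t * dev d₀ d₁ v b := by
  unfold dev
  rw [h0, h1]
  obtain rfl : s = 1 - t := by linarith
  ring

/-- Affine functions that are positive at one end of a segment and not all positive at the other
have a first common exit point. -/
theorem exists_exit {p₁ p₂ p₃ q₁ q₂ q₃ : ℝ} (h₁ : 0 < p₁) (h₂ : 0 < p₂) (h₃ : 0 < p₃)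
    (hq : ¬ (0 < q₁ ∧ 0 < q₂ ∧ 0 < q₃)) : ∃ t : ℝ, 0 < t ∧ t ≤ 1 ∧ 0 ≤ (1 - t) * p₁ + t * q₁ ∧
      0 ≤ (1 - t) * p₂ + t * q₂ ∧ 0 ≤ (1 - t) * p₃ + t * q₃ ∧
      ((1 - t) * p₁ + t * q₁ = 0 ∨ (1 - t) * p₂ + t * q₂ = 0 ∨ (1 - t) * p₃ + t * q₃ = 0) := by
  let f : ℝ → ℝ := fun t =>
    min ((1 - t) * p₁ + t * q₁) (min ((1 - t) * p₂ + t * q₂) ((1 - t) * p₃ + t * q₃))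
  have hf : Continuous f := by fun_prop
  have h0 : 0 < f 0 := by simp [f, h₁, h₂, h₃]
  have h1 : f 1 ≤ 0 := by
    simp only [f, sub_self, zero_mul, one_mul, zero_add, min_le_iff]
    by_contra h
    push Not at h
    exact hq h
  obtain ⟨t, ⟨ht0, ht1⟩, ht⟩ := intermediate_value_Icc' (zero_le_one' ℝ) hf.continuousOn
    (show (0 : ℝ) ∈ Set.Icc (f 1) (f 0) from ⟨h1, h0.le⟩)
  have ht' : 0 ≤ f t := ht.ge
  simp only [f, le_min_iff] at ht'
  refine ⟨t, lt_of_le_of_ne ht0 ?_, ht1, ht'.1, ht'.2.1, ht'.2.2, ?_⟩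
  · rintro rfl
    exact h0.ne' ht
  · simp only [f] at ht
    rcases min_choice ((1 - t) * p₁ + t * q₁) (min ((1 - t) * p₂ + t * q₂) ((1 - t) * p₃ + t * q₃))
      with h | h
    · left; rw [← h, ht]
    · rw [h] at ht
      rcases min_choice ((1 - t) * p₂ + t * q₂) ((1 - t) * p₃ + t * q₃) with h | h
      · right; left; rw [← h, ht]
      · right; right; rw [← h, ht]

section
variable {S : Finset Plane} {T : SimpleGraph S}

/-- The configuration seen from `v` in direction `(d₀, d₁)`: the first edge `a b` that is hit, and
the points `x`, `y` of the triangle `v a b` that are closest in angle to the direction. -/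
structure Wedge (T : SimpleGraph S) (d₀ d₁ : ℝ) (v a b x y : S) : Prop where
  adj : T.Adj a b
  fa : 0 < dev d₀ d₁ v a
  fb : dev d₀ d₁ v b < 0
  hab : 0 < ori v a b
  -- The ray from `v` meets the line `c d` at parameter `ori v c d / (dev d₀ d₁ v c - dev d₀ d₁ v
  -- d)`; the denominators are cleared here.
  hmin : ∀ c d : S, T.Adj c d → 0 < dev d₀ d₁ v c → dev d₀ d₁ v d < 0 → 0 < ori v c d →
    ori v a b * (dev d₀ d₁ v c - dev d₀ d₁ v d) ≤ ori v c d * (dev d₀ d₁ v a - dev d₀ d₁ v b)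
  fx : 0 < dev d₀ d₁ v x
  abx : 0 ≤ ori a b x
  vax : 0 ≤ ori v a x
  fy : dev d₀ d₁ v y < 0
  aby : 0 ≤ ori a b y
  vyb : 0 ≤ ori v y b
  empty : ∀ s : S, 0 < ori v x s → 0 < ori y v s → 0 < ori a b s → False

variable {d₀ d₁ : ℝ} {v a b x y : S}

/-- This and the next two lemmas fix the counterclockwise order `a`, `x`, ray, `y`, `b` around `v`,
where `x` may be `a` and `y` may be `b`. -/
theorem Wedge.vxb (W : Wedge T d₀ d₁ v a b x y) : 0 < ori v x b := by
  have h : dev d₀ d₁ v a * ori v x b =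
      dev d₀ d₁ v x * ori v a b - dev d₀ d₁ v b * ori v a x := by
    unfold ori dev; ring
  have h1 := mul_pos W.fx W.hab
  have h2 := mul_nonneg (neg_nonneg.2 W.fb.le) W.vax
  exact pos_of_mul_pos_right (a := dev d₀ d₁ v a) (by linarith) W.fa.le

theorem Wedge.vay (W : Wedge T d₀ d₁ v a b x y) : 0 < ori v a y := by
  have h : (- dev d₀ d₁ v b) * ori v a y =
      - dev d₀ d₁ v y * ori v a b + dev d₀ d₁ v a * ori v y b := by
    unfold ori dev; ring
  have h1 := mul_pos (neg_pos.2 W.fy) W.hab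
  have h2 := mul_nonneg W.fa.le W.vyb
  exact pos_of_mul_pos_right (a := -dev d₀ d₁ v b) (by linarith) (neg_nonneg.2 W.fb.le)

theorem Wedge.vxy (W : Wedge T d₀ d₁ v a b x y) : 0 < ori v x y := by
  have h : (- dev d₀ d₁ v b) * ori v x y =
      dev d₀ d₁ v x * ori v y b - dev d₀ d₁ v y * ori v x b := by
    unfold ori dev; ring
  have h1 := mul_pos (neg_pos.2 W.fy) W.vxb
  have h2 := mul_nonneg W.fx.le W.vyb
  exact pos_of_mul_pos_right (a := -dev d₀ d₁ v b) (by linarith) (neg_nonneg.2 W.fb.le)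

/-- An edge that meets the interior of the wedge leaves it, at either end, through a side that
contains `v`. -/
theorem Wedge.exit (hS : InGeneralPosition S) (hT : IsCrossingFree T)
    (W : Wedge T d₀ d₁ v a b x y) {c d : S} (hcd : T.Adj c d) {z : Plane}
    (hz : z ∈ openSegment ℝ (c : Plane) d) (h1 : 0 < ori v x z) (h2 : 0 < ori y v z)
    (h3 : 0 < ori a b z) : ∃ t : ℝ, 0 < t ∧ t ≤ 1 ∧ 0 ≤ (1 - t) * ori v x z + t * ori v x c ∧
      0 ≤ (1 - t) * ori y v z + t * ori y v c ∧ 0 ≤ (1 - t) * ori a b z + t * ori a b c ∧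
      ((1 - t) * ori v x z + t * ori v x c = 0 ∨ (1 - t) * ori y v z + t * ori y v c = 0) := by
  obtain ⟨t, t0, t1, k1, k2, k3, hk⟩ := exists_exit (q₁ := ori v x c) (q₂ := ori y v c)
    (q₃ := ori a b c) h1 h2 h3 (fun h => W.empty c h.1 h.2.1 h.2.2)
  refine ⟨t, t0, t1, k1, k2, k3, ?_⟩
  by_contra hne
  push Not at hne
  -- Otherwise the edge leaves through `a b` at a point `z'` strictly between the rays `v x` and `v
  -- y`, hence strictly between `a` and `b`.
  have k4 : (1 - t) * ori a b z + t * ori a b c = 0 := by tauto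
  replace k1 := lt_of_le_of_ne k1 (Ne.symm hne.1)
  replace k2 := lt_of_le_of_ne k2 (Ne.symm hne.2)
  clear hk hne k3
  set z' : Plane := (1 - t) • z + t • (c : Plane) with hz'
  have z0 : z' 0 = (1 - t) * z 0 + t * (c : Plane) 0 := by simp [hz']
  have z1 : z' 1 = (1 - t) * z 1 + t * (c : Plane) 1 := by simp [hz']
  rw [← ori_combo (by ring) z0 z1] at k1 k2 k4
  have hxy := W.vxy
  have m1 : 0 < ori v a z' := by
    have h : ori v x y * ori v a z' = ori y v z' * ori v a x + ori v x z' * ori v a y := by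
      unfold ori; ring
    have h1 := mul_pos k1 W.vay
    have h2 := mul_nonneg k2.le W.vax
    exact pos_of_mul_pos_right (a := ori v x y) (by linarith) hxy.le
  have m2 : 0 < ori v z' b := by
    have h : ori v x y * ori v z' b = ori y v z' * ori v x b + ori v x z' * ori v y b := by
      unfold ori; ring
    have h1 := mul_pos k2 W.vxb
    have h2 := mul_nonneg k1.le W.vyb
    exact pos_of_mul_pos_right (a := ori v x y) (by linarith) hxy.le
  have hsum : ori v z' b + ori v a z' = ori v a b := by
    have : ori a b z' = ori v a b - ori v z' b - ori v a z' := by unfold ori; ring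
    linarith
  have hab := W.hab
  have hzab : z' ∈ openSegment ℝ (a : Plane) b := by
    rw [mem_openSegment_iff']
    refine ⟨ori v z' b / ori v a b, ori v a z' / ori v a b, by positivity, by positivity, ?_, ?_, ?_⟩
    · rw [← add_div, hsum, div_self hab.ne']
    · field_simp
      have : ori v a b * (z' 0 - (v : Plane) 0) = ori v z' b * ((a : Plane) 0 - (v : Plane) 0) +
        ori v a z' * ((b : Plane) 0 - (v : Plane) 0) := by unfold ori; ring
      linear_combination this - (v : Plane) 0 * hsum
    · field_simp
      have : ori v a b * (z' 1 - (v : Plane) 1) = ori v z' b * ((a : Plane) 1 - (v : Plane) 1) +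
        ori v a z' * ((b : Plane) 1 - (v : Plane) 1) := by unfold ori; ring
      linear_combination this - (v : Plane) 1 * hsum
  -- For `t < 1` two edges cross at `z'`, so they coincide, although `z` is off the line `a b`. For
  -- `t = 1` the point `c` lies inside the edge `a b`.
  rcases t1.lt_or_eq with t1 | rfl
  · have hzcd : z' ∈ openSegment ℝ (c : Plane) d := by
      obtain ⟨s, r, hs, hr, hsr, e0, e1⟩ := mem_openSegment_iff'.1 hz
      rw [mem_openSegment_iff']
      have : 0 < (1 - t) := by linarith
      refine ⟨(1 - t) * s + t, (1 - t) * r, by positivity, by positivity, ?_, ?_, ?_⟩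
      · linear_combination (1 - t) * hsr
      · rw [z0, e0]; ring
      · rw [z1, e1]; ring
    have hedge := edge_eq_of_mem hT W.adj hcd hzab hzcd
    obtain ⟨s, r, hs, hr, hsr, e0, e1⟩ := mem_openSegment_iff'.1 hz
    have := ori_combo hsr e0 e1 (a : Plane) b
    rw [Sym2.eq_iff] at hedge
    rcases hedge with ⟨rfl, rfl⟩ | ⟨rfl, rfl⟩ <;> simp at this <;> linarith
  · have : z' = c := by simp [hz']
    exact notMem_openSegment hS W.adj.ne c (this ▸ hzab)

/-- The conclusion says that the affine function `w + s * D` of `s` is positive at the zero of `z +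
s * F`. This zero is strictly between `-n` and `m`, where the former function is nonnegative, and
that function is positive at `s = 0`. -/
theorem affine_pos_between {F w z D m n : ℝ} (hF : 0 < F) (hw : 0 < w) (h1 : 0 < z + m * F)
    (h2 : z - n * F < 0) (g1 : 0 ≤ w + m * D) (g2 : 0 ≤ w - n * D) : 0 < F * w - z * D := by
  rcases le_total 0 z with hz | hz
  · rcases le_or_gt D 0 with hD | hD
    · linarith [mul_pos hF hw, mul_nonneg hz (neg_nonneg.2 hD)]
    · linarith [mul_nonneg hF.le g2, mul_pos (neg_pos.2 h2) hD]
  · rcases le_or_gt 0 D with hD | hD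
    · linarith [mul_pos hF hw, mul_nonneg (neg_nonneg.2 hz) hD]
    · linarith [mul_nonneg hF.le g1, mul_pos h1 (neg_pos.2 hD)]

/-- No edge meets the interior of the wedge. -/
theorem Wedge.no_edge (hS : InGeneralPosition S) (hT : IsCrossingFree T)
    (W : Wedge T d₀ d₁ v a b x y) {c d : S} (hcd : T.Adj c d) {z : Plane}
    (hz : z ∈ openSegment ℝ (c : Plane) d) (h1 : 0 < ori v x z) (h2 : 0 < ori y v z)
    (h3 : 0 < ori a b z) : False := by
  obtain ⟨t, t0, t1, k1, k2, k3, hk⟩ := W.exit hS hT hcd hz h1 h2 h3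
  obtain ⟨u, u0, u1, l1, l2, l3, hl⟩ :=
    W.exit hS hT hcd.symm (by rwa [openSegment_symm]) h1 h2 h3
  obtain ⟨s, r, hs, hr, hsr, e0, e1⟩ := mem_openSegment_iff'.1 hz
  have c1 := ori_combo hsr e0 e1 (v : Plane) x
  have c2 := ori_combo hsr e0 e1 (y : Plane) v
  have c3 := ori_combo hsr e0 e1 (a : Plane) b
  have cf := dev_combo hsr e0 e1 d₀ d₁ v
  -- the function values at the two exits average to a positive multiple of the value at `z`
  have avg : ∀ p q w : ℝ, w = s * p + r * q →
      s * u * ((1 - t) * w + t * p) + r * t * ((1 - u) * w + u * q) = (s * u + r * t) * w := by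
    intro p q w h; rw [h]; ring_nf
    obtain rfl : s = 1 - r := by linarith
    ring
  have su : 0 < s * u := mul_pos hs u0
  have rt : 0 < r * t := mul_pos hr t0
  -- The edge leaves the wedge through `v x` towards `c` and through `v y` towards `d`. It then
  -- meets the ray in front of `v` and before `a b`, against `hmin`.
  have key : ∀ c d : S, T.Adj c d → ∀ s r t u : ℝ, 0 < s → 0 < r → s + r = 1 → 0 < t → t ≤ 1 →
      0 < u → u ≤ 1 → z 0 = s * (c : Plane) 0 + r * (d : Plane) 0 →
      z 1 = s * (c : Plane) 1 + r * (d : Plane) 1 →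
      (1 - t) * ori v x z + t * ori v x c = 0 → 0 < (1 - t) * ori y v z + t * ori y v c →
      0 < (1 - u) * ori v x z + u * ori v x d → (1 - u) * ori y v z + u * ori y v d = 0 →
      0 ≤ (1 - t) * ori a b z + t * ori a b c → 0 ≤ (1 - u) * ori a b z + u * ori a b d →
      False := by
    clear avg su rt cf c1 c2 c3 hz hcd e0 e1 hs hr hsr t0 t1 u0 u1 k1 k2 k3 l1 l2 l3 hk hl
    clear c d s r t u
    intro c d hcd s r t u hs hr hsr t0 t1 u0 u1 e0 e1 k1 k2 l1 l2 k3 l3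
    have hxy := W.vxy
    have cf := dev_combo hsr e0 e1 d₀ d₁ v
    have c1 := ori_combo hsr e0 e1 (v : Plane) x
    have c2 := ori_combo hsr e0 e1 (y : Plane) v
    have c3 := ori_combo hsr e0 e1 (a : Plane) b
    have dec : ∀ w : Plane, ori v x y * dev d₀ d₁ v w =
        ori y v w * dev d₀ d₁ v x + ori v x w * dev d₀ d₁ v y := by
      intro w; unfold ori dev; ring
    have f1 : 0 < (1 - t) * dev d₀ d₁ v z + t * dev d₀ d₁ v c := by
      have : ori v x y * ((1 - t) * dev d₀ d₁ v z + t * dev d₀ d₁ v c) =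
        ((1 - t) * ori y v z + t * ori y v c) * dev d₀ d₁ v x := by
        linear_combination (1 - t) * dec z + t * dec c + dev d₀ d₁ v y * k1
      exact pos_of_mul_pos_right (a := ori v x y) (this ▸ mul_pos k2 W.fx) hxy.le
    have f2 : (1 - u) * dev d₀ d₁ v z + u * dev d₀ d₁ v d < 0 := by
      have : ori v x y * ((1 - u) * dev d₀ d₁ v z + u * dev d₀ d₁ v d) =
        ((1 - u) * ori v x z + u * ori v x d) * dev d₀ d₁ v y := by
        linear_combination (1 - u) * dec z + u * dec d + dev d₀ d₁ v x * l2
      exact neg_of_mul_neg_right (a := ori v x y) (this ▸ mul_neg_of_pos_of_neg l1 W.fy) hxy.le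
    -- slopes along the edge
    set F := dev d₀ d₁ v c - dev d₀ d₁ v d with hF
    have ec : dev d₀ d₁ v c = dev d₀ d₁ v z + r * F := by
      rw [cf, hF]; linear_combination (-dev d₀ d₁ v c) * hsr
    have ed : dev d₀ d₁ v d = dev d₀ d₁ v z - s * F := by
      rw [cf, hF]; linear_combination (-dev d₀ d₁ v d) * hsr
    have f1' : 0 < dev d₀ d₁ v z + (t * r) * F := by rw [ec] at f1; linarith
    have f2' : dev d₀ d₁ v z - (u * s) * F < 0 := by rw [ed] at f2; linarith
    have tr : 0 < t * r := mul_pos t0 hr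
    have us : 0 < u * s := mul_pos u0 hs
    have Fpos : 0 < F := by
      have : 0 < (t * r + u * s) * F := by linarith
      exact pos_of_mul_pos_right this (by positivity)
    have fc : 0 < dev d₀ d₁ v c := by
      rw [ec]
      linarith [mul_nonneg (mul_nonneg (sub_nonneg.2 t1) hr.le) Fpos.le]
    have fd : dev d₀ d₁ v d < 0 := by
      rw [ed]
      linarith [mul_nonneg (mul_nonneg (sub_nonneg.2 u1) hs.le) Fpos.le]
    -- values at the point of the edge on the axis
    have aff : ∀ p q w : ℝ, w = s * p + r * q → 0 < w → 0 ≤ (1 - t) * w + t * p →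
        0 ≤ (1 - u) * w + u * q → 0 < - dev d₀ d₁ v d * p + dev d₀ d₁ v c * q := by
      intro p q w hw w0 h1 h2
      have e1 : - dev d₀ d₁ v d * p + dev d₀ d₁ v c * q = F * w - dev d₀ d₁ v z * (p - q) := by
        rw [hw, ec, ed]; ring
      rw [e1]
      refine affine_pos_between Fpos w0 f1' f2' ?_ ?_
      · have : (1 - t) * w + t * p = w + (t * r) * (p - q) := by
          rw [hw]; linear_combination (-t * p) * hsr
        linarith
      · have : (1 - u) * w + u * q = w - (u * s) * (p - q) := by
          rw [hw]; linear_combination (-u * q) * hsr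
        linarith
    have A1 := aff _ _ _ c1 h1 k1.ge l1.le
    have A3 := aff _ _ _ c3 h3 k3 l3
    have vcd : 0 < ori v c d := by
      have : dev d₀ d₁ v x * ori v c d =
          - dev d₀ d₁ v d * ori v x c + dev d₀ d₁ v c * ori v x d := by unfold ori dev; ring
      exact pos_of_mul_pos_right (a := dev d₀ d₁ v x) (this ▸ A1) W.fx.le
    have := W.hmin c d hcd fc fd vcd
    -- The left side is a positive multiple of `ori a b` at the point where `c d` meets the ray, so
    -- `A3` places this point strictly on the side of `a b` that contains `v`.
    have e : - dev d₀ d₁ v d * ori a b c + dev d₀ d₁ v c * ori a b d =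
        ori v a b * (dev d₀ d₁ v c - dev d₀ d₁ v d) -
        ori v c d * (dev d₀ d₁ v a - dev d₀ d₁ v b) := by unfold ori dev; ring
    linarith
  have a1 := avg _ _ _ c1
  have a2 := avg _ _ _ c2
  have p1 : 0 < (s * u + r * t) * ori v x z := by positivity
  have p2 : 0 < (s * u + r * t) * ori y v z := by positivity
  -- The two exits are not both on the line `v x`: a positive average of the values there is a
  -- positive multiple of the value at `z`.
  have n1 : ¬ ((1 - t) * ori v x z + t * ori v x c = 0 ∧
      (1 - u) * ori v x z + u * ori v x d = 0) := by
    rintro ⟨h, h'⟩; rw [h, h'] at a1; linarith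
  have n2 : ¬ ((1 - t) * ori y v z + t * ori y v c = 0 ∧
      (1 - u) * ori y v z + u * ori y v d = 0) := by
    rintro ⟨h, h'⟩; rw [h, h'] at a2; linarith
  rcases hk with hk | hk <;> rcases hl with hl | hl
  · exact n1 ⟨hk, hl⟩
  · refine key c d hcd s r t u hs hr hsr t0 t1 u0 u1 e0 e1 hk ?_ ?_ hl k3 l3
    · exact lt_of_le_of_ne k2 (fun h => n2 ⟨h.symm, hl⟩)
    · exact lt_of_le_of_ne l1 (fun h => n1 ⟨hk, h.symm⟩)
  · refine key d c hcd.symm r s u t hr hs (by linarith) u0 u1 t0 t1 (by linarith) (by linarith)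
      hl ?_ ?_ hk l3 k3
    · exact lt_of_le_of_ne l2 (fun h => n2 ⟨hk, h.symm⟩)
    · exact lt_of_le_of_ne k1 (fun h => n1 ⟨h.symm, hl⟩)
  · exact n2 ⟨hk, hl⟩

end

/-! ### Triangular faces from maximality -/

section
variable {S : Finset Plane} {T : SimpleGraph S}

/-- The triangle `u v w` is a counterclockwise bounded face of `T`. -/
structure IsTri (T : SimpleGraph S) (u v w : S) : Prop where
  pos : 0 < ori u v w
  uv : T.Adj u v
  vw : T.Adj v w
  wu : T.Adj w u
  empty : ∀ z : S, 0 < ori u v z → 0 < ori v w z → 0 < ori w u z → False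

theorem IsTri.rotate {u v w : S} (h : IsTri T u v w) : IsTri T v w u :=
  ⟨by rw [ori_rotate]; exact h.pos, h.vw, h.wu, h.uv, fun z h1 h2 h3 => h.empty z h3 h1 h2⟩

variable {d₀ d₁ : ℝ} {v a b x y : S}

theorem mem_openSegment_near {c d z : Plane} (hz : z ∈ openSegment ℝ c d) {t : ℝ} (ht0 : 0 ≤ t)
    (ht : t < 1) : (1 - t) • z + t • c ∈ openSegment ℝ c d := by
  obtain ⟨s, r, hs, hr, hsr, e0, e1⟩ := mem_openSegment_iff'.1 hz
  rw [mem_openSegment_iff']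
  have : 0 < (1 - t) := by linarith
  refine ⟨(1 - t) * s + t, (1 - t) * r, by positivity, by positivity, ?_, ?_, ?_⟩
  · linear_combination (1 - t) * hsr
  · simp [e0]; ring
  · simp [e1]; ring

/-- If the open segment `v x` bounds the wedge and an edge crosses it into the wedge, then the edge
meets the interior of the wedge. -/
theorem Wedge.no_edge_of_tendsto (hS : InGeneralPosition S) (hT : IsCrossingFree T)
    (W : Wedge T d₀ d₁ v a b x y) {c d : S} (hcd : T.Adj c d) {z : Plane}
    (hz : z ∈ openSegment ℝ (c : Plane) d) (h1 : 0 ≤ ori v x z) (h2 : 0 ≤ ori y v z)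
    (h3 : 0 < ori a b z) (h1' : 0 < ori v x z ∨ 0 < ori v x c)
    (h2' : 0 < ori y v z ∨ 0 < ori y v c) : False := by
  -- a point slightly further towards `c`
  have key : ∀ p q : ℝ, 0 ≤ p → (0 < p ∨ 0 < q) →
      ∃ ε : ℝ, 0 < ε ∧ ∀ t, 0 < t → t < ε → 0 < (1 - t) * p + t * q := by
    intro p q hp hpq
    rcases hp.lt_or_eq with hp | rfl
    · refine ⟨p / (p + |q|), by positivity, fun t ht0 ht => ?_⟩
      rw [lt_div_iff₀ (by positivity)] at ht
      have := neg_abs_le q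
      nlinarith [mul_le_mul_of_nonneg_left this ht0.le]
    · refine ⟨1, one_pos, fun t ht0 ht => ?_⟩
      have : 0 < q := by simpa using hpq
      have := mul_pos ht0 this
      linarith
  obtain ⟨e1, e1p, k1⟩ := key _ _ h1 h1'
  obtain ⟨e2, e2p, k2⟩ := key _ _ h2 h2'
  obtain ⟨e3, e3p, k3⟩ := key _ (ori a b c) h3.le (Or.inl h3)
  obtain ⟨t, ht0, ht⟩ := exists_between (lt_min (lt_min e1p e2p) (lt_min e3p one_pos))
  simp only [lt_min_iff] at ht
  have z0 : ((1 - t) • z + t • (c : Plane)) 0 = (1 - t) * z 0 + t * (c : Plane) 0 := by simp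
  have z1 : ((1 - t) • z + t • (c : Plane)) 1 = (1 - t) * z 1 + t * (c : Plane) 1 := by simp
  refine W.no_edge hS hT hcd (mem_openSegment_near hz ht0.le ht.2.2) ?_ ?_ ?_ <;>
    rw [ori_combo (by ring) z0 z1]
  · exact k1 t ht0 ht.1.1
  · exact k2 t ht0 ht.1.2
  · exact k3 t ht0 ht.2.1

/-- An edge crossing a side of `v x y` would have points inside the wedge, so no edge crosses and
maximality supplies the sides. The only exception is `x y = a b`, which is already an edge. -/
theorem Wedge.isTri (hS : InGeneralPosition S) (hT : IsTriangulation T)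
    (W : Wedge T d₀ d₁ v a b x y) : IsTri T v x y := by
  have hxy := W.vxy
  have hab : 0 < ori a b v := by rw [ori_rotate]; exact W.hab
  have hvx : v ≠ x := by rintro rfl; simp at hxy
  have hvy : v ≠ y := by rintro rfl; simp at hxy
  have hxney : x ≠ y := by rintro rfl; simp at hxy
  have hyvx : 0 < ori y v x := by rw [← ori_rotate]; exact hxy
  refine ⟨hxy, ?_, ?_, ?_, ?_⟩
  · refine adj_of_uncrossed hS hT hvx fun c d hcd _ z hz hz' _ hd => ?_
    obtain ⟨s, r, hs, hr, hsr, e0, e1⟩ := mem_openSegment_iff'.1 hz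
    refine W.no_edge_of_tendsto hS hT.1 hcd.symm (by rwa [openSegment_symm]) (z := z) ?_ ?_ ?_
      (Or.inr hd) ?_
    · rw [ori_combo hsr e0 e1]; simp
    · rw [ori_combo hsr e0 e1]; simp; positivity
    · rw [ori_combo hsr e0 e1]
      have := mul_pos hs hab
      have := mul_nonneg hr.le W.abx
      linarith
    · left; rw [ori_combo hsr e0 e1]; simp; positivity
  · by_cases hxa : ori a b x = 0 ∧ ori a b y = 0
    · obtain rfl : x = a := by
        rcases eq_or_eq_of_ori_eq_zero hS W.adj.ne hxa.1 with h | rfl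
        · exact h
        · exact absurd W.fx W.fb.not_gt
      obtain rfl : y = b := by
        rcases eq_or_eq_of_ori_eq_zero hS W.adj.ne hxa.2 with rfl | h
        · exact absurd W.fy W.fx.not_gt
        · exact h
      exact W.adj
    · refine adj_of_uncrossed hS hT hxney fun c d hcd _ z hz hz' _ hd => ?_
      obtain ⟨s, r, hs, hr, hsr, e0, e1⟩ := mem_openSegment_iff'.1 hz
      refine W.no_edge hS hT.1 hcd hz' ?_ ?_ ?_ <;> rw [ori_combo hsr e0 e1]
      · simp; positivity
      · simp; positivity
      · have h1 := mul_nonneg hs.le W.abx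
        have h2 := mul_nonneg hr.le W.aby
        rcases W.abx.lt_or_eq with h | h
        · linarith [mul_pos hs h]
        · rcases W.aby.lt_or_eq with h' | h'
          · linarith [mul_pos hr h']
          · exact absurd ⟨h.symm, h'.symm⟩ hxa
  · refine (adj_of_uncrossed hS hT hvy fun c d hcd _ z hz hz' hc _ => ?_).symm
    obtain ⟨s, r, hs, hr, hsr, e0, e1⟩ := mem_openSegment_iff'.1 hz
    have hc' : 0 < ori y v c := by rw [ori_swap]; linarith
    refine W.no_edge_of_tendsto hS hT.1 hcd hz' ?_ ?_ ?_ ?_ (Or.inr hc')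
    · rw [ori_combo hsr e0 e1]; simp; positivity
    · rw [ori_combo hsr e0 e1]; simp
    · rw [ori_combo hsr e0 e1]
      have := mul_pos hs hab
      have := mul_nonneg hr.le W.aby
      linarith
    · left; rw [ori_combo hsr e0 e1]; simp; positivity
  · intro z h1 h2 h3
    refine W.empty z h1 h3 ?_
    have : ori v x y * ori a b z = ori x y z * ori a b v + ori y v z * ori a b x +
        ori v x z * ori a b y := by unfold ori; ring
    have g1 := mul_pos h2 hab
    have g2 := mul_nonneg h3.le W.abx
    have g3 := mul_nonneg h1.le W.aby
    exact pos_of_mul_pos_right (a := ori v x y) (by linarith) hxy.le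

theorem sq_add_sq_pos_of_dev {v s : Plane} (h : dev d₀ d₁ v s ≠ 0) : 0 < d₀ ^ 2 + d₁ ^ 2 := by
  by_cases h0 : d₀ = 0
  · have h1 : d₁ ≠ 0 := by rintro rfl; simp [dev, h0] at h
    positivity
  · positivity

/-- In a triangulation, the direction `(d₀, d₁)` at `v` points into a face that is a triangle, unless
it leaves the convex hull. -/
theorem exists_isTri (hS : InGeneralPosition S) (hT : IsTriangulation T)
    (hd : ∀ s : S, s ≠ v → dev d₀ d₁ v s ≠ 0) {p q : S} (hq : 0 < dev d₀ d₁ v q)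
    (hp : dev d₀ d₁ v p < 0) (hqp : 0 < ori v q p) :
    ∃ x y : S, IsTri T v x y ∧ 0 < dev d₀ d₁ v x ∧ dev d₀ d₁ v y < 0 := by
  classical
  set f := fun s : S => dev d₀ d₁ v s with hf
  let P : Finset (S × S) := Finset.univ.filter fun e => 0 < f e.1 ∧ f e.2 < 0 ∧ 0 < ori v e.1 e.2
  let η : S × S → ℝ := fun e => ori v e.1 e.2 / (f e.1 - f e.2)
  -- some edge is hit
  have hedge : ∃ e ∈ P, T.Adj e.1 e.2 := by
    -- Among all pairs of points whose segment meets the ray, adjacent or not, one met farthest out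
    -- has all of `S` on one side and is therefore an edge.
    obtain ⟨⟨a, b⟩, he, hmax⟩ := P.exists_max_image η ⟨(q, p), by simp [P, *]⟩
    refine ⟨(a, b), he, ?_⟩
    simp only [P, Finset.mem_filter, Finset.mem_univ, true_and] at he
    obtain ⟨fa, fb, hab⟩ := he
    have hmax' : ∀ c d : S, 0 < f c → f d < 0 → 0 < ori v c d →
        ori v c d * (f a - f b) ≤ ori v a b * (f c - f d) := by
      intro c d hc hd' hcd
      have := hmax (c, d) (by simp [P, hc, hd', hcd])
      simp only [η] at this
      rwa [div_le_div_iff₀ (by linarith) (by linarith)] at this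
    have hall : ∀ z : S, 0 ≤ ori a b z := by
      intro z
      by_contra hz
      push Not at hz
      have hzv : z ≠ v := by
        rintro rfl
        have : ori a b z = ori z a b := ori_rotate _ _ _
        linarith
      rcases lt_or_gt_of_ne (hd z hzv) with hfz | hfz
      · have e : ori v a z * (f a - f b) = ori v a b * (f a - f z) - f a * ori a b z := by
          simp only [hf]; unfold ori dev; ring
        have h1 : 0 < - f a * ori a b z := by
          have := mul_neg_of_pos_of_neg fa hz; linarith
        have h2 : 0 < ori v a b * (f a - f z) := mul_pos hab (sub_pos.2 (hfz.trans fa))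
        have h3 : 0 < ori v a z :=
          pos_of_mul_pos_left (b := f a - f b) (by linarith) (by linarith)
        have := hmax' a z fa hfz h3
        linarith
      · have e : ori v z b * (f a - f b) = ori v a b * (f z - f b) + f b * ori a b z := by
          simp only [hf]; unfold ori dev; ring
        have h1 : 0 < f b * ori a b z := mul_pos_of_neg_of_neg fb hz
        have h2 : 0 < ori v a b * (f z - f b) := mul_pos hab (sub_pos.2 (fb.trans hfz))
        have h3 : 0 < ori v z b :=
          pos_of_mul_pos_left (b := f a - f b) (by linarith) (by linarith)
        have := hmax' z b hfz fb h3
        linarith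
    refine adj_of_uncrossed hS hT ?_ fun c d _ _ _ _ _ hc _ => absurd hc (hall c).not_gt
    intro h
    change a = b at h
    rw [h] at fa
    exact absurd fa fb.not_gt
  obtain ⟨⟨a, b⟩, he, hmin⟩ := (P.filter fun e => T.Adj e.1 e.2).exists_min_image η (by
    obtain ⟨e, he, h⟩ := hedge
    exact ⟨e, by simp [he, h]⟩)
  simp only [P, Finset.mem_filter, Finset.mem_univ, true_and] at he
  obtain ⟨⟨fa, fb, hab⟩, hadj⟩ := he
  -- The quotient is the cotangent of the angle between the ray and `v x`, so its maximum is
  -- attained closest to the ray.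
  obtain ⟨x, hx, hxmax⟩ := (Finset.univ.filter fun x : S => 0 < f x ∧ 0 ≤ ori a b x ∧
    0 ≤ ori v a x).exists_max_image
      (fun x : S => (((x : Plane) 0 - (v : Plane) 0) * d₀ + ((x : Plane) 1 - (v : Plane) 1) * d₁) / f x)
      ⟨a, by simp [fa]⟩
  obtain ⟨y, hy, hymax⟩ := (Finset.univ.filter fun y : S => f y < 0 ∧ 0 ≤ ori a b y ∧
    0 ≤ ori v y b).exists_max_image
      (fun x : S => (((x : Plane) 0 - (v : Plane) 0) * d₀ + ((x : Plane) 1 - (v : Plane) 1) * d₁) / (- f x))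
      ⟨b, by simp [fb]⟩
  simp only [Finset.mem_filter, Finset.mem_univ, true_and] at hx hy hxmax hymax
  obtain ⟨fx, abx, vax⟩ := hx
  obtain ⟨fy, aby, vyb⟩ := hy
  have hD : 0 < d₀ ^ 2 + d₁ ^ 2 := sq_add_sq_pos_of_dev hq.ne'
  have W : Wedge T d₀ d₁ v a b x y := by
    refine ⟨hadj, fa, fb, hab, ?_, fx, abx, vax, fy, aby, vyb, ?_⟩
    · intro c d hcd hc hd' hcd'
      have := hmin (c, d) (by simp [P, hf, hc, hd', hcd', hcd])
      simp only [η] at this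
      rwa [div_le_div_iff₀ (sub_pos.2 (fb.trans fa)) (sub_pos.2 (hd'.trans hc))] at this
    · intro s h1 h2 h3
      have hsv : s ≠ v := by rintro rfl; simp at h1
      rcases lt_or_gt_of_ne (hd s hsv) with hfs | hfs
      · change f s < 0 at hfs
        have h4 : 0 ≤ ori v s b := by
          have h : (- f y) * ori v s b = (- f s) * ori v y b + (- f b) * ori y v s := by
            simp only [hf]; unfold ori dev; ring
          have g1 := mul_nonneg (neg_nonneg.2 hfs.le) vyb
          have g2 := mul_pos (neg_pos.2 fb) h2
          exact (pos_of_mul_pos_right (a := - f y) (by linarith) (by linarith)).le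
        have := hymax s ⟨hfs, h3.le, h4⟩
        rw [div_le_div_iff₀ (by linarith) (by linarith)] at this
        have h : (((s : Plane) 0 - (v : Plane) 0) * d₀ + ((s : Plane) 1 - (v : Plane) 1) * d₁) * (- f y)
          - (((y : Plane) 0 - (v : Plane) 0) * d₀ + ((y : Plane) 1 - (v : Plane) 1) * d₁) * (- f s)
          = (d₀ ^ 2 + d₁ ^ 2) * ori y v s := by
          simp only [hf]; unfold ori dev; ring
        have h5 : (d₀ ^ 2 + d₁ ^ 2) * ori y v s ≤ 0 := by linarith
        linarith [mul_pos hD h2]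
      · change 0 < f s at hfs
        have h4 : 0 ≤ ori v a s := by
          have h : f x * ori v a s = f s * ori v a x + f a * ori v x s := by
            simp only [hf]; unfold ori dev; ring
          have g1 := mul_nonneg hfs.le vax
          have g2 := mul_pos fa h1
          exact (pos_of_mul_pos_right (a := f x) (by linarith) fx.le).le
        have := hxmax s ⟨hfs, h3.le, h4⟩
        rw [div_le_div_iff₀ hfs fx] at this
        have h : (((s : Plane) 0 - (v : Plane) 0) * d₀ + ((s : Plane) 1 - (v : Plane) 1) * d₁) * f x
          - (((x : Plane) 0 - (v : Plane) 0) * d₀ + ((x : Plane) 1 - (v : Plane) 1) * d₁) * f s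
          = (d₀ ^ 2 + d₁ ^ 2) * ori v x s := by
          simp only [hf]; unfold ori dev; ring
        have h5 : (d₀ ^ 2 + d₁ ^ 2) * ori v x s ≤ 0 := by linarith
        linarith [mul_pos hD h1]
  exact ⟨x, y, W.isTri hS hT, fx, fy⟩

end

/-! ### Uniqueness of faces, and inner points -/

section
variable {S : Finset Plane} {T : SimpleGraph S}

theorem exists_small {ι : Type*} [Finite ι] (p q : ι → ℝ) :
    ∃ ε : ℝ, 0 < ε ∧ ∀ i, 0 < p i → 0 < p i + ε * q i := by
  have h : ∀ i, ∀ᶠ ε : ℝ in nhdsWithin 0 (Set.Ioi 0), 0 < p i → 0 < p i + ε * q i := by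
    intro i
    by_cases hi : 0 < p i
    · have hc : Continuous fun ε : ℝ => p i + ε * q i := by fun_prop
      have : ∀ᶠ ε : ℝ in nhds 0, 0 < p i + ε * q i :=
        hc.continuousAt.eventually (lt_mem_nhds (by simpa using hi))
      filter_upwards [nhdsWithin_le_nhds this] with ε hε _ using hε
    · exact Filter.Eventually.of_forall fun _ h => absurd h hi
  obtain ⟨ε, hε, hpos⟩ := ((Filter.eventually_all.2 h).and self_mem_nhdsWithin).exists
  exact ⟨ε, hpos, hε⟩

theorem exists_generic {ι : Type*} [Finite ι] (p q : ι → ℝ) (h : ∀ i, p i ≠ 0 ∨ q i ≠ 0) :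
    ∃ t : ℝ, ∀ i, p i + t * q i ≠ 0 := by
  have hfin : (⋃ i, {t : ℝ | p i + t * q i = 0}).Finite := by
    refine Set.finite_iUnion fun i => Set.Subsingleton.finite ?_
    intro s hs t ht
    simp only [Set.mem_ofPred_eq] at hs ht
    by_cases hq : q i = 0
    · have := h i
      rw [hq] at hs this
      simp at hs this
      exact absurd hs this
    · apply mul_right_cancel₀ hq
      linarith
  obtain ⟨t, ht⟩ := hfin.infinite_compl.nonempty
  refine ⟨t, fun i hi => ht (Set.mem_iUnion.2 ⟨i, hi⟩)⟩

/-- No edge at `v` enters the angle of a face at `v`. -/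
theorem IsTri.not_cone (hS : InGeneralPosition S) (hT : IsCrossingFree T) {v x y z : S}
    (h : IsTri T v x y) (hz : T.Adj v z) (h1 : 0 < ori v x z) (h2 : 0 < ori v z y) : False := by
  have e : ori x y z = ori v x y - ori v x z - ori v z y := by unfold ori; ring
  have hxy := h.pos
  -- According as `z` is beyond, on or before the line `x y`: the edge `v z` crosses `x y`, or `z`
  -- is `x` or `y`, or `z` lies inside the face.
  rcases lt_trichotomy (ori x y z) 0 with h3 | h3 | h3
  · set σ := ori v x z + ori v z y with hσ
    have σpos : 0 < σ := by positivity
    have i0 : ori v x y * ((z : Plane) 0 - (v : Plane) 0) = ori v z y * ((x : Plane) 0 - (v : Plane) 0) +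
        ori v x z * ((y : Plane) 0 - (v : Plane) 0) := by unfold ori; ring
    have i1 : ori v x y * ((z : Plane) 1 - (v : Plane) 1) = ori v z y * ((x : Plane) 1 - (v : Plane) 1) +
        ori v x z * ((y : Plane) 1 - (v : Plane) 1) := by unfold ori; ring
    set w : Plane := (ori v z y / σ) • (x : Plane) + (ori v x z / σ) • (y : Plane) with hw
    have m1 : w ∈ openSegment ℝ (x : Plane) y :=
      ⟨ori v z y / σ, ori v x z / σ, by positivity, by positivity, by
        rw [← add_div, add_comm, div_self σpos.ne'], rfl⟩
    have m2 : w ∈ openSegment ℝ (v : Plane) z := by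
      rw [mem_openSegment_iff']
      refine ⟨1 - ori v x y / σ, ori v x y / σ, ?_, by positivity, by ring, ?_, ?_⟩
      · rw [sub_pos, div_lt_one σpos]; linarith
      · simp [hw]; field_simp; linear_combination (-1 : ℝ) * i0 - (v : Plane) 0 * hσ
      · simp [hw]; field_simp; linear_combination (-1 : ℝ) * i1 - (v : Plane) 1 * hσ
    have := edge_eq_of_mem hT hz h.vw m2 m1
    rw [Sym2.eq_iff] at this
    rcases this with ⟨rfl, -⟩ | ⟨rfl, -⟩ <;> simp at hxy
  · rcases eq_or_eq_of_ori_eq_zero hS h.vw.ne h3 with rfl | rfl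
    · simp at h1
    · simp at h2
  · exact h.empty z h1 h3 (by rw [← ori_rotate]; exact h2)

theorem IsTri.unique (hS : InGeneralPosition S) (hT : IsCrossingFree T) {u v w w' : S}
    (h : IsTri T u v w) (h' : IsTri T u v w') : w = w' := by
  by_contra hne
  have hu : u ≠ w := h.wu.ne.symm
  have hu' : u ≠ w' := h'.wu.ne.symm
  rcases lt_or_gt_of_ne (ori_ne_zero hS hu hu' hne) with h1 | h1
  · rw [ori_swap_right] at h1
    exact h.not_cone hS hT h'.wu.symm h'.pos (by linarith)
  · exact h'.not_cone hS hT h.wu.symm h.pos h1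

/-- Two different faces entered by the same direction would overlap near `v`, so that an edge of one
enters the angle of the other. -/
theorem IsTri.unique_dir (hS : InGeneralPosition S) (hT : IsCrossingFree T) {d₀ d₁ : ℝ}
    {v x y x' y' : S} (h : IsTri T v x y) (h' : IsTri T v x' y') (hx : 0 < dev d₀ d₁ v x)
    (hy : dev d₀ d₁ v y < 0) (hx' : 0 < dev d₀ d₁ v x') (hy' : dev d₀ d₁ v y' < 0) :
    x = x' ∧ y = y' := by
  have key : ∀ x y x' y' : S, IsTri T v x y → IsTri T v x' y' → 0 < dev d₀ d₁ v x →
      dev d₀ d₁ v y < 0 → 0 < dev d₀ d₁ v x' → 0 < ori v x x' → False := by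
    intro x y x' y' h h' hx hy hx' h1
    refine h.not_cone hS hT h'.uv h1 ?_
    have e : dev d₀ d₁ v x * ori v x' y =
        dev d₀ d₁ v x' * ori v x y - dev d₀ d₁ v y * ori v x x' := by unfold ori dev; ring
    have := mul_pos hx' h.pos
    have := mul_pos (neg_pos.2 hy) h1
    exact pos_of_mul_pos_right (a := dev d₀ d₁ v x) (by linarith) hx.le
  obtain rfl : x = x' := by
    by_contra hne
    rcases lt_or_gt_of_ne (ori_ne_zero hS h.uv.ne h'.uv.ne hne) with h1 | h1
    · rw [ori_swap_right] at h1
      exact key x' y' x y h' h hx' hy' hx (by linarith)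
    · exact key x y x' y' h h' hx hy hx' h1
  exact ⟨rfl, h.unique hS hT h'⟩

/-- An edge of a triangulation that has points to its left bounds a face on its left. -/
theorem exists_isTri_left (hS : InGeneralPosition S) (hT : IsTriangulation T) {u v p : S}
    (huv : T.Adj u v) (hp : 0 < ori u v p) : ∃ w, IsTri T u v w := by
  -- Look from `u` along `v - u` plus a small multiple of `p - u`: no point off the line `u v`
  -- changes side, and `v` comes to lie just right of the ray. The face seen then has the side `u
  -- v`.
  obtain ⟨ε, ε0, hε⟩ := exists_small (ι := S ⊕ S)
    (Sum.elim (fun s => ori u v s) (fun s => - ori u v s))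
    (Sum.elim (fun s => ori u p s) (fun s => - ori u p s))
  have hl : ∀ s : S, 0 < ori u v s → 0 < ori u v s + ε * ori u p s := fun s => hε (Sum.inl s)
  have hr : ∀ s : S, ori u v s < 0 → ori u v s + ε * ori u p s < 0 := by
    intro s hs
    have := hε (Sum.inr s) (by simpa using hs)
    simp at this
    linarith
  set d₀ : ℝ := ((v : Plane) 0 - (u : Plane) 0) + ε * ((p : Plane) 0 - (u : Plane) 0) with hd0
  set d₁ : ℝ := ((v : Plane) 1 - (u : Plane) 1) + ε * ((p : Plane) 1 - (u : Plane) 1) with hd1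
  have hdev : ∀ s : S, dev d₀ d₁ u s = -(ori u v s + ε * ori u p s) := by
    intro s; rw [hd0, hd1]; unfold dev ori; ring
  have hupv : ori u p v = - ori u v p := ori_swap_right _ _ _
  have hv : 0 < dev d₀ d₁ u v := by
    rw [hdev, hupv]; simp; positivity
  have hpne : dev d₀ d₁ u p < 0 := by
    rw [hdev]; simp; exact hp
  obtain ⟨x, y, h, hx, hy⟩ := exists_isTri (d₀ := d₀) (d₁ := d₁) hS hT (v := u) (p := p) (q := v)
    (by
      intro s hs
      by_cases hsv : s = v
      · rw [hsv]; exact hv.ne'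
      · rw [hdev]
        rcases lt_or_gt_of_ne (ori_ne_zero hS huv.ne (Ne.symm hs) (Ne.symm hsv)) with h | h
        · have := hr s h; linarith
        · have := hl s h; linarith) hv hpne hp
  rw [hdev] at hx hy
  have hvx : x = v := by
    by_contra hne
    rcases lt_or_gt_of_ne (ori_ne_zero hS huv.ne h.uv.ne (Ne.symm hne)) with h1 | h1
    · have hyv : v ≠ y := by
        rintro rfl
        rw [hupv] at hy
        simp at hy
        linarith [mul_pos ε0 hp]
      refine h.not_cone hS hT.1 huv (by rw [ori_swap_right]; linarith) ?_
      rcases lt_or_gt_of_ne (ori_ne_zero hS huv.ne h.wu.ne.symm hyv) with h2 | h2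
      · have := hr y h2; linarith
      · exact h2
    · have := hl x h1; linarith
  exact ⟨y, hvx ▸ h⟩

/-- A point of `S` all around which there are points of `S`. -/
def IsInner (v : S) : Prop :=
  ∀ d₀ d₁ : ℝ, d₀ ≠ 0 ∨ d₁ ≠ 0 → ∃ s : S, 0 < dev d₀ d₁ v s

/-- The neighbours of `v` in `G` surround `v`. -/
def Surrounded (G : SimpleGraph S) (v : S) : Prop :=
  ∀ d₀ d₁ : ℝ, d₀ ≠ 0 ∨ d₁ ≠ 0 → ∃ w : S, G.Adj v w ∧ 0 < dev d₀ d₁ v w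

theorem dev_neg (d₀ d₁ : ℝ) (v s : Plane) : dev (-d₀) (-d₁) v s = - dev d₀ d₁ v s := by
  unfold dev; ring

theorem ori_eq_dev (u v s : Plane) : ori u v s = dev (-(v 0 - u 0)) (-(v 1 - u 1)) u s := by
  unfold dev ori; ring

theorem coord_sub_ne_zero {u v : S} (h : u ≠ v) :
    (v : Plane) 0 - (u : Plane) 0 ≠ 0 ∨ (v : Plane) 1 - (u : Plane) 1 ≠ 0 := by
  by_contra hc
  push Not at hc
  exact h (Subtype.ext (plane_ext (by linarith) (by linarith)))

theorem IsInner.exists_left {v w : S} (h : IsInner v) (hvw : v ≠ w) : ∃ s : S, 0 < ori v w s := by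
  obtain ⟨s, hs⟩ := h _ _ ((coord_sub_ne_zero hvw).imp neg_ne_zero.2 neg_ne_zero.2)
  exact ⟨s, by rwa [ori_eq_dev]⟩

theorem IsInner.exists_right {v w : S} (h : IsInner v) (hvw : v ≠ w) : ∃ s : S, ori v w s < 0 := by
  obtain ⟨s, hs⟩ := h _ _ (coord_sub_ne_zero hvw)
  refine ⟨s, ?_⟩
  rw [ori_eq_dev, dev_neg]
  linarith

/-- Take `q` on the right with the smallest angle to the direction. A point `p` left of `v q` cannot
be on the right of the direction as well, since its angle would be smaller. -/
theorem IsInner.exists_pair {d₀ d₁ : ℝ} {v : S} (h : IsInner v) (hne : d₀ ≠ 0 ∨ d₁ ≠ 0)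
    (hd : ∀ s : S, s ≠ v → dev d₀ d₁ v s ≠ 0) :
    ∃ q p : S, 0 < dev d₀ d₁ v q ∧ dev d₀ d₁ v p < 0 ∧ 0 < ori v q p := by
  classical
  obtain ⟨s₀, hs₀⟩ := h d₀ d₁ hne
  obtain ⟨q, hq, hmax⟩ := (Finset.univ.filter fun s : S => 0 < dev d₀ d₁ v s).exists_max_image
    (fun x : S => (((x : Plane) 0 - (v : Plane) 0) * d₀ + ((x : Plane) 1 - (v : Plane) 1) * d₁) /
      dev d₀ d₁ v x) ⟨s₀, by simpa using hs₀⟩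
  simp only [Finset.mem_filter, Finset.mem_univ, true_and] at hq hmax
  have hqv : v ≠ q := by rintro rfl; simp at hq
  obtain ⟨p, hp⟩ := h.exists_left hqv
  refine ⟨q, p, hq, ?_, hp⟩
  have hpv : p ≠ v := by rintro rfl; simp at hp
  refine lt_of_le_of_ne ?_ (hd p hpv)
  by_contra hpos
  push Not at hpos
  have := hmax p hpos
  rw [div_le_div_iff₀ hpos hq] at this
  have e : (((p : Plane) 0 - (v : Plane) 0) * d₀ + ((p : Plane) 1 - (v : Plane) 1) * d₁) * dev d₀ d₁ v q
    - (((q : Plane) 0 - (v : Plane) 0) * d₀ + ((q : Plane) 1 - (v : Plane) 1) * d₁) * dev d₀ d₁ v p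
    = (d₀ ^ 2 + d₁ ^ 2) * ori v q p := by unfold dev ori; ring
  linarith [mul_pos (sq_add_sq_pos_of_dev hq.ne') hp]

/-- A generic direction, the right normal of `(d₀, d₁)` plus `t` times `(d₀, d₁)`, enters a face at
`v`. It lies between the two edges of that face at `v`, so one of them also points strictly to the
right of `(d₀, d₁)`. -/
theorem IsInner.surrounded (hS : InGeneralPosition S) (hT : IsTriangulation T) {v : S}
    (h : IsInner v) : Surrounded T v := by
  intro d₀ d₁ hne
  have hD : 0 < d₀ ^ 2 + d₁ ^ 2 := by rcases hne with h | h <;> positivity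
  obtain ⟨t, ht⟩ := exists_generic (ι := {s : S // s ≠ v})
    (fun s => -(((s.1 : Plane) 0 - (v : Plane) 0) * d₀ + ((s.1 : Plane) 1 - (v : Plane) 1) * d₁))
    (fun s => dev d₀ d₁ v s.1) (by
      rintro ⟨s, hs⟩
      by_contra hc
      push Not at hc
      obtain ⟨h1, h2⟩ := hc
      unfold dev at h2
      simp only at h1
      have e0 : (d₀ ^ 2 + d₁ ^ 2) * ((s : Plane) 0 - (v : Plane) 0) = 0 := by
        linear_combination (-d₀) * h1 + d₁ * h2
      have e1 : (d₀ ^ 2 + d₁ ^ 2) * ((s : Plane) 1 - (v : Plane) 1) = 0 := by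
        linear_combination (-d₁) * h1 - d₀ * h2
      rcases coord_sub_ne_zero (Ne.symm hs) with h | h
      · exact h ((mul_eq_zero.1 e0).resolve_left hD.ne')
      · exact h ((mul_eq_zero.1 e1).resolve_left hD.ne'))
  have hdev : ∀ s : S, dev (d₁ + t * d₀) (-d₀ + t * d₁) v s =
      -(((s : Plane) 0 - (v : Plane) 0) * d₀ + ((s : Plane) 1 - (v : Plane) 1) * d₁)
       + t * dev d₀ d₁ v s := by intro s; unfold dev; ring
  have hne' : ∀ s : S, s ≠ v → dev (d₁ + t * d₀) (-d₀ + t * d₁) v s ≠ 0 := by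
    intro s hs; rw [hdev]; exact ht ⟨s, hs⟩
  obtain ⟨q, p, hq, hp, hqp⟩ := h.exists_pair (d₀ := d₁ + t * d₀) (d₁ := -d₀ + t * d₁) (by
      by_contra hc
      push Not at hc
      have : d₀ ^ 2 + d₁ ^ 2 = 0 := by linear_combination d₁ * hc.1 - d₀ * hc.2
      exact hD.ne' this) hne'
  obtain ⟨x, y, hxy, hx, hy⟩ := exists_isTri hS hT hne' hq hp hqp
  by_contra hc
  push Not at hc
  have hx' := hc x hxy.uv
  have hy' := hc y hxy.wu.symm
  have e : ori v x y * (d₀ ^ 2 + d₁ ^ 2) = dev (d₁ + t * d₀) (-d₀ + t * d₁) v x * dev d₀ d₁ v y -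
     dev (d₁ + t * d₀) (-d₀ + t * d₁) v y * dev d₀ d₁ v x := by unfold dev ori; ring
  have g1 := mul_pos hxy.pos hD
  have g2 := mul_nonneg hx.le (neg_nonneg.2 hy')
  have g3 := mul_nonneg (neg_nonneg.2 hy.le) (neg_nonneg.2 hx')
  linarith

theorem inner_of_pairs {d₀ d₁ : ℝ} {v q p q' p' : S} (hq : 0 < dev d₀ d₁ v q)
    (hp : dev d₀ d₁ v p < 0) (hqp : 0 < ori v q p) (hq' : 0 < dev d₀ d₁ v q')
    (hp' : dev d₀ d₁ v p' < 0) (hqp' : ori v q' p' < 0) : IsInner v := by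
  intro e₀ e₁ hne
  by_contra hc
  push Not at hc
  -- the direction `(d₀, d₁)` and its opposite are positive combinations of these points
  have i1 : ori v q p * (d₀ * e₁ - d₁ * e₀) = dev d₀ d₁ v q * dev e₀ e₁ v p - dev d₀ d₁ v p * dev e₀ e₁ v q := by
    unfold dev ori; ring
  have i2 : ori v q' p' * (d₀ * e₁ - d₁ * e₀) =
      dev d₀ d₁ v q' * dev e₀ e₁ v p' - dev d₀ d₁ v p' * dev e₀ e₁ v q' := by
    unfold dev ori; ring
  have a1 := mul_nonneg hq.le (neg_nonneg.2 (hc p))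
  have a2 := mul_nonneg (neg_nonneg.2 hp.le) (neg_nonneg.2 (hc q))
  have a3 := mul_nonneg hq'.le (neg_nonneg.2 (hc p'))
  have a4 := mul_nonneg (neg_nonneg.2 hp'.le) (neg_nonneg.2 (hc q'))
  have hz : d₀ * e₁ - d₁ * e₀ = 0 := by
    rcases lt_trichotomy (d₀ * e₁ - d₁ * e₀) 0 with h | h | h
    · linarith [mul_pos_of_neg_of_neg hqp' h]
    · exact h
    · linarith [mul_pos hqp h]
  rw [hz] at i1
  have hep : dev e₀ e₁ v p = 0 := by
    have : dev d₀ d₁ v q * dev e₀ e₁ v p = 0 := by linarith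
    exact (mul_eq_zero.1 this).resolve_left hq.ne'
  have heq : dev e₀ e₁ v q = 0 := by
    have : dev d₀ d₁ v p * dev e₀ e₁ v q = 0 := by linarith
    exact (mul_eq_zero.1 this).resolve_left hp.ne
  have j0 : ori v q p * e₀ = ((q : Plane) 0 - (v : Plane) 0) * (- dev e₀ e₁ v p) +
    ((p : Plane) 0 - (v : Plane) 0) * dev e₀ e₁ v q := by unfold dev ori; ring
  have j1 : ori v q p * e₁ = ((q : Plane) 1 - (v : Plane) 1) * (- dev e₀ e₁ v p) +
    ((p : Plane) 1 - (v : Plane) 1) * dev e₀ e₁ v q := by unfold dev ori; ring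
  rw [hep, heq] at j0 j1
  simp [hqp.ne'] at j0 j1
  tauto

end

/-! ### Counting faces and edges by a generic sweep -/

section
open Classical
variable {S : Finset Plane} {T : SimpleGraph S}

/-- The direction `(d₀, d₁)` is not parallel to any line through two points of `S`. -/
def GenericDir (S : Finset Plane) (d₀ d₁ : ℝ) : Prop :=
  ∀ u v : S, v ≠ u → dev d₀ d₁ u v ≠ 0

theorem exists_genericDir (S : Finset Plane) : ∃ d₀ d₁ : ℝ, GenericDir S d₀ d₁ := by
  obtain ⟨t, ht⟩ := exists_generic (ι := {e : S × S // e.2 ≠ e.1})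
    (fun e => (e.1.1 : Plane) 1 - (e.1.2 : Plane) 1)
    (fun e => (e.1.2 : Plane) 0 - (e.1.1 : Plane) 0) (by
      rintro ⟨⟨u, v⟩, h⟩
      rcases coord_sub_ne_zero (Ne.symm h) with h | h
      · exact Or.inr h
      · left
        rw [← neg_sub]
        exact neg_ne_zero.2 h)
  refine ⟨1, t, fun u v huv => ?_⟩
  have := ht ⟨(u, v), huv⟩
  simp only at this
  unfold dev
  intro h
  exact this (by linarith)

theorem GenericDir.neg {d₀ d₁ : ℝ} (h : GenericDir S d₀ d₁) : GenericDir S (-d₀) (-d₁) := by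
  intro u v huv
  rw [dev_neg]
  exact neg_ne_zero.2 (h u v huv)

theorem GenericDir.ne {d₀ d₁ : ℝ} (h : GenericDir S d₀ d₁) (hc : 2 ≤ S.card) : d₀ ≠ 0 ∨ d₁ ≠ 0 := by
  obtain ⟨a, ha, b, hb, hab⟩ := Finset.one_lt_card.1 hc
  have := h ⟨a, ha⟩ ⟨b, hb⟩ (fun e => hab (congrArg Subtype.val e).symm)
  by_contra hc
  push Not at hc
  simp [dev, hc.1, hc.2] at this

theorem dev_antisymm (d₀ d₁ : ℝ) (u v : Plane) : dev d₀ d₁ v u = - dev d₀ d₁ u v := by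
  unfold dev; ring

theorem dev_trans (d₀ d₁ : ℝ) (u v w : Plane) : dev d₀ d₁ u w = dev d₀ d₁ u v + dev d₀ d₁ v w := by
  unfold dev; ring

/-- There are points of `S` on both sides of `v` whose connecting segment passes over `v`. -/
def HasRoof (d₀ d₁ : ℝ) (v : S) : Prop :=
  ∃ q p : S, 0 < dev d₀ d₁ v q ∧ dev d₀ d₁ v p < 0 ∧ 0 < ori v q p

/-- A generic direction `d` or its opposite points into a face exactly at the middle vertex in the
order across `d`. At each vertex `d` enters at most one face, and it enters one precisely when there
is a roof. -/
theorem card_faces_up (hS : InGeneralPosition S) (hT : IsTriangulation T) {d₀ d₁ : ℝ}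
    (hd : GenericDir S d₀ d₁) :
    (Finset.univ.filter fun t : S × S × S => IsTri T t.1 t.2.1 t.2.2 ∧ 0 < dev d₀ d₁ t.1 t.2.1 ∧
      dev d₀ d₁ t.1 t.2.2 < 0).card = (Finset.univ.filter fun v : S => HasRoof d₀ d₁ v).card := by
  refine Finset.card_bij (fun t _ => t.1) ?_ ?_ ?_
  · rintro ⟨v, x, y⟩ h
    simp only [Finset.mem_filter, Finset.mem_univ, true_and] at h ⊢
    exact ⟨x, y, h.2.1, h.2.2, h.1.pos⟩
  · rintro ⟨v, x, y⟩ h ⟨v', x', y'⟩ h' e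
    simp only [Finset.mem_filter, Finset.mem_univ, true_and] at h h' e
    subst e
    obtain ⟨rfl, rfl⟩ := h.1.unique_dir hS hT.1 h'.1 h.2.1 h.2.2 h'.2.1 h'.2.2
    rfl
  · intro v h
    simp only [Finset.mem_filter, Finset.mem_univ, true_and] at h
    obtain ⟨q, p, hq, hp, hqp⟩ := h
    obtain ⟨x, y, h, hx, hy⟩ := exists_isTri hS hT (fun s hs => hd v s hs) hq hp hqp
    exact ⟨(v, x, y), by simpa using ⟨h, hx, hy⟩, rfl⟩

/-- The points all around which there are points of `S`. -/
noncomputable def innerPoints (S : Finset Plane) : Finset S := Finset.univ.filter IsInner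

/-- Inclusion-exclusion: a point with roofs in both directions is inner, and only the two extreme
points across the direction have no roof at all. -/
theorem card_roofs (hS : InGeneralPosition S) (hc : 2 ≤ S.card) {d₀ d₁ : ℝ}
    (hd : GenericDir S d₀ d₁) :
    (Finset.univ.filter fun v : S => HasRoof d₀ d₁ v).card +
      (Finset.univ.filter fun v : S => HasRoof (-d₀) (-d₁) v).card + 2 =
      (innerPoints S).card + S.card := by
  rw [← Finset.card_union_add_card_inter, ← Finset.filter_and, ← Finset.filter_or]
  have h1 : (Finset.univ.filter fun v : S => HasRoof d₀ d₁ v ∧ HasRoof (-d₀) (-d₁) v) =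
      innerPoints S := by
    ext v
    simp only [innerPoints, Finset.mem_filter, Finset.mem_univ, true_and]
    constructor
    · rintro ⟨⟨q, p, hq, hp, hqp⟩, q', p', hq', hp', hqp'⟩
      rw [dev_neg] at hq' hp'
      refine inner_of_pairs (q' := p') (p' := q') hq hp hqp (by linarith) (by linarith) ?_
      rw [ori_swap_right]; linarith
    · intro h
      exact ⟨h.exists_pair (hd.ne hc) fun s hs => hd v s hs,
        h.exists_pair (hd.neg.ne hc) fun s hs => hd.neg v s hs⟩
  rw [h1]
  have : Nonempty S := by
    obtain ⟨a, ha⟩ := Finset.card_pos.1 (by omega : 0 < S.card)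
    exact ⟨⟨a, ha⟩⟩
  obtain ⟨a, -, ha⟩ := Finset.univ.exists_min_image (fun s : S => dev d₀ d₁ 0 s) Finset.univ_nonempty
  obtain ⟨b, -, hb⟩ := Finset.univ.exists_max_image (fun s : S => dev d₀ d₁ 0 s) Finset.univ_nonempty
  have hsub : ∀ u v : S, dev d₀ d₁ u v = dev d₀ d₁ 0 v - dev d₀ d₁ 0 u := by
    intro u v; unfold dev; ring
  have hab : a ≠ b := by
    rintro rfl
    obtain ⟨s, hs⟩ : ∃ s : S, s ≠ a := by
      have : Nontrivial S := by
        rw [← Fintype.one_lt_card_iff_nontrivial]; simp; omega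
      exact exists_ne a
    have := hd a s hs
    have h1 := ha s (Finset.mem_univ _)
    have h2 := hb s (Finset.mem_univ _)
    rw [hsub] at this
    exact this (by linarith)
  have h2 : (Finset.univ.filter fun v : S => HasRoof d₀ d₁ v ∨ HasRoof (-d₀) (-d₁) v) =
      Finset.univ \ {a, b} := by
    ext v
    simp only [Finset.mem_filter, Finset.mem_univ, true_and, Finset.mem_sdiff, Finset.mem_insert,
      Finset.mem_singleton]
    constructor
    · intro h hv
      have : ∃ q p : S, 0 < dev d₀ d₁ v q ∧ dev d₀ d₁ v p < 0 := by
        rcases h with ⟨q, p, hq, hp, -⟩ | ⟨q, p, hq, hp, -⟩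
        · exact ⟨q, p, hq, hp⟩
        · rw [dev_neg] at hq hp
          exact ⟨p, q, by linarith, by linarith⟩
      obtain ⟨q, p, hq, hp⟩ := this
      rw [hsub] at hq hp
      rcases hv with rfl | rfl
      · have := ha p (Finset.mem_univ _); linarith
      · have := hb q (Finset.mem_univ _); linarith
    · intro hv
      push Not at hv
      have h1 : dev d₀ d₁ v a < 0 := by
        refine lt_of_le_of_ne ?_ (hd v a (Ne.symm hv.1))
        have := ha v (Finset.mem_univ _)
        rw [hsub]; linarith
      have h2 : 0 < dev d₀ d₁ v b := by
        refine lt_of_le_of_ne ?_ (hd v b (Ne.symm hv.2)).symm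
        have := hb v (Finset.mem_univ _)
        rw [hsub]; linarith
      rcases lt_or_gt_of_ne (ori_ne_zero hS hv.2 hv.1 (Ne.symm hab)) with h | h
      · right
        refine ⟨a, b, ?_, ?_, ?_⟩
        · rw [dev_neg]; linarith
        · rw [dev_neg]; linarith
        · rw [ori_swap_right]; linarith
      · exact Or.inl ⟨b, a, h2, h1, h⟩
  rw [h2, Finset.card_sdiff_of_subset (Finset.subset_univ _), Finset.card_pair hab]
  have : (Finset.univ : Finset S).card = S.card := by simp
  omega

/-- The faces of `T`, listed as triples that start with the vertex in the middle with respect to the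
given direction. -/
noncomputable def midFaces (T : SimpleGraph S) (d₀ d₁ : ℝ) : Finset (S × S × S) :=
  Finset.univ.filter fun t => IsTri T t.1 t.2.1 t.2.2 ∧
    ((0 < dev d₀ d₁ t.1 t.2.1 ∧ dev d₀ d₁ t.1 t.2.2 < 0) ∨
      (dev d₀ d₁ t.1 t.2.1 < 0 ∧ 0 < dev d₀ d₁ t.1 t.2.2))

theorem card_midFaces (hS : InGeneralPosition S) (hc : 2 ≤ S.card) (hT : IsTriangulation T)
    {d₀ d₁ : ℝ} (hd : GenericDir S d₀ d₁) :
    (midFaces T d₀ d₁).card + 2 = (innerPoints S).card + S.card := by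
  rw [← card_roofs hS hc hd, ← card_faces_up hS hT hd, ← card_faces_up hS hT hd.neg,
    ← Finset.card_union_of_disjoint]
  · congr 2
    ext ⟨v, x, y⟩
    simp only [midFaces, dev_neg, Finset.mem_filter, Finset.mem_univ, true_and, Finset.mem_union,
      Left.neg_pos_iff, Left.neg_neg_iff]
    tauto
  · rw [Finset.disjoint_left]
    rintro ⟨v, x, y⟩ h h'
    simp only [dev_neg, Finset.mem_filter, Finset.mem_univ, true_and, Left.neg_pos_iff] at h h'
    linarith

/-- The directed edges of `T` that have points of `S` on their left. -/
noncomputable def leftDarts (T : SimpleGraph S) : Finset (S × S) :=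
  Finset.univ.filter fun e => T.Adj e.1 e.2 ∧ ∃ p : S, 0 < ori e.1 e.2 p

/-- A directed edge with points on its left has exactly one face there. Among the three rotations of
the vertex triple of a face, exactly one starts with the middle vertex. -/
theorem card_leftDarts (hS : InGeneralPosition S) (hT : IsTriangulation T)
    {d₀ d₁ : ℝ} (hd : GenericDir S d₀ d₁) :
    (leftDarts T).card = 3 * (midFaces T d₀ d₁).card := by
  let A : Finset (S × S × S) := Finset.univ.filter fun t => IsTri T t.1 t.2.1 t.2.2
  let mid : S → S → S → Prop := fun v x y => (0 < dev d₀ d₁ v x ∧ dev d₀ d₁ v y < 0) ∨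
      (dev d₀ d₁ v x < 0 ∧ 0 < dev d₀ d₁ v y)
  have h1 : (leftDarts T).card = A.card := by
    symm
    refine Finset.card_bij (fun t _ => (t.1, t.2.1)) ?_ ?_ ?_
    · rintro ⟨u, v, w⟩ h
      simp only [A, leftDarts, Finset.mem_filter, Finset.mem_univ, true_and] at h ⊢
      exact ⟨h.uv, w, h.pos⟩
    · rintro ⟨u, v, w⟩ h ⟨u', v', w'⟩ h' e
      simp only [A, Finset.mem_filter, Finset.mem_univ, true_and, Prod.mk.injEq] at h h' e
      obtain ⟨rfl, rfl⟩ := e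
      rw [h.unique hS hT.1 h']
    · rintro ⟨u, v⟩ h
      simp only [leftDarts, Finset.mem_filter, Finset.mem_univ, true_and] at h
      obtain ⟨huv, p, hp⟩ := h
      obtain ⟨w, hw⟩ := exists_isTri_left hS hT huv hp
      exact ⟨(u, v, w), by simpa [A] using hw, rfl⟩
  have hrot : ∀ P : S → S → S → Prop, (A.filter fun t => P t.2.1 t.2.2 t.1).card =
      (A.filter fun t => P t.1 t.2.1 t.2.2).card := by
    intro P
    refine Finset.card_bij (fun t _ => (t.2.1, t.2.2, t.1)) ?_ ?_ ?_
    · rintro ⟨u, v, w⟩ h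
      simp only [A, Finset.mem_filter, Finset.mem_univ, true_and] at h ⊢
      exact ⟨h.1.rotate, h.2⟩
    · rintro ⟨u, v, w⟩ h ⟨u', v', w'⟩ h' e
      simp only [Prod.mk.injEq] at e ⊢
      tauto
    · rintro ⟨u, v, w⟩ h
      simp only [A, Finset.mem_filter, Finset.mem_univ, true_and] at h
      exact ⟨(w, u, v), by simpa [A] using ⟨h.1.rotate.rotate, h.2⟩, rfl⟩
  have hM : midFaces T d₀ d₁ = A.filter fun t => mid t.1 t.2.1 t.2.2 := by
    simp only [midFaces, A, mid, Finset.filter_filter]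
  have hA : A.card = (A.filter fun t => mid t.1 t.2.1 t.2.2).card +
      (A.filter fun t => mid t.2.1 t.2.2 t.1).card +
      (A.filter fun t => mid t.2.2 t.1 t.2.1).card := by
    simp only [Finset.card_filter]
    rw [← Finset.sum_add_distrib, ← Finset.sum_add_distrib]
    rw [Finset.card_eq_sum_ones]
    refine Finset.sum_congr rfl ?_
    rintro ⟨u, v, w⟩ h
    simp only [A, Finset.mem_filter, Finset.mem_univ, true_and] at h
    have huv := hd u v h.uv.ne.symm
    have hvw := hd v w h.vw.ne.symm
    have hwu := hd w u h.wu.ne.symm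
    have e : dev d₀ d₁ u v + dev d₀ d₁ v w + dev d₀ d₁ w u = 0 := by unfold dev; ring
    simp only [mid]
    rw [dev_antisymm d₀ d₁ w u, dev_antisymm d₀ d₁ u v, dev_antisymm d₀ d₁ v w]
    rcases lt_or_gt_of_ne huv with h1 | h1 <;> rcases lt_or_gt_of_ne hvw with h2 | h2 <;>
      rcases lt_or_gt_of_ne hwu with h3 | h3 <;>
      first
      | (exfalso; linarith)
      | simp [h1, h2, h3, h1.not_gt, h2.not_gt, h3.not_gt]
  have r1 : (A.filter fun t => mid t.2.1 t.2.2 t.1).card =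
      (A.filter fun t => mid t.1 t.2.1 t.2.2).card := by convert hrot mid
  have r2 : (A.filter fun t => mid t.2.2 t.1 t.2.1).card =
      (A.filter fun t => mid t.2.1 t.2.2 t.1).card := by convert hrot (fun a b c => mid b c a)
  rw [h1, hA, hM]
  omega

/-- A closed half plane through `u` that contains some points of `S` can be turned so that it
contains them in its interior. -/
theorem exists_dev_neg (hS : InGeneralPosition S) {u : S} {P : S → Prop} {d₀ d₁ : ℝ}
    (hne : d₀ ≠ 0 ∨ d₁ ≠ 0) (hle : ∀ s : S, P s → dev d₀ d₁ u s ≤ 0) :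
    ∃ e₀ e₁ : ℝ, ∀ s : S, P s → s ≠ u → dev e₀ e₁ u s < 0 := by
  -- By general position the boundary line contains at most one point `t` of `S` besides `u`. A
  -- small turn computed from `t - u` moves `t` inside and keeps strict inequalities strict.
  by_cases ht : ∃ t : S, P t ∧ t ≠ u ∧ dev d₀ d₁ u t = 0
  · obtain ⟨t, -, htu, ht⟩ := ht
    have hD : 0 < d₀ ^ 2 + d₁ ^ 2 := by rcases hne with h | h <;> positivity
    let dot : S → ℝ := fun s => ((s : Plane) 0 - (u : Plane) 0) * ((t : Plane) 0 - (u : Plane) 0) +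
      ((s : Plane) 1 - (u : Plane) 1) * ((t : Plane) 1 - (u : Plane) 1)
    obtain ⟨ε, ε0, hε⟩ := exists_small (fun s : S => - dev d₀ d₁ u s) dot
    refine ⟨d₀ + ε * ((t : Plane) 1 - (u : Plane) 1), d₁ - ε * ((t : Plane) 0 - (u : Plane) 0),
      fun s hP hs => ?_⟩
    have e : dev (d₀ + ε * ((t : Plane) 1 - (u : Plane) 1)) (d₁ - ε * ((t : Plane) 0 - (u : Plane) 0)) u s
      = -(- dev d₀ d₁ u s + ε * dot s) := by simp only [dot]; unfold dev; ring
    rw [e, neg_lt_zero]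
    by_cases hst : s = t
    · subst hst
      rw [ht]
      have : 0 < dot s := by
        simp only [dot]
        rcases coord_sub_ne_zero (Ne.symm hs) with h | h
        · have := mul_self_pos.2 h
          have := mul_self_nonneg ((s : Plane) 1 - (u : Plane) 1)
          linarith
        · have := mul_self_pos.2 h
          have := mul_self_nonneg ((s : Plane) 0 - (u : Plane) 0)
          linarith
      have := mul_pos ε0 this
      linarith
    · refine hε s (neg_pos.2 (lt_of_le_of_ne (hle s hP) fun h0 => ?_))
      refine ori_ne_zero hS (Ne.symm htu) (Ne.symm hs) (Ne.symm hst) ?_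
      have e : (d₀ ^ 2 + d₁ ^ 2) * ori u t s =
        dev d₀ d₁ u t * (((s : Plane) 0 - (u : Plane) 0) * d₀ + ((s : Plane) 1 - (u : Plane) 1) * d₁) -
        dev d₀ d₁ u s * (((t : Plane) 0 - (u : Plane) 0) * d₀ + ((t : Plane) 1 - (u : Plane) 1) * d₁) := by
        unfold ori dev; ring
      rw [ht, h0] at e
      simp at e
      exact e.resolve_left hD.ne'
  · push Not at ht
    exact ⟨d₀, d₁, fun s hP hs => lt_of_le_of_ne (hle s hP) (ht s hP hs)⟩

theorem not_inner_strict (hS : InGeneralPosition S) {u : S} (hu : ¬ IsInner u) :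
    ∃ d₀ d₁ : ℝ, ∀ s : S, s ≠ u → dev d₀ d₁ u s < 0 := by
  unfold IsInner at hu
  push Not at hu
  obtain ⟨d₀, d₁, hne, hle⟩ := hu
  obtain ⟨e₀, e₁, h⟩ := exists_dev_neg hS (P := fun _ => True) hne fun s _ => hle s
  exact ⟨e₀, e₁, fun s => h s trivial⟩

/-- The next point in counterclockwise order along the convex hull. -/
theorem exists_hull_succ (hS : InGeneralPosition S) (hc : 2 ≤ S.card) {u : S} (hu : ¬ IsInner u) :
    ∃ v : S, v ≠ u ∧ ∀ s : S, 0 ≤ ori u v s := by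
  obtain ⟨d₀, d₁, h⟩ := not_inner_strict hS hu
  have : Nontrivial S := by
    rw [← Fintype.one_lt_card_iff_nontrivial]; simp; omega
  obtain ⟨a, ha⟩ := exists_ne u
  -- All other points are left of the direction; the largest cotangent belongs to the first one
  -- counterclockwise.
  obtain ⟨v, hv, hmax⟩ := (Finset.univ.filter fun s : S => s ≠ u).exists_max_image
    (fun x : S => (((x : Plane) 0 - (u : Plane) 0) * d₀ + ((x : Plane) 1 - (u : Plane) 1) * d₁) /
      (- dev d₀ d₁ u x)) ⟨a, by simpa using ha⟩
  simp only [Finset.mem_filter, Finset.mem_univ, true_and] at hv hmax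
  refine ⟨v, hv, fun s => ?_⟩
  by_cases hsu : s = u
  · subst hsu; simp
  have hv' := h v hv
  have hs' := h s hsu
  have := hmax s hsu
  rw [div_le_div_iff₀ (by linarith) (by linarith)] at this
  have hD := sq_add_sq_pos_of_dev hv'.ne
  have e : (d₀ ^ 2 + d₁ ^ 2) * ori u v s =
    (((v : Plane) 0 - (u : Plane) 0) * d₀ + ((v : Plane) 1 - (u : Plane) 1) * d₁) * (- dev d₀ d₁ u s) -
    (((s : Plane) 0 - (u : Plane) 0) * d₀ + ((s : Plane) 1 - (u : Plane) 1) * d₁) * (- dev d₀ d₁ u v) := by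
    unfold ori dev; ring
  exact nonneg_of_mul_nonneg_right (a := d₀ ^ 2 + d₁ ^ 2) (by linarith) hD

theorem adj_of_one_sided (hS : InGeneralPosition S) (hT : IsTriangulation T) {u v : S}
    (huv : u ≠ v) (h : ∀ s : S, 0 ≤ ori u v s) : T.Adj u v :=
  adj_of_uncrossed hS hT huv fun c _ _ _ _ _ _ hc _ => absurd hc (h c).not_gt

theorem not_inner_of_one_sided {u v : S} (huv : u ≠ v) (h : ∀ s : S, 0 ≤ ori u v s) :
    ¬ IsInner u := fun hu => by
  obtain ⟨s, hs⟩ := hu.exists_right huv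
  exact absurd hs (h s).not_gt

/-- The directed edges of `T` along the convex hull, counterclockwise. -/
noncomputable def hullDarts (T : SimpleGraph S) : Finset (S × S) :=
  Finset.univ.filter fun e => T.Adj e.1 e.2 ∧ ∀ p : S, 0 ≤ ori e.1 e.2 p

theorem card_hullDarts (hS : InGeneralPosition S) (hc : 2 ≤ S.card) (hT : IsTriangulation T) :
    (hullDarts T).card + (innerPoints S).card = S.card := by
  have h1 : (hullDarts T).card = (Finset.univ.filter fun v : S => ¬ IsInner v).card := by
    refine Finset.card_bij (fun t _ => t.1) ?_ ?_ ?_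
    · rintro ⟨u, v⟩ h
      simp only [hullDarts, Finset.mem_filter, Finset.mem_univ, true_and] at h ⊢
      exact not_inner_of_one_sided h.1.ne h.2
    · rintro ⟨u, v⟩ h ⟨u', v'⟩ h' e
      simp only [hullDarts, Finset.mem_filter, Finset.mem_univ, true_and] at h h' e
      subst e
      have a := h.2 v'
      have b := h'.2 v
      rw [ori_swap_right] at b
      have : ori u v v' = 0 := by linarith
      rcases eq_or_eq_of_ori_eq_zero hS h.1.ne this with rfl | rfl
      · exact absurd rfl h'.1.ne
      · rfl
    · intro u h
      simp only [Finset.mem_filter, Finset.mem_univ, true_and] at h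
      obtain ⟨v, hv, hs⟩ := exists_hull_succ hS hc h
      exact ⟨(u, v), Finset.mem_filter.2
        ⟨Finset.mem_univ _, adj_of_one_sided hS hT hv.symm hs, hs⟩, rfl⟩
  rw [h1, innerPoints, add_comm, Finset.card_filter_add_card_filter_not]
  simp

/-- The directed edges of `T` that have points of `S` on both sides. -/
noncomputable def innerDarts (T : SimpleGraph S) : Finset (S × S) :=
  Finset.univ.filter fun e => T.Adj e.1 e.2 ∧ (∃ p : S, 0 < ori e.1 e.2 p) ∧
    ∃ p : S, ori e.1 e.2 p < 0

theorem exists_third (hc : 3 ≤ S.card) (u v : S) : ∃ s : S, s ≠ u ∧ s ≠ v := by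
  have : ({u, v} : Finset S).card < (Finset.univ : Finset S).card := by
    have := Finset.card_le_two (a := u) (b := v)
    simp only [Finset.card_univ, Fintype.card_coe]
    omega
  obtain ⟨s, -, hs⟩ := Finset.exists_mem_notMem_of_card_lt_card this
  simp at hs
  exact ⟨s, hs⟩

theorem leftDarts_eq (hS : InGeneralPosition S) (hc : 3 ≤ S.card) :
    leftDarts T = innerDarts T ∪ hullDarts T ∧ Disjoint (innerDarts T) (hullDarts T) := by
  constructor
  · ext ⟨u, v⟩
    simp only [leftDarts, innerDarts, hullDarts, Finset.mem_filter, Finset.mem_univ, true_and,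
      Finset.mem_union]
    constructor
    · rintro ⟨h, hp⟩
      by_cases hn : ∃ p : S, ori u v p < 0
      · exact Or.inl ⟨h, hp, hn⟩
      · push Not at hn
        exact Or.inr ⟨h, hn⟩
    · rintro (⟨h, hp, -⟩ | ⟨h, hp⟩)
      · exact ⟨h, hp⟩
      · obtain ⟨s, hs, hs'⟩ := exists_third hc u v
        exact ⟨h, s, lt_of_le_of_ne (hp s) (ori_ne_zero hS h.ne hs.symm hs'.symm).symm⟩
  · rw [Finset.disjoint_left]
    rintro ⟨u, v⟩ h h'
    simp only [innerDarts, hullDarts, Finset.mem_filter, Finset.mem_univ, true_and] at h h'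
    obtain ⟨-, -, p, hp⟩ := h
    exact absurd hp (h'.2 p).not_gt

/-- With `i` inner points this is three sides for each of the `N + i - 2` faces, minus the `N - i`
hull edges. -/
theorem card_innerDarts (hS : InGeneralPosition S) (hc : 3 ≤ S.card) (hT : IsTriangulation T) :
    (innerDarts T).card + 6 = 4 * (innerPoints S).card + 2 * S.card := by
  obtain ⟨d₀, d₁, hd⟩ := exists_genericDir S
  have h1 := card_leftDarts hS hT hd
  have h2 := card_midFaces hS (by omega) hT hd
  have h3 := card_hullDarts hS (by omega) hT
  obtain ⟨h4, h5⟩ := leftDarts_eq (T := T) hS hc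
  rw [h4, Finset.card_union_of_disjoint h5] at h1
  omega

end

/-! ### The boundary of the convex hull -/

section
variable {S : Finset Plane} {T : SimpleGraph S}

theorem convex_dev_le (d₀ d₁ : ℝ) (b : Plane) : Convex ℝ {z : Plane | dev d₀ d₁ b z ≤ 0} := by
  intro x hx y hy s t hs ht hst
  simp only [Set.mem_ofPred_eq] at hx hy ⊢
  rw [dev_combo hst (a := x) (b := y) (by simp) (by simp)]
  nlinarith

theorem dev_le_of_mem_convexHull {d₀ d₁ : ℝ} {b z : Plane} (h : ∀ s ∈ S, dev d₀ d₁ b s ≤ 0)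
    (hz : z ∈ convexHull ℝ (S : Set Plane)) : dev d₀ d₁ b z ≤ 0 :=
  convexHull_min (fun s hs => h s hs) (convex_dev_le d₀ d₁ b) hz

theorem notMem_interior_of_dev {d₀ d₁ : ℝ} (hne : d₀ ≠ 0 ∨ d₁ ≠ 0) {b : Plane}
    (h : ∀ s ∈ S, dev d₀ d₁ b s ≤ 0) : b ∉ interior (convexHull ℝ (S : Set Plane)) := by
  intro hb
  rw [mem_interior_iff_mem_nhds] at hb
  have hD : 0 < d₀ ^ 2 + d₁ ^ 2 := by rcases hne with h | h <;> positivity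
  set e : Plane := !₂[d₁, -d₀] with he
  have hc : Filter.Tendsto (fun t : ℝ => b + t • e) (nhdsWithin 0 (Set.Ioi 0)) (nhds b) := by
    have : Continuous fun t : ℝ => b + t • e := by fun_prop
    have := this.tendsto 0
    simp only [zero_smul, add_zero] at this
    exact this.mono_left nhdsWithin_le_nhds
  obtain ⟨t, ht, ht0⟩ := ((hc.eventually hb).and self_mem_nhdsWithin).exists
  have := dev_le_of_mem_convexHull h ht
  have e1 : dev d₀ d₁ b (b + t • e) = t * (d₀ ^ 2 + d₁ ^ 2) := by
    simp [dev, he]; ring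
  rw [e1] at this
  linarith [mul_pos (show 0 < t from ht0) hD]

theorem strongDual_eq_dev (f : StrongDual ℝ Plane) (hf : f ≠ 0) : ∃ d₀ d₁ : ℝ, (d₀ ≠ 0 ∨ d₁ ≠ 0) ∧
    ∀ b z : Plane, f z - f b = dev d₀ d₁ b z := by
  set e₀ : Plane := !₂[1, 0] with he0
  set e₁ : Plane := !₂[0, 1] with he1
  have hz : ∀ z : Plane, f z = z 0 * f e₀ + z 1 * f e₁ := by
    intro z
    have : z = z 0 • e₀ + z 1 • e₁ := by
      refine plane_ext ?_ ?_ <;> simp [he0, he1]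
    conv_lhs => rw [this]
    simp
  refine ⟨-f e₁, f e₀, ?_, fun b z => ?_⟩
  · by_contra hc
    push Not at hc
    apply hf
    ext z
    rw [hz z, hc.2, neg_eq_zero.1 hc.1]
    simp
  · rw [hz z, hz b]; unfold dev; ring

theorem interior_convexHull_nonempty (hS : InGeneralPosition S) (hc : 3 ≤ S.card) :
    (interior (convexHull ℝ (S : Set Plane))).Nonempty := by
  rw [interior_convexHull_nonempty_iff_affineSpan_eq_top, eq_top_iff]
  obtain ⟨a, b, c, ha, hb, hcS, hab, hac, hbc⟩ := Finset.two_lt_card_iff.1 hc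
  have hi : AffineIndependent ℝ ![a, b, c] := by
    rw [affineIndependent_iff_not_collinear_set]
    exact hS a ha b hb c hcS hab hac hbc
  have := (hi.affineSpan_eq_top_iff_card_eq_finrank_add_one).2 (by simp)
  rw [← this]
  refine affineSpan_mono ℝ ?_
  rintro _ ⟨i, rfl⟩
  fin_cases i <;> simpa

/-- Separation from the hull uses that its interior is nonempty. Two points lack this, but then the
line through them supports the hull everywhere. -/
theorem exists_dev_of_notMem_interior (hS : InGeneralPosition S) (hc : 2 ≤ S.card) {b : Plane}
    (hb : b ∈ convexHull ℝ (S : Set Plane)) (hb' : b ∉ interior (convexHull ℝ (S : Set Plane))) :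
    ∃ d₀ d₁ : ℝ, (d₀ ≠ 0 ∨ d₁ ≠ 0) ∧ ∀ s ∈ S, dev d₀ d₁ b s ≤ 0 := by
  rcases hc.lt_or_eq with hc | hc
  · obtain ⟨f, hf, h⟩ := geometric_hahn_banach_of_nonempty_interior_point (convex_convexHull ℝ _) hb'
      (interior_convexHull_nonempty hS hc)
    obtain ⟨d₀, d₁, hne, hd⟩ := strongDual_eq_dev f hf
    refine ⟨d₀, d₁, hne, fun s hs => ?_⟩
    rw [← hd]
    have := h s (subset_convexHull ℝ _ hs)
    linarith
  · obtain ⟨u, v, huv, rfl⟩ := Finset.card_eq_two.1 hc.symm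
    refine ⟨v 0 - u 0, v 1 - u 1, ?_, ?_⟩
    · by_contra h
      push Not at h
      exact huv (plane_ext (by linarith) (by linarith))
    · rw [Finset.coe_pair, convexHull_pair, mem_segment_iff'] at hb
      obtain ⟨s, t, hs, ht, hst, h0, h1⟩ := hb
      obtain rfl : s = 1 - t := by linarith
      intro x hx
      simp only [Finset.mem_insert, Finset.mem_singleton] at hx
      rcases hx with rfl | rfl
      · apply le_of_eq; unfold dev; rw [h0, h1]; ring
      · apply le_of_eq; unfold dev; rw [h0, h1]; ring

theorem hullBoundary_eq : hullBoundary S =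
    convexHull ℝ (S : Set Plane) \ interior (convexHull ℝ (S : Set Plane)) := by
  unfold hullBoundary
  rw [frontier, IsClosed.closure_eq]
  exact (Set.Finite.isCompact_convexHull (𝕜 := ℝ) S.finite_toSet).isClosed

theorem mem_hullBoundary_iff (hS : InGeneralPosition S) (hc : 2 ≤ S.card) {b : Plane}
    (hb : b ∈ convexHull ℝ (S : Set Plane)) : b ∈ hullBoundary S ↔
    ∃ d₀ d₁ : ℝ, (d₀ ≠ 0 ∨ d₁ ≠ 0) ∧ ∀ s ∈ S, dev d₀ d₁ b s ≤ 0 := by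
  rw [hullBoundary_eq]
  constructor
  · exact fun h => exists_dev_of_notMem_interior hS hc hb h.2
  · rintro ⟨d₀, d₁, hne, h⟩
    exact ⟨hb, notMem_interior_of_dev hne h⟩

theorem mem_hullBoundary_iff_not_inner (hS : InGeneralPosition S) (hc : 2 ≤ S.card) (v : S) :
    (v : Plane) ∈ hullBoundary S ↔ ¬ IsInner v := by
  rw [mem_hullBoundary_iff hS hc (subset_convexHull ℝ _ v.2)]
  unfold IsInner
  push Not
  simp

theorem IsInner.mem_interior (hS : InGeneralPosition S) (hc : 2 ≤ S.card) {v : S} (h : IsInner v) :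
    (v : Plane) ∈ interior (convexHull ℝ (S : Set Plane)) := by
  by_contra hv
  refine (mem_hullBoundary_iff_not_inner hS hc v).1 ?_ h
  rw [hullBoundary_eq]
  exact ⟨subset_convexHull ℝ _ v.2, hv⟩

theorem card_hullVertices (hS : InGeneralPosition S) (hc : 2 ≤ S.card) :
    (hullVertices S).card + (innerPoints S).card = S.card := by
  classical
  have h1 : (hullVertices S).card = (Finset.univ.filter fun v : S => ¬ IsInner v).card := by
    symm
    refine Finset.card_bij (fun v _ => (v : Plane)) ?_ ?_ ?_
    · intro v hv
      simp only [Finset.mem_filter, Finset.mem_univ, true_and] at hv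
      exact Finset.mem_filter.2 ⟨v.2, (mem_hullBoundary_iff_not_inner hS hc v).2 hv⟩
    · intro a _ b _ h
      exact Subtype.ext h
    · intro b hb
      obtain ⟨hb, hb'⟩ := Finset.mem_filter.1 hb
      exact ⟨⟨b, hb⟩, by simpa using (mem_hullBoundary_iff_not_inner hS hc ⟨b, hb⟩).1 hb', rfl⟩
  rw [h1, innerPoints, add_comm, Finset.card_filter_add_card_filter_not]
  simp

theorem segment_subset_hull (u v : S) :
    segment ℝ (u : Plane) v ⊆ convexHull ℝ (S : Set Plane) :=
  (convex_convexHull ℝ _).segment_subset (subset_convexHull ℝ _ u.2) (subset_convexHull ℝ _ v.2)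

/-- A segment between points of `S` lies on the boundary of the hull if and only if all points of
`S` are on one side of it. -/
theorem segment_subset_hullBoundary_iff (hS : InGeneralPosition S) (hc : 2 ≤ S.card) {u v : S}
    (huv : u ≠ v) : segment ℝ (u : Plane) v ⊆ hullBoundary S ↔
      (∀ s : S, 0 ≤ ori u v s) ∨ ∀ s : S, ori u v s ≤ 0 := by
  constructor
  · intro h
    have hm : midpoint ℝ (u : Plane) v ∈ segment ℝ (u : Plane) v := midpoint_mem_segment _ _
    obtain ⟨d₀, d₁, hne, hd⟩ := (mem_hullBoundary_iff hS hc (segment_subset_hull u v hm)).1 (h hm)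
    have m0 : midpoint ℝ (u : Plane) v 0 = ((u : Plane) 0 + (v : Plane) 0) / 2 := by
      simp [midpoint_eq_smul_add]; ring
    have m1 : midpoint ℝ (u : Plane) v 1 = ((u : Plane) 1 + (v : Plane) 1) / 2 := by
      simp [midpoint_eq_smul_add]; ring
    have hu := hd u u.2
    have hv := hd v v.2
    unfold dev at hu hv
    rw [m0, m1] at hu hv
    -- The deviations of `u` and `v` from a supporting line at their midpoint are opposite and both
    -- nonpositive, so the line contains `u` and `v`.
    have hpar : ((v : Plane) 0 - (u : Plane) 0) * d₁ - ((v : Plane) 1 - (u : Plane) 1) * d₀ = 0 := by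
      linarith
    have hrel : ∀ s : S, dev d₀ d₁ (midpoint ℝ (u : Plane) v) s = dev d₀ d₁ u s := by
      intro s; unfold dev; rw [m0, m1]; linarith
    have hcomm : ∀ s : S, ((d₀ ^ 2 + d₁ ^ 2)) * ori u v s = - dev d₀ d₁ u s *
        (((v : Plane) 0 - (u : Plane) 0) * d₀ + ((v : Plane) 1 - (u : Plane) 1) * d₁) := by
      intro s
      unfold ori dev
      linear_combination (((s : Plane) 0 - (u : Plane) 0) * d₀ + ((s : Plane) 1 - (u : Plane) 1) * d₁) * hpar
    have hD : 0 < d₀ ^ 2 + d₁ ^ 2 := by rcases hne with h | h <;> positivity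
    rcases le_total 0 (((v : Plane) 0 - (u : Plane) 0) * d₀ + ((v : Plane) 1 - (u : Plane) 1) * d₁)
      with h0 | h0
    · left
      intro s
      have := hd s s.2
      rw [hrel] at this
      have := mul_nonneg (neg_nonneg.2 this) h0
      exact nonneg_of_mul_nonneg_right (a := d₀ ^ 2 + d₁ ^ 2) (by rw [hcomm]; exact this) hD
    · right
      intro s
      have h1 := hd s s.2
      rw [hrel] at h1
      have := mul_nonneg (neg_nonneg.2 h1) (neg_nonneg.2 h0)
      exact nonpos_of_mul_nonpos_right (a := d₀ ^ 2 + d₁ ^ 2) (by rw [hcomm]; linarith) hD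
  · intro h z hz
    rw [mem_hullBoundary_iff hS hc (segment_subset_hull u v hz)]
    obtain ⟨s, t, hs, ht, hst, h0, h1⟩ := mem_segment_iff'.1 hz
    obtain rfl : s = 1 - t := by linarith
    have e : ∀ x : Plane, dev ((v : Plane) 0 - (u : Plane) 0) ((v : Plane) 1 - (u : Plane) 1) z x =
        - ori u v x := by
      intro x; unfold dev ori; rw [h0, h1]; ring
    rcases h with h | h
    · refine ⟨_, _, coord_sub_ne_zero huv, fun x hx => ?_⟩
      rw [e]
      have := h ⟨x, hx⟩
      simpa using this
    · refine ⟨-((v : Plane) 0 - (u : Plane) 0), -((v : Plane) 1 - (u : Plane) 1),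
        (coord_sub_ne_zero huv).imp neg_ne_zero.2 neg_ne_zero.2, fun x hx => ?_⟩
      rw [dev_neg, e]
      have := h ⟨x, hx⟩
      simpa using this

theorem mem_interiorEdges_iff (hS : InGeneralPosition S) (hc : 2 ≤ S.card) {u v : S} :
    s(u, v) ∈ interiorEdges T ↔ T.Adj u v ∧ (∃ p : S, 0 < ori u v p) ∧ ∃ p : S, ori u v p < 0 := by
  simp only [interiorEdges, Set.mem_ofPred_eq, SimpleGraph.mem_edgeSet, edgeSegment_mk]
  refine and_congr_right fun h => ?_
  rw [segment_subset_hullBoundary_iff hS hc h.ne]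
  push Not
  tauto

/-- A boundary point of the hull is a point of `S` on the boundary or on a hull edge. -/
theorem exists_hull_edge (hS : InGeneralPosition S) (hc : 2 ≤ S.card) {b : Plane}
    (hb : b ∈ hullBoundary S) : ∃ u v : S, u ≠ v ∧ (∀ s : S, 0 ≤ ori u v s) ∧
      b ∈ segment ℝ (u : Plane) v := by
  classical
  have hbh : b ∈ convexHull ℝ (S : Set Plane) := by
    rw [hullBoundary_eq] at hb; exact hb.1
  obtain ⟨d₀, d₁, hne, hd⟩ := (mem_hullBoundary_iff hS hc hbh).1 hb
  have hD : 0 < d₀ ^ 2 + d₁ ^ 2 := by rcases hne with h | h <;> positivity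
  -- `b` lies in the hull of the points that attain the maximum
  have hface : b ∈ convexHull ℝ ((S.filter fun s => dev d₀ d₁ b s = 0 : Finset Plane) : Set Plane) := by
    rw [Finset.mem_convexHull'] at hbh ⊢
    obtain ⟨w, hw0, hw1, hwb⟩ := hbh
    have hsum : ∑ s ∈ S, w s * dev d₀ d₁ b s = 0 := by
      have c0 : ∑ s ∈ S, w s * s 0 = b 0 := by
        have := congrArg (fun z : Plane => z 0) hwb
        simpa using this
      have c1 : ∑ s ∈ S, w s * s 1 = b 1 := by
        have := congrArg (fun z : Plane => z 1) hwb
        simpa using this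
      calc ∑ s ∈ S, w s * dev d₀ d₁ b s
          = (∑ s ∈ S, w s * s 0 - (∑ s ∈ S, w s) * b 0) * d₁ -
            (∑ s ∈ S, w s * s 1 - (∑ s ∈ S, w s) * b 1) * d₀ := by
            simp only [sub_mul, Finset.sum_mul, ← Finset.sum_sub_distrib]
            refine Finset.sum_congr rfl fun s _ => ?_
            unfold dev; ring
        _ = 0 := by rw [c0, c1, hw1]; ring
    have hz : ∀ s ∈ S, w s * dev d₀ d₁ b s = 0 :=
      (Finset.sum_eq_zero_iff_of_nonpos
        (fun s hs => mul_nonpos_of_nonneg_of_nonpos (hw0 s hs) (hd s hs))).1 hsum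
    have hzero : ∀ s ∈ S, s ∉ S.filter (fun s => dev d₀ d₁ b s = 0) → w s = 0 := by
      intro s hs hns
      rcases mul_eq_zero.1 (hz s hs) with h | h
      · exact h
      · exact absurd (Finset.mem_filter.2 ⟨hs, h⟩) hns
    refine ⟨w, fun s hs => hw0 s (Finset.filter_subset _ _ hs), ?_, ?_⟩
    · rw [← hw1]
      exact Finset.sum_subset (Finset.filter_subset _ _) hzero
    · refine Eq.trans ?_ hwb
      exact Finset.sum_subset (Finset.filter_subset _ _) fun s hs hns => by
        rw [hzero s hs hns, zero_smul]
  have hne' : (S.filter fun s => dev d₀ d₁ b s = 0).Nonempty := by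
    rw [← Finset.coe_nonempty, ← convexHull_nonempty_iff (𝕜 := ℝ)]
    exact ⟨b, hface⟩
  obtain ⟨u, hu⟩ := hne'
  have hu' := Finset.mem_filter.1 hu
  have hrel : ∀ s : S, dev d₀ d₁ b s = dev d₀ d₁ u s := by
    intro s
    have := dev_trans d₀ d₁ b u s
    rw [hu'.2] at this
    linarith
  -- By general position at most two points lie on the supporting line. If there is only one, `b` is
  -- that point and its hull successor completes an edge.
  by_cases hv : ∃ v ∈ S.filter (fun s => dev d₀ d₁ b s = 0), v ≠ u
  · obtain ⟨v, hv, hvu⟩ := hv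
    have hv' := Finset.mem_filter.1 hv
    have hface' : S.filter (fun s => dev d₀ d₁ b s = 0) = {u, v} := by
      ext x
      simp only [Finset.mem_insert, Finset.mem_singleton]
      constructor
      · intro hx
        have hx' := Finset.mem_filter.1 hx
        have h0 : ori u v x = 0 := by
          have e1 := hrel ⟨v, hv'.1⟩
          have e2 := hrel ⟨x, hx'.1⟩
          simp only at e1 e2
          rw [hv'.2] at e1
          rw [hx'.2] at e2
          have e : (d₀ ^ 2 + d₁ ^ 2) * ori u v x =
            dev d₀ d₁ u v * ((x 0 - u 0) * d₀ + (x 1 - u 1) * d₁) -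
            dev d₀ d₁ u x * ((v 0 - u 0) * d₀ + (v 1 - u 1) * d₁) := by
            unfold ori dev; ring
          rw [← e1, ← e2] at e
          simp at e
          exact e.resolve_left hD.ne'
        have := eq_or_eq_of_ori_eq_zero hS (a := ⟨u, hu'.1⟩) (b := ⟨v, hv'.1⟩) (c := ⟨x, hx'.1⟩)
          (fun h => hvu (congrArg Subtype.val h).symm) h0
        simpa [Subtype.ext_iff] using this
      · rintro (rfl | rfl)
        · exact hu
        · exact hv
    rw [hface', Finset.coe_pair, convexHull_pair] at hface
    have hside : segment ℝ u v ⊆ hullBoundary S := by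
      intro z hz
      rw [mem_hullBoundary_iff hS hc (segment_subset_hull ⟨u, hu'.1⟩ ⟨v, hv'.1⟩ hz)]
      refine ⟨d₀, d₁, hne, fun s hs => ?_⟩
      obtain ⟨p, q, _, _, hpq, h0, h1⟩ := mem_segment_iff'.1 hz
      have := dev_combo hpq h0 h1 d₀ d₁ b
      rw [hu'.2, hv'.2] at this
      have := dev_trans d₀ d₁ b z s
      have := hd s hs
      linarith
    have huv : (⟨u, hu'.1⟩ : S) ≠ ⟨v, hv'.1⟩ := fun h => hvu (congrArg Subtype.val h).symm
    rcases (segment_subset_hullBoundary_iff hS hc huv).1 hside with h | h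
    · exact ⟨_, _, huv, h, hface⟩
    · refine ⟨_, _, huv.symm, fun s => ?_, by rwa [segment_symm]⟩
      rw [ori_swap]
      have := h s
      linarith
  · push Not at hv
    have hbu : b = u := by
      have : S.filter (fun s => dev d₀ d₁ b s = 0) = {u} := by
        ext x
        simp only [Finset.mem_singleton]
        exact ⟨hv x, fun h => h ▸ hu⟩
      rw [this, Finset.coe_singleton, convexHull_singleton] at hface
      exact hface
    subst hbu
    obtain ⟨v, hv, hs⟩ := exists_hull_succ hS hc (u := ⟨b, hu'.1⟩)
      ((mem_hullBoundary_iff_not_inner hS hc ⟨b, hu'.1⟩).1 hb)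
    exact ⟨⟨b, hu'.1⟩, v, hv.symm, hs, left_mem_segment ℝ _ _⟩

end

/-! ### Surrounded inner points make bounded faces convex -/

section
variable {S : Finset Plane} {T : SimpleGraph S}

theorem segment_subset_drawing {G : SimpleGraph S} {u v : S} (h : G.Adj u v) :
    segment ℝ (u : Plane) v ⊆ drawing G := by
  intro z hz
  exact Set.mem_iUnion₂.2 ⟨s(u, v), h, hz⟩

theorem exists_of_mem_drawing {G : SimpleGraph S} {z : Plane} (h : z ∈ drawing G) :
    ∃ u v : S, G.Adj u v ∧ z ∈ segment ℝ (u : Plane) v := by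
  obtain ⟨e, he, hz⟩ := Set.mem_iUnion₂.1 h
  induction e with
  | _ u v => exact ⟨u, v, he, hz⟩

theorem isClosed_drawing (G : SimpleGraph S) : IsClosed (drawing G) := by
  refine Set.Finite.isClosed_biUnion (Set.toFinite _) fun e _ => ?_
  induction e with
  | _ u v =>
    rw [edgeSegment_mk, ← convexHull_pair]
    exact ((Set.toFinite _).isCompact_convexHull (𝕜 := ℝ)).isClosed

theorem drawing_subset_hull (G : SimpleGraph S) : drawing G ⊆ convexHull ℝ (S : Set Plane) := by
  intro z hz
  obtain ⟨u, v, -, h⟩ := exists_of_mem_drawing hz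
  exact segment_subset_hull u v h

theorem isClosed_hull : IsClosed (convexHull ℝ (S : Set Plane)) :=
  (S.finite_toSet.isCompact_convexHull (𝕜 := ℝ)).isClosed

/-- A face that is bounded lies in the convex hull. -/
theorem face_subset_hull {G : SimpleGraph S} {A : Set Plane} (hA : IsFace G A)
    (hb : Bornology.IsBounded A) : A ⊆ convexHull ℝ (S : Set Plane) := by
  obtain ⟨x₀, hx₀, rfl⟩ := hA
  intro x hx
  by_contra hxh
  rw [connectedComponentIn_eq hx] at hb
  by_cases hne : (convexHull ℝ (S : Set Plane)).Nonempty
  swap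
  · rw [Set.not_nonempty_iff_eq_empty] at hne
    have : drawing G = ∅ := Set.subset_empty_iff.1 (hne ▸ drawing_subset_hull G)
    rw [this, Set.compl_empty, connectedComponentIn_univ] at hb
    rw [show connectedComponent x = Set.univ from PreconnectedSpace.connectedComponent_eq_univ x] at hb
    exact NormedSpace.unbounded_univ ℝ Plane hb
  obtain ⟨f, u, hfu, hux⟩ := geometric_hahn_banach_closed_point (convex_convexHull ℝ _) isClosed_hull hxh
  have hf : f ≠ 0 := by
    rintro rfl
    obtain ⟨a, ha⟩ := hne
    have := hfu a ha
    simp at this hux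
    linarith
  obtain ⟨d₀, d₁, hd, hfd⟩ := strongDual_eq_dev f hf
  have hD : 0 < d₀ ^ 2 + d₁ ^ 2 := by rcases hd with h | h <;> positivity
  -- The ray from `x` along the separating normal misses the hull and hence the drawing, so the face
  -- would be unbounded.
  set e : Plane := !₂[d₁, -d₀] with he
  have hdev : ∀ t : ℝ, dev d₀ d₁ x (x + t • e) = t * (d₀ ^ 2 + d₁ ^ 2) := by
    intro t; simp [dev, he]; ring
  have hray : (fun t : ℝ => x + t • e) '' Set.Ici 0 ⊆ connectedComponentIn (drawing G)ᶜ x := by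
    refine IsPreconnected.subset_connectedComponentIn ?_ ⟨0, by simp, by simp⟩ ?_
    · exact isPreconnected_Ici.image _ (by fun_prop)
    · rintro _ ⟨t, ht, rfl⟩ hz
      have h1 := hfu _ (drawing_subset_hull G hz)
      have h2 := hfd x (x + t • e)
      rw [hdev] at h2
      have h3 := mul_nonneg (show 0 ≤ t from ht) hD.le
      simp only at h1
      linarith
  obtain ⟨C, hC⟩ := hb.exists_norm_le
  have hbd : ∀ t : ℝ, 0 ≤ t → t * ‖e‖ ≤ C + ‖x‖ := by
    intro t ht
    have h1 := hC _ (hray ⟨t, ht, rfl⟩)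
    simp only at h1
    have h2 : ‖t • e‖ ≤ ‖x + t • e‖ + ‖x‖ := by
      have := norm_sub_le (x + t • e) x
      simpa using this
    rw [norm_smul, Real.norm_eq_abs, abs_of_nonneg ht] at h2
    linarith
  have hen : 0 < ‖e‖ := by
    rw [norm_pos_iff]
    intro h0
    have := hdev 1
    rw [h0] at this
    simp at this
    linarith
  have h0 := hbd 0 le_rfl
  have h1 := hbd ((C + ‖x‖ + 1) / ‖e‖) (div_nonneg (by linarith) hen.le)
  rw [div_mul_cancel₀ _ hen.ne'] at h1
  linarith

variable {F : Finset (Sym2 S)}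

theorem hullBoundary_subset_drawing (hS : InGeneralPosition S) (hc : 2 ≤ S.card)
    (hT : IsTriangulation T) (hF : (F : Set (Sym2 S)) ⊆ interiorEdges T) :
    hullBoundary S ⊆ drawing (T.deleteEdges F) := by
  intro b hb
  obtain ⟨u, v, huv, h, hbs⟩ := exists_hull_edge hS hc hb
  refine segment_subset_drawing ?_ hbs
  rw [SimpleGraph.deleteEdges_adj]
  refine ⟨adj_of_one_sided hS hT huv h, fun hmem => ?_⟩
  obtain ⟨-, -, p, hp⟩ := (mem_interiorEdges_iff hS hc).1 (hF hmem)
  exact absurd hp (h p).not_gt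

/-- A drawn segment that starts at an inner point `b` of `x y` does not enter the triangle spanned by
`x`, `y`, `a` if this triangle is swept by undrawn segments from `x`. -/
theorem not_enter_swept {D : Set Plane} {x y a b w : Plane} {β : ℝ} (hβ0 : 0 < β) (hβ1 : β < 1)
    (hb0 : b 0 = x 0 + β * (y 0 - x 0)) (hb1 : b 1 = x 1 + β * (y 1 - x 1))
    (hsweep : ∀ r : ℝ, 0 ≤ r → r < 1 → Disjoint (segment ℝ x ((1 - r) • a + r • y)) D)
    (hw : segment ℝ b w ⊆ D) : ori x y a * ori x y w ≤ 0 := by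
  by_contra hpos
  push Not at hpos
  have hκ : ori x y a ≠ 0 := by intro h; rw [h] at hpos; simp at hpos
  set p := ori x y w / ori x y a with hp
  have hp0 : 0 < p := by
    rcases pos_and_pos_or_neg_and_neg_of_mul_pos hpos with ⟨h1, h2⟩ | ⟨h1, h2⟩
    · exact div_pos h2 h1
    · exact div_pos_of_neg_of_neg h2 h1
  set q := - ori x a w / ori x y a - β with hq
  have e0 : w 0 - b 0 = p * (a 0 - x 0) + q * (y 0 - x 0) := by
    rw [hp, hq, hb0]; field_simp; unfold ori; ring
  have e1 : w 1 - b 1 = p * (a 1 - x 1) + q * (y 1 - x 1) := by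
    rw [hp, hq, hb1]; field_simp; unfold ori; ring
  -- A short step from `b` towards `w` stays in the triangle; `r` selects the swept segment that it
  -- reaches and `m` the position on that segment.
  obtain ⟨ε, ε0, hε⟩ := exists_small (ι := Fin 3) ![β, 1 - β, 1] ![q, -(p + q), -1]
  have k1 := hε 0 (by simpa using hβ0)
  have k2 := hε 1 (by simpa using hβ1)
  have k3 := hε 2 (by simp)
  simp at k1 k2 k3
  set m := ε * p + (β + ε * q) with hm
  have hεp := mul_pos ε0 hp0
  have hm0 : 0 < m := by linarith
  set r := (β + ε * q) / m with hr
  have hr0 : 0 ≤ r := by positivity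
  have hr1 : r < 1 := by rw [hr, div_lt_one hm0]; linarith
  have hmr : m * r = β + ε * q := by rw [hr]; field_simp
  set z : Plane := (1 - ε) • b + ε • w with hz
  have hzD : z ∈ D := hw ⟨1 - ε, ε, by linarith, ε0.le, by ring, rfl⟩
  refine Set.disjoint_left.1 (hsweep r hr0 hr1) ?_ hzD
  rw [mem_segment_iff']
  refine ⟨1 - m, m, by linarith, hm0.le, by ring, ?_, ?_⟩
  · simp [hz]
    linear_combination ε * e0 + hb0 + (a 0 - y 0) * hmr - (a 0 - x 0) * hm
  · simp [hz]
    linear_combination ε * e1 + hb1 + (a 1 - y 1) * hmr - (a 1 - x 1) * hm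

/-- The star argument: if a bounded face contains `x`, `a`, `y` and the segments from `x` to all points
of the segment `a y` other than `y`, then it contains the segment from `x` to `y`. -/
theorem segment_disjoint_of_swept (hS : InGeneralPosition S) (hc : 2 ≤ S.card)
    {G : SimpleGraph S} (hsur : ∀ v : S, IsInner v → Surrounded G v)
    {x y a : Plane} (hxi : x ∈ interior (convexHull ℝ (S : Set Plane)))
    (hyi : y ∈ interior (convexHull ℝ (S : Set Plane)))
    (hxD : x ∉ drawing G) (hyD : y ∉ drawing G) (hκ : ori x y a ≠ 0)
    (hsweep : ∀ r : ℝ, 0 ≤ r → r < 1 → Disjoint (segment ℝ x ((1 - r) • a + r • y)) (drawing G)) :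
    Disjoint (segment ℝ x y) (drawing G) := by
  rw [Set.disjoint_left]
  intro b hb hbD
  -- it suffices to find a vertex on the segment
  have vertex : ∀ (c : S) (γ : ℝ), 0 < γ → γ < 1 → (c : Plane) 0 = x 0 + γ * (y 0 - x 0) →
      (c : Plane) 1 = x 1 + γ * (y 1 - x 1) → False := by
    intro c γ h0 h1 c0 c1
    -- A surrounded inner vertex has an edge towards the side of `a`, which enters the swept
    -- triangle. A vertex that is not inner is on the hull boundary and cannot lie between two
    -- interior points.
    by_cases hin : IsInner c
    · obtain ⟨w, hw, hpos⟩ := hsur c hin (-(ori x y a * (y 0 - x 0))) (-(ori x y a * (y 1 - x 1))) (by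
        by_contra hcon
        push Not at hcon
        simp [hκ] at hcon
        apply hκ
        unfold ori; rw [hcon.1, hcon.2]; ring)
      have := not_enter_swept h0 h1 c0 c1 hsweep (segment_subset_drawing hw)
      have e : dev (-(ori x y a * (y 0 - x 0))) (-(ori x y a * (y 1 - x 1))) c w =
          ori x y a * ori x y w := by
        conv_lhs => unfold dev
        rw [c0, c1]
        conv_rhs => rw [show ori x y w = (y 0 - x 0) * (w.1 1 - x 1) - (y 1 - x 1) * (w.1 0 - x 0) from rfl]
        ring
      linarith
    · have h := (mem_hullBoundary_iff_not_inner hS hc c).2 hin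
      rw [hullBoundary_eq] at h
      refine h.2 ((convex_convexHull ℝ _).interior.segment_subset hxi hyi ?_)
      rw [mem_segment_iff']
      exact ⟨1 - γ, γ, by linarith, h0.le, by ring, by linarith, by linarith⟩
  have param : ∀ z : Plane, z ∈ drawing G → ∀ β : ℝ, z 0 = x 0 + β * (y 0 - x 0) →
      z 1 = x 1 + β * (y 1 - x 1) → β ≠ 0 ∧ β ≠ 1 := by
    intro z hz β h0 h1
    refine ⟨?_, ?_⟩
    · rintro rfl
      refine hxD ?_
      rwa [← plane_ext (a := z) (b := x) (by linarith) (by linarith)]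
    · rintro rfl
      refine hyD ?_
      rwa [← plane_ext (a := z) (b := y) (by linarith) (by linarith)]
  obtain ⟨s, β, hs, hβ, hsβ, h0, h1⟩ := mem_segment_iff'.1 hb
  obtain rfl : s = 1 - β := by linarith
  replace h0 : b 0 = x 0 + β * (y 0 - x 0) := by linarith
  replace h1 : b 1 = x 1 + β * (y 1 - x 1) := by linarith
  obtain ⟨hβ0, hβ1⟩ := param b hbD β h0 h1
  replace hβ0 : 0 < β := lt_of_le_of_ne hβ hβ0.symm
  replace hβ1 : β < 1 := lt_of_le_of_ne (by linarith) hβ1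
  obtain ⟨c, d, hcd, hbcd⟩ := exists_of_mem_drawing hbD
  have hseg := segment_subset_drawing hcd
  have hbc : segment ℝ b (c : Plane) ⊆ drawing G :=
    ((convex_segment _ _).segment_subset hbcd (left_mem_segment ℝ _ _)).trans hseg
  have hbd : segment ℝ b (d : Plane) ⊆ drawing G :=
    ((convex_segment _ _).segment_subset hbcd (right_mem_segment ℝ _ _)).trans hseg
  have k1 := not_enter_swept hβ0 hβ1 h0 h1 hsweep hbc
  have k2 := not_enter_swept hβ0 hβ1 h0 h1 hsweep hbd
  obtain ⟨s, t, hs, ht, hst, e0, e1⟩ := mem_segment_iff'.1 hbcd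
  have hb0 : ori x y b = 0 := by unfold ori; rw [h0, h1]; ring
  have hcomb := ori_combo hst e0 e1 x y
  rw [hb0] at hcomb
  -- Neither end of the edge through `b` is strictly on the side of `a`, so either `b` is an end or
  -- the whole edge lies on the line `x y`.
  rcases hs.eq_or_lt with rfl | hs
  · obtain rfl : t = 1 := by linarith
    exact vertex d β hβ0 hβ1 (by linarith) (by linarith)
  rcases ht.eq_or_lt with rfl | ht
  · obtain rfl : s = 1 := by linarith
    exact vertex c β hβ0 hβ1 (by linarith) (by linarith)
  have hc0 : ori x y c = 0 := by
    have : s * (ori x y a * ori x y c) + t * (ori x y a * ori x y d) = 0 := by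
      linear_combination (- ori x y a) * hcomb
    have g1 := mul_nonneg hs.le (neg_nonneg.2 k1)
    have g2 := mul_nonneg ht.le (neg_nonneg.2 k2)
    have : s * (ori x y a * ori x y c) = 0 := by linarith
    simpa [hs.ne', hκ] using this
  -- `c` lies on the line through `x` and `y`
  obtain ⟨γ, c0, c1⟩ : ∃ γ : ℝ, (c : Plane) 0 = x 0 + γ * (y 0 - x 0) ∧
      (c : Plane) 1 = x 1 + γ * (y 1 - x 1) := by
    unfold ori at hc0
    by_cases hy0 : y 0 - x 0 = 0
    · have hy1 : y 1 - x 1 ≠ 0 := by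
        intro hy1
        apply hκ
        unfold ori; rw [hy0, hy1]; ring
      refine ⟨((c : Plane) 1 - x 1) / (y 1 - x 1), ?_, by field_simp; ring⟩
      rw [hy0] at hc0 ⊢
      have := mul_eq_zero.1 (show (y 1 - x 1) * ((c : Plane) 0 - x 0) = 0 by linarith)
      have := this.resolve_left hy1
      linarith
    · refine ⟨((c : Plane) 0 - x 0) / (y 0 - x 0), by field_simp; ring, ?_⟩
      field_simp
      linarith
  -- Moving from `b` to `c` along the edge never meets `x` or `y`, which are undrawn, so `c` is
  -- still strictly between them.
  have hmid : ∀ τ : ℝ, 0 ≤ τ → τ ≤ 1 → (1 - τ) * β + τ * γ ≠ 0 ∧ (1 - τ) * β + τ * γ ≠ 1 := by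
    intro τ h2 h3
    refine param ((1 - τ) • b + τ • (c : Plane)) (hbc ⟨1 - τ, τ, by linarith, h2, by ring, rfl⟩) _ ?_ ?_
    · simp [h0, c0]; ring
    · simp [h1, c1]; ring
  refine vertex c γ ?_ ?_ c0 c1
  · by_contra hγ
    push Not at hγ
    refine (hmid (β / (β - γ)) (div_nonneg hβ (by linarith)) ?_).1 ?_
    · rw [div_le_one (by linarith)]; linarith
    · have : β - γ ≠ 0 := by linarith
      field_simp; ring
  · by_contra hγ
    push Not at hγ
    refine (hmid ((1 - β) / (γ - β)) (div_nonneg (by linarith) (by linarith)) ?_).2 ?_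
    · rw [div_le_one (by linarith)]; linarith
    · have : γ - β ≠ 0 := by linarith
      field_simp; ring

theorem segment_subset_of_collinear {A : Set Plane} {x y a : Plane} (hκ : ori x y a = 0)
    (hxa : segment ℝ x a ⊆ A) (hay : segment ℝ a y ⊆ A) : segment ℝ x y ⊆ A := by
  by_cases hxy : x = y
  · subst hxy
    rw [segment_same]
    rintro _ rfl
    exact hxa (left_mem_segment ℝ _ _)
  have hcol := collinear_of_ori_eq_zero hxy hκ
  have : Wbtw ℝ x y a ∨ Wbtw ℝ y a x ∨ Wbtw ℝ a x y := hcol.wbtw_or_wbtw_or_wbtw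
  have hsub : segment ℝ x y ⊆ segment ℝ x a ∪ segment ℝ a y := by
    rcases this with h | h | h
    · exact ((convex_segment _ _).segment_subset (left_mem_segment ℝ _ _)
        (mem_segment_iff_wbtw.2 h)).trans Set.subset_union_left
    · intro z hz
      have ha : a ∈ segment ℝ x y := mem_segment_iff_wbtw.2 h.symm
      obtain ⟨s, t, hs, ht, hst, rfl⟩ := ha
      obtain ⟨s', t', hs', ht', hst', rfl⟩ := hz
      obtain rfl : s = 1 - t := by linarith
      obtain rfl : s' = 1 - t' := by linarith
      rcases le_total t' t with htt | htt
      · left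
        rcases ht.eq_or_lt with rfl | ht
        · obtain rfl : t' = 0 := by linarith
          simp
        · rw [mem_segment_iff']
          refine ⟨1 - t' / t, t' / t, ?_, by positivity, by ring, ?_, ?_⟩
          · rw [sub_nonneg, div_le_one ht]; exact htt
          · simp; field_simp; ring
          · simp; field_simp; ring
      · right
        rcases hs.eq_or_lt with hs0 | hs
        · obtain rfl : t = 1 := by linarith
          obtain rfl : t' = 1 := by linarith
          simp
        · rw [mem_segment_iff']
          refine ⟨(1 - t') / (1 - t), 1 - (1 - t') / (1 - t), by positivity, ?_, by ring, ?_, ?_⟩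
          · rw [sub_nonneg, div_le_one hs]; linarith
          · simp; field_simp; ring
          · simp; field_simp; ring
    · exact ((convex_segment _ _).segment_subset (mem_segment_iff_wbtw.2 h)
        (right_mem_segment ℝ _ _)).trans Set.subset_union_right
  exact hsub.trans (Set.union_subset hxa hay)

theorem isOpen_star {A : Set Plane} (hA : IsOpen A) (x : Plane) :
    IsOpen {y : Plane | segment ℝ x y ⊆ A} := by
  rw [Metric.isOpen_iff]
  intro y hy
  have hcomp : IsCompact (segment ℝ x y) := by
    rw [← convexHull_pair]
    exact (Set.toFinite _).isCompact_convexHull (𝕜 := ℝ)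
  obtain ⟨δ, hδ, hsub⟩ := hcomp.exists_thickening_subset_open hA hy
  refine ⟨δ, hδ, fun y' hy' => ?_⟩
  rintro z ⟨s, t, hs, ht, hst, rfl⟩
  refine hsub (Metric.mem_thickening_iff.2 ⟨s • x + t • y, ⟨s, t, hs, ht, hst, rfl⟩, ?_⟩)
  rw [dist_add_left, dist_smul₀, Real.norm_eq_abs, abs_of_nonneg ht]
  have : dist y' y < δ := hy'
  nlinarith [dist_nonneg (x := y') (y := y)]

/-- If the kept edges surround every inner point, all bounded faces are convex. -/
theorem convex_face (hS : InGeneralPosition S) (hc : 2 ≤ S.card) {G : SimpleGraph S}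
    (hb : hullBoundary S ⊆ drawing G) (hsur : ∀ v : S, IsInner v → Surrounded G v) {A : Set Plane}
    (hA : IsFace G A) (hbd : Bornology.IsBounded A) : Convex ℝ A := by
  have hAh := face_subset_hull hA hbd
  obtain ⟨x₀, hx₀, rfl⟩ := hA
  set A := connectedComponentIn (drawing G)ᶜ x₀ with hAdef
  have hAD : A ⊆ (drawing G)ᶜ := connectedComponentIn_subset _ _
  have hAi : A ⊆ interior (convexHull ℝ (S : Set Plane)) := by
    intro z hz
    by_contra hzi
    refine hAD hz (hb ?_)
    rw [hullBoundary_eq]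
    exact ⟨hAh hz, hzi⟩
  have hopen : IsOpen A := (isClosed_drawing G).isOpen_compl.connectedComponentIn
  have hseg : ∀ x ∈ A, ∀ y : Plane, Disjoint (segment ℝ x y) (drawing G) → segment ℝ x y ⊆ A := by
    intro x hx y hd
    rw [hAdef, connectedComponentIn_eq hx]
    exact (convex_segment x y).isPreconnected.subset_connectedComponentIn (left_mem_segment ℝ _ _)
      (Set.subset_compl_iff_disjoint_right.2 hd)
  -- The set of points visible from `x` is open. For closedness within `A`, a visible `a` near `y`
  -- is moved straight to `y`; the first invisible point `y'` on the way bounds a triangle `x a y'`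
  -- whose other sight lines are clear.
  have hstar : ∀ x ∈ A, A ⊆ {y : Plane | segment ℝ x y ⊆ A} := by
    intro x hx
    refine isPreconnected_connectedComponentIn.subset_of_closure_inter_subset (isOpen_star hopen x)
      ⟨x, hx, by simpa using hx⟩ ?_
    rintro y ⟨hycl, hyA⟩
    obtain ⟨r, hr, hball⟩ := Metric.isOpen_iff.1 hopen y hyA
    obtain ⟨a, ha, hay⟩ := Metric.mem_closure_iff.1 hycl r hr
    rw [dist_comm] at hay
    have hpath : ∀ s : ℝ, 0 ≤ s → s ≤ 1 → (1 - s) • a + s • y ∈ Metric.ball y r := by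
      intro s h0 h1
      exact convex_ball y r hay (Metric.mem_ball_self hr) (by linarith) h0 (by ring)
    let C : Set ℝ := Set.Icc 0 1 ∩ {s | ¬ segment ℝ x ((1 - s) • a + s • y) ⊆ A}
    by_contra hcon
    have hCne : C.Nonempty := ⟨1, by simp, by simpa using hcon⟩
    have hCcl : IsClosed C := by
      refine isClosed_Icc.inter ?_
      have hcont : Continuous fun s : ℝ => (1 - s) • a + s • y := by fun_prop
      exact ((isOpen_star hopen x).preimage hcont).isClosed_compl
    have hCbd : BddBelow C := ⟨0, fun s hs => hs.1.1⟩
    set m := sInf C with hm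
    obtain ⟨⟨hm0, hm1⟩, hmC⟩ : m ∈ C := hCcl.csInf_mem hCne hCbd
    have hbelow : ∀ s : ℝ, 0 ≤ s → s < m → segment ℝ x ((1 - s) • a + s • y) ⊆ A := by
      intro s h0 h1
      by_contra h
      exact absurd (csInf_le hCbd (show s ∈ C from ⟨⟨h0, by linarith⟩, h⟩)) h1.not_ge
    have hmpos : 0 < m := by
      refine lt_of_le_of_ne hm0 fun h => hmC ?_
      rw [← h]
      simpa using ha
    set y' := (1 - m) • a + m • y with hy'
    have hy'b : y' ∈ Metric.ball y r := hpath m hm0 hm1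
    refine hmC ?_
    by_cases hκ : ori x y' a = 0
    · refine segment_subset_of_collinear hκ ha ?_
      exact ((convex_ball y r).segment_subset hay hy'b).trans hball
    · refine hseg x hx y' (segment_disjoint_of_swept hS hc hsur (hAi hx) (hAi (hball hy'b))
        (hAD hx) (hAD (hball hy'b)) hκ fun s h0 h1 => ?_)
      have e : (1 - s) • a + s • y' = (1 - s * m) • a + (s * m) • y := by
        rw [hy', smul_add, smul_smul, smul_smul, ← add_assoc, ← add_smul]
        congr 2; ring
      rw [e]
      have := hbelow (s * m) (by positivity) (by nlinarith)
      exact Set.subset_compl_iff_disjoint_right.1 (this.trans hAD)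
  intro x hx
  exact starConvex_iff_segment_subset.2 fun y hy => hstar x hx hy

theorem isPsFlippable_of_surrounded (hS : InGeneralPosition S) (hc : 2 ≤ S.card)
    (hT : IsTriangulation T) (hF : (F : Set (Sym2 S)) ⊆ interiorEdges T)
    (hsur : ∀ v : S, IsInner v → Surrounded (T.deleteEdges F) v) : IsPsFlippable T F := by
  refine ⟨hF, fun A hA hb => convex_face hS hc (hullBoundary_subset_drawing hS hc hT hF) hsur hA hb,
    fun v => ?_⟩
  by_cases hv : IsInner v
  · obtain ⟨w, hw, -⟩ := hsur v hv 1 0 (by simp)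
    exact ⟨w, hw⟩
  · obtain ⟨w, hwv, h⟩ := exists_hull_succ hS hc hv
    refine ⟨w, ?_⟩
    rw [SimpleGraph.deleteEdges_adj]
    refine ⟨adj_of_one_sided hS hT hwv.symm h, fun hmem => ?_⟩
    obtain ⟨-, -, p, hp⟩ := (mem_interiorEdges_iff hS hc).1 (hF hmem)
    exact absurd hp (h p).not_gt

end

/-! ### Maximal deletable sets and needed edges -/

section
open Classical
variable {S : Finset Plane} {T : SimpleGraph S} {F : Finset (Sym2 S)}

/-- The directed edges of an edge set. -/
noncomputable def dartsOf (F : Finset (Sym2 S)) : Finset (S × S) :=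
  Finset.univ.filter fun e => s(e.1, e.2) ∈ F

theorem card_dartsOf (hF : ∀ e ∈ F, e ∈ T.edgeSet) : (dartsOf F).card = 2 * F.card := by
  rw [Finset.card_eq_sum_card_fiberwise (f := fun e : S × S => s(e.1, e.2)) (t := F)
    (by intro e he; exact (Finset.mem_filter.1 he).2)]
  rw [Finset.sum_const_nat (m := 2), mul_comm]
  intro e he
  have he' := hF e he
  induction e with
  | _ a b =>
    have hab : a ≠ b := SimpleGraph.Adj.ne he'
    have : ((dartsOf F).filter fun e : S × S => s(e.1, e.2) = s(a, b)) = {(a, b), (b, a)} := by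
      ext ⟨u, v⟩
      simp only [dartsOf, Finset.mem_filter, Finset.mem_univ, true_and, Finset.mem_insert,
        Finset.mem_singleton, Prod.mk.injEq, Sym2.eq_iff]
      constructor
      · rintro ⟨-, h⟩; exact h
      · rintro (⟨rfl, rfl⟩ | ⟨rfl, rfl⟩)
        · exact ⟨he, by simp⟩
        · exact ⟨by rwa [Sym2.eq_swap], by simp⟩
    rw [this, Finset.card_pair (by simp [hab])]

theorem mem_innerDarts {u v : S} : (u, v) ∈ innerDarts T ↔
    T.Adj u v ∧ (∃ p : S, 0 < ori u v p) ∧ ∃ p : S, ori u v p < 0 := by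
  simp [innerDarts]

theorem mem_innerDarts_swap {u v : S} : (u, v) ∈ innerDarts T ↔ (v, u) ∈ innerDarts T := by
  rw [mem_innerDarts, mem_innerDarts, T.adj_comm u v]
  constructor
  · rintro ⟨h, ⟨p, hp⟩, q, hq⟩
    exact ⟨h, ⟨q, by rw [ori_swap]; linarith⟩, p, by rw [ori_swap]; linarith⟩
  · rintro ⟨h, ⟨p, hp⟩, q, hq⟩
    exact ⟨h, ⟨q, by rw [ori_swap]; linarith⟩, p, by rw [ori_swap]; linarith⟩

theorem mem_innerDarts_iff (hS : InGeneralPosition S) (hc : 2 ≤ S.card) {u v : S} :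
    (u, v) ∈ innerDarts T ↔ s(u, v) ∈ interiorEdges T := by
  rw [mem_innerDarts, mem_interiorEdges_iff hS hc]

/-- The number of interior edges of a triangulation. -/
theorem card_interiorEdges (hS : InGeneralPosition S) (hc : 3 ≤ S.card) (hT : IsTriangulation T)
    {E : Finset (Sym2 S)} (hE : (E : Set (Sym2 S)) = interiorEdges T) :
    E.card + 3 = 2 * (innerPoints S).card + S.card := by
  have h1 : dartsOf E = innerDarts T := by
    ext ⟨u, v⟩
    rw [mem_innerDarts_iff hS (by omega), ← hE]
    simp [dartsOf]
  have h2 := card_dartsOf (T := T) (F := E) (fun e he => by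
    have : e ∈ interiorEdges T := hE ▸ he
    exact this.1)
  have h3 := card_innerDarts hS hc hT
  rw [h1] at h2
  omega

theorem adj_innerDarts {u v : S} (hu : IsInner u) (h : T.Adj u v) : (u, v) ∈ innerDarts T :=
  mem_innerDarts.2 ⟨h, hu.exists_left h.ne, hu.exists_right h.ne⟩

/-- Removing `v` from the neighbours of `u` leaves a half-plane at `u` empty. -/
def Needs (G : SimpleGraph S) (u v : S) : Prop :=
  IsInner u ∧ G.Adj u v ∧ ∃ d₀ d₁ : ℝ, (d₀ ≠ 0 ∨ d₁ ≠ 0) ∧ ∀ w, G.Adj u w → w ≠ v → dev d₀ d₁ u w ≤ 0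

/-- All inner points remain surrounded after the deletion of `F`. -/
def KeepsSurrounded (T : SimpleGraph S) (F : Finset (Sym2 S)) : Prop :=
  (F : Set (Sym2 S)) ⊆ interiorEdges T ∧ ∀ v : S, IsInner v → Surrounded (T.deleteEdges F) v

/-- If an interior edge cannot be added to a set of maximum size, its deletion empties an open
half-plane at some inner `z`. That edge had the only neighbour of `z` there, so `z` is an end of it
and needs it. -/
theorem exists_maximal_keepsSurrounded (hS : InGeneralPosition S) (hT : IsTriangulation T) :
    ∃ F : Finset (Sym2 S), KeepsSurrounded T F ∧
      ∀ u v : S, s(u, v) ∈ interiorEdges T → s(u, v) ∉ F →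
        Needs (T.deleteEdges F) u v ∨ Needs (T.deleteEdges F) v u := by
  obtain ⟨F, hF, hmax⟩ := (Finset.univ.filter fun F : Finset (Sym2 S) => KeepsSurrounded T F).exists_max_image
    Finset.card ⟨∅, by simpa [KeepsSurrounded] using fun v hv hv' => IsInner.surrounded hS hT hv'⟩
  simp only [Finset.mem_filter, Finset.mem_univ, true_and] at hF hmax
  refine ⟨F, hF, fun u v huv huvF => ?_⟩
  have hins : ¬ KeepsSurrounded T (insert s(u, v) F) := by
    intro h
    have := hmax _ h
    rw [Finset.card_insert_of_notMem huvF] at this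
    omega
  have hsub : ((insert s(u, v) F : Finset (Sym2 S)) : Set (Sym2 S)) ⊆ interiorEdges T := by
    rw [Finset.coe_insert]
    exact Set.insert_subset huv hF.1
  have : ∃ z : S, IsInner z ∧ ∃ d₀ d₁ : ℝ, (d₀ ≠ 0 ∨ d₁ ≠ 0) ∧
      ∀ w, (T.deleteEdges (insert s(u, v) F : Finset (Sym2 S))).Adj z w → dev d₀ d₁ z w ≤ 0 := by
    by_contra hcon
    push Not at hcon
    exact hins ⟨hsub, fun z hz d₀ d₁ hd => hcon z hz d₀ d₁ hd⟩
  obtain ⟨z, hz, d₀, d₁, hd, hle⟩ := this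
  have huvG : (T.deleteEdges F).Adj u v := by
    rw [SimpleGraph.deleteEdges_adj]
    exact ⟨huv.1, huvF⟩
  have hadj : ∀ w, (T.deleteEdges F).Adj z w → s(z, w) ≠ s(u, v) → dev d₀ d₁ z w ≤ 0 := by
    intro w hw hne
    refine hle w ?_
    rw [SimpleGraph.deleteEdges_adj] at hw ⊢
    refine ⟨hw.1, ?_⟩
    rw [Finset.coe_insert, Set.mem_insert_iff]
    exact fun h => h.elim hne hw.2
  obtain ⟨w, hw, hpos⟩ := hF.2 z hz d₀ d₁ hd
  have hedge : s(z, w) = s(u, v) := by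
    by_contra h
    exact absurd hpos (hadj w hw h).not_gt
  rw [Sym2.eq_iff] at hedge
  rcases hedge with ⟨rfl, rfl⟩ | ⟨rfl, rfl⟩
  · refine Or.inl ⟨hz, huvG, d₀, d₁, hd, fun x hx hne => hadj x hx ?_⟩
    rw [Ne, Sym2.eq_iff]
    rintro (⟨-, h⟩ | ⟨h, -⟩)
    · exact hne h
    · exact hw.ne h
  · refine Or.inr ⟨hz, huvG.symm, d₀, d₁, hd, fun x hx hne => hadj x hx ?_⟩
    rw [Ne, Sym2.eq_iff]
    rintro (⟨h, -⟩ | ⟨-, h⟩)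
    · exact hw.ne h
    · exact hne h

/-- A kept edge does not lie between two needed edges that form a convex angle. -/
theorem needs_not_cone (hS : InGeneralPosition S) {G : SimpleGraph S} {u x y z : S}
    (hsur : Surrounded G u) (hx : Needs G u x) (hy : Needs G u y) (hz : G.Adj u z)
    (h1 : 0 < ori u x z) (h2 : 0 < ori u z y) (hxy : 0 < ori u x y) : False := by
  obtain ⟨-, hux, d₀, d₁, hd, hl⟩ := hx
  obtain ⟨-, huy, e₀, e₁, he, hm⟩ := hy
  have hzx : z ≠ x := by rintro rfl; simp at h1
  have hzy : z ≠ y := by rintro rfl; simp at h2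
  have hyx : y ≠ x := by rintro rfl; simp at hxy
  have lx : 0 < dev d₀ d₁ u x := by
    obtain ⟨w, hw, hpos⟩ := hsur d₀ d₁ hd
    by_cases h : w = x
    · exact h ▸ hpos
    · exact absurd hpos (hl w hw h).not_gt
  have my : 0 < dev e₀ e₁ u y := by
    obtain ⟨w, hw, hpos⟩ := hsur e₀ e₁ he
    by_cases h : w = y
    · exact h ▸ hpos
    · exact absurd hpos (hm w hw h).not_gt
  have ly := hl y huy hyx
  have mx := hm x hux hyx.symm
  have lz := hl z hz hzx
  have mz := hm z hz hzy
  have dl : ori u x y * dev d₀ d₁ u z = ori u z y * dev d₀ d₁ u x + ori u x z * dev d₀ d₁ u y := by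
    unfold ori dev; ring
  have dm : ori u x y * dev e₀ e₁ u z = ori u z y * dev e₀ e₁ u x + ori u x z * dev e₀ e₁ u y := by
    unfold ori dev; ring
  have nl : ori u x y * dev d₀ d₁ u z ≤ 0 := mul_nonpos_of_nonneg_of_nonpos hxy.le lz
  have nm : ori u x y * dev e₀ e₁ u z ≤ 0 := mul_nonpos_of_nonneg_of_nonpos hxy.le mz
  -- Write `l` and `m` for the two functionals: among the neighbours, `l` is positive only at `x`
  -- and `m` only at `y`. Since `z - u` is a positive combination of `x - u` and `y - u` while `l`
  -- and `m` are nonpositive at `z`, `l x * m y ≤ m x * l y`.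
  have gy : dev d₀ d₁ u x * dev e₀ e₁ u y - dev e₀ e₁ u x * dev d₀ d₁ u y ≤ 0 := by
    have g1 : ori u z y * dev d₀ d₁ u x ≤ ori u x z * (- dev d₀ d₁ u y) := by linarith
    have g2 : ori u x z * dev e₀ e₁ u y ≤ ori u z y * (- dev e₀ e₁ u x) := by linarith
    have g3 := mul_le_mul g1 g2 (mul_nonneg h1.le my.le) (mul_nonneg h1.le (neg_nonneg.2 ly))
    have : (ori u x z * ori u z y) *
      (dev d₀ d₁ u x * dev e₀ e₁ u y - dev e₀ e₁ u x * dev d₀ d₁ u y) ≤ 0 := by linarith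
    exact nonpos_of_mul_nonpos_right this (mul_pos h1 h2)
  -- The combination `-m(x) l + l(x) m` vanishes at `x` and is nonpositive at all other neighbours,
  -- so it contradicts surroundedness unless it is identically zero.
  set a := - dev e₀ e₁ u x with ha
  set b := dev d₀ d₁ u x with hb
  have comb : ∀ w : S, dev (a * d₀ + b * e₀) (a * d₁ + b * e₁) u w =
      a * dev d₀ d₁ u w + b * dev e₀ e₁ u w := by intro w; unfold dev; ring
  have gle : ∀ w : S, G.Adj u w → a * dev d₀ d₁ u w + b * dev e₀ e₁ u w ≤ 0 := by
    intro w hw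
    by_cases hwx : w = x
    · subst hwx
      rw [ha, hb]; linarith
    · by_cases hwy : w = y
      · subst hwy
        rw [ha]; linarith
      · have := mul_nonneg (show 0 ≤ a by linarith) (neg_nonneg.2 (hl w hw hwx))
        have := mul_nonneg lx.le (neg_nonneg.2 (hm w hw hwy))
        linarith
  by_cases hne : a * d₀ + b * e₀ ≠ 0 ∨ a * d₁ + b * e₁ ≠ 0
  · obtain ⟨w, hw, hpos⟩ := hsur _ _ hne
    rw [comb] at hpos
    exact absurd hpos (gle w hw).not_gt
  · push Not at hne
    -- In the degenerate case all neighbours except `x` and `y` lie on one line through `u`. A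
    -- neighbour strictly right of `u x` is a second one besides `z`, against general position.
    have hzero : ∀ w : S, a * dev d₀ d₁ u w + b * dev e₀ e₁ u w = 0 := by
      intro w; rw [← comb]; unfold dev; rw [hne.1, hne.2]; ring
    have hline : ∀ w : S, G.Adj u w → w ≠ x → w ≠ y → dev e₀ e₁ u w = 0 := by
      intro w hw hwx hwy
      have := mul_nonneg (show 0 ≤ a by linarith) (neg_nonneg.2 (hl w hw hwx))
      have h0 := hzero w
      have h3 := hm w hw hwy
      have : 0 ≤ b * dev e₀ e₁ u w := by linarith
      exact le_antisymm h3 (nonneg_of_mul_nonneg_right this lx)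
    have hz0 := hline z hz hzx hzy
    have hD : 0 < e₀ ^ 2 + e₁ ^ 2 := sq_add_sq_pos_of_dev my.ne'
    obtain ⟨w, hw, hpos⟩ := hsur _ _ (coord_sub_ne_zero hux.ne)
    have hpos' : ori u x w < 0 := by
      rw [ori_eq_dev, dev_neg]; linarith
    by_cases hwx : w = x
    · subst hwx; simp at hpos'
    by_cases hwy : w = y
    · subst hwy; linarith
    have hw0 := hline w hw hwx hwy
    have e : (e₀ ^ 2 + e₁ ^ 2) * ori u z w =
      dev e₀ e₁ u z * (((w : Plane) 0 - (u : Plane) 0) * e₀ + ((w : Plane) 1 - (u : Plane) 1) * e₁) -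
      dev e₀ e₁ u w * (((z : Plane) 0 - (u : Plane) 0) * e₀ + ((z : Plane) 1 - (u : Plane) 1) * e₁) := by
      unfold ori dev; ring
    rw [hz0, hw0] at e
    simp [hD.ne'] at e
    rcases eq_or_eq_of_ori_eq_zero hS hz.ne e with rfl | rfl
    · exact hw.ne rfl
    · linarith

/-- A vertex that is surrounded by four or more neighbours needs at most two of them. -/
theorem card_needs_le_two (hS : InGeneralPosition S) {G : SimpleGraph S} {u : S}
    (hsur : Surrounded G u) (hdeg : (Finset.univ.filter fun v => G.Adj u v).card ≠ 3) :
    (Finset.univ.filter fun v => Needs G u v).card ≤ 2 := by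
  by_contra hcard
  push Not at hcard
  obtain ⟨x, y, w, hx, hy, hw, hxy, hxw, hyw⟩ := Finset.two_lt_card_iff.1 hcard
  simp only [Finset.mem_filter, Finset.mem_univ, true_and] at hx hy hw
  obtain ⟨z, hz, hzn⟩ : ∃ z, G.Adj u z ∧ z ∉ ({x, y, w} : Finset S) := by
    by_contra hcon
    push Not at hcon
    apply hdeg
    have : (Finset.univ.filter fun v => G.Adj u v) = {x, y, w} := by
      ext v
      simp only [Finset.mem_filter, Finset.mem_univ, true_and]
      refine ⟨hcon v, fun hv => ?_⟩
      simp only [Finset.mem_insert, Finset.mem_singleton] at hv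
      rcases hv with rfl | rfl | rfl
      exacts [hx.2.1, hy.2.1, hw.2.1]
    rw [this, Finset.card_eq_three]
    exact ⟨x, y, w, hxy, hxw, hyw, rfl⟩
  simp only [Finset.mem_insert, Finset.mem_singleton, not_or] at hzn
  obtain ⟨hzx, hzy, hzw⟩ := hzn
  have C : ∀ p q r : S, Needs G u p → Needs G u q → G.Adj u r → 0 < ori u p q → 0 < ori u p r →
      0 < ori u r q → False := fun p q r hp hq hr h1 h2 h3 =>
    needs_not_cone hS hsur hp hq hr h2 h3 h1
  have sw : ∀ p q : S, ori u p q < 0 → 0 < ori u q p := fun p q h => by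
    rw [ori_swap_right]; linarith
  have hz' : ∀ p, G.Adj u p → p ≠ z → ori u p z ≠ 0 := fun p hp hne => ori_ne_zero hS hp.ne hz.ne hne
  -- the ordered case
  have main : ∀ x y w : S, Needs G u x → Needs G u y → Needs G u w → x ≠ z → y ≠ z → w ≠ z →
      0 < ori u x y → 0 < ori u y w → 0 < ori u w x → False := by
    clear hx hy hw hxy hxw hyw hzx hzy hzw hcard
    intro x y w hx hy hw hxz hyz hwz h1 h2 h3
    have e : ori u y w * ori u x z + ori u w x * ori u y z + ori u x y * ori u w z = 0 := by
      unfold ori; ring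
    rcases lt_or_gt_of_ne (hz' x hx.2.1 hxz) with a | a <;>
      rcases lt_or_gt_of_ne (hz' y hy.2.1 hyz) with b | b <;>
      rcases lt_or_gt_of_ne (hz' w hw.2.1 hwz) with c | c
    · linarith [mul_neg_of_pos_of_neg h2 a, mul_neg_of_pos_of_neg h3 b, mul_neg_of_pos_of_neg h1 c]
    · exact C w x z hw hx hz h3 c (sw _ _ a)
    · exact C y w z hy hw hz h2 b (sw _ _ c)
    · exact C w x z hw hx hz h3 c (sw _ _ a)
    · exact C x y z hx hy hz h1 a (sw _ _ b)
    · exact C x y z hx hy hz h1 a (sw _ _ b)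
    · exact C y w z hy hw hz h2 b (sw _ _ c)
    · linarith [mul_pos h2 a, mul_pos h3 b, mul_pos h1 c]
  -- Either the three needed neighbours go around `u`, and `z` is in one of their three angles, or
  -- one of them lies in the convex angle of the other two.
  rcases lt_or_gt_of_ne (ori_ne_zero hS hx.2.1.ne hy.2.1.ne hxy) with a | a <;>
    rcases lt_or_gt_of_ne (ori_ne_zero hS hy.2.1.ne hw.2.1.ne hyw) with b | b <;>
    rcases lt_or_gt_of_ne (ori_ne_zero hS hw.2.1.ne hx.2.1.ne hxw.symm) with c | c
  · exact main y x w hy hx hw (Ne.symm hzy) (Ne.symm hzx) (Ne.symm hzw) (sw _ _ a) (sw _ _ c) (sw _ _ b)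
  · exact C w x y hw hx hy.2.1 c (sw _ _ b) (sw _ _ a)
  · exact C y w x hy hw hx.2.1 b (sw _ _ a) (sw _ _ c)
  · exact C y x w hy hx hw.2.1 (sw _ _ a) b c
  · exact C x y w hx hy hw.2.1 a (sw _ _ c) (sw _ _ b)
  · exact C w y x hw hy hx.2.1 (sw _ _ b) c a
  · exact C x w y hx hw hy.2.1 (sw _ _ c) a b
  · exact main x y w hx hy hw (Ne.symm hzx) (Ne.symm hzy) (Ne.symm hzw) a b c

/-- `e` is one of the three directed sides of the face `t`. -/
def IsSide (t : S × S × S) (e : S × S) : Prop :=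
  e = (t.1, t.2.1) ∨ e = (t.2.1, t.2.2) ∨ e = (t.2.2, t.1)

/-- The face left of a directed edge is unique, and listing its middle vertex first leaves one
rotation of the triple. -/
theorem midFaces_side_unique (hS : InGeneralPosition S) (hT : IsTriangulation T) {d₀ d₁ : ℝ}
    {t t' : S × S × S} {e : S × S} (ht : t ∈ midFaces T d₀ d₁) (ht' : t' ∈ midFaces T d₀ d₁)
    (he : IsSide t e) (he' : IsSide t' e) : t = t' := by
  obtain ⟨p, q⟩ := e
  have key : ∀ t ∈ midFaces T d₀ d₁, IsSide t (p, q) → ∃ r, IsTri T p q r ∧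
      (t = (p, q, r) ∨ t = (r, p, q) ∨ t = (q, r, p)) := by
    rintro ⟨u, v, w⟩ ht he
    simp only [midFaces, Finset.mem_filter, Finset.mem_univ, true_and] at ht
    rcases he with h | h | h <;> simp only [Prod.mk.injEq] at h <;> obtain ⟨rfl, rfl⟩ := h
    · exact ⟨w, ht.1, by simp⟩
    · exact ⟨u, ht.1.rotate, by simp⟩
    · exact ⟨v, ht.1.rotate.rotate, by simp⟩
  obtain ⟨r, hr, h⟩ := key t ht he
  obtain ⟨r', hr', h'⟩ := key t' ht' he'
  obtain rfl := hr.unique hS hT.1 hr'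
  have a1 := dev_antisymm d₀ d₁ (p : Plane) q
  have a2 := dev_antisymm d₀ d₁ (q : Plane) r
  have a3 := dev_antisymm d₀ d₁ (r : Plane) p
  have a4 : dev d₀ d₁ p q + dev d₀ d₁ q r + dev d₀ d₁ r p = 0 := by unfold dev; ring
  simp only [midFaces, Finset.mem_filter, Finset.mem_univ, true_and] at ht ht'
  rcases h with rfl | rfl | rfl <;> rcases h' with rfl | rfl | rfl <;> first
    | rfl
    | (exfalso
       simp only at ht ht'
       rcases ht.2 with ⟨b1, b2⟩ | ⟨b1, b2⟩ <;> rcases ht'.2 with ⟨c1, c2⟩ | ⟨c1, c2⟩ <;> linarith)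

end

/-! ### The charging argument -/

section
open Classical
variable {S : Finset Plane} {T : SimpleGraph S} {F : Finset (Sym2 S)}

/-- The directed interior edges of `T` that are not in `F`. -/
noncomputable def keptDarts (T : SimpleGraph S) (F : Finset (Sym2 S)) : Finset (S × S) :=
  (innerDarts T).filter fun e => s(e.1, e.2) ∉ F

/-- Inner points that keep exactly three edges. -/
def IsCubic (T : SimpleGraph S) (F : Finset (Sym2 S)) (u : S) : Prop :=
  IsInner u ∧ (Finset.univ.filter fun v => (T.deleteEdges F).Adj u v).card = 3

/-- `u` is the endpoint in charge of the kept interior edge `u v`, neither end of which is cubic. -/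
def InCharge (T : SimpleGraph S) (F : Finset (Sym2 S)) (u v : S) : Prop :=
  (u, v) ∈ keptDarts T F ∧ ¬ IsCubic T F u ∧ ¬ IsCubic T F v ∧ Needs (T.deleteEdges F) u v ∧
    -- The arbitrary numbering only breaks ties when both ends need the edge.
    (Needs (T.deleteEdges F) v u → Fintype.equivFin S u < Fintype.equivFin S v)

theorem mem_keptDarts {u v : S} : (u, v) ∈ keptDarts T F ↔ (u, v) ∈ innerDarts T ∧ s(u, v) ∉ F := by
  simp [keptDarts]

theorem keptDarts_swap {u v : S} : (u, v) ∈ keptDarts T F ↔ (v, u) ∈ keptDarts T F := by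
  rw [mem_keptDarts, mem_keptDarts, mem_innerDarts_swap, Sym2.eq_swap]

theorem keptDarts_adj {u v : S} (h : (u, v) ∈ keptDarts T F) : (T.deleteEdges F).Adj u v := by
  rw [mem_keptDarts] at h
  rw [SimpleGraph.deleteEdges_adj]
  exact ⟨(mem_innerDarts.1 h.1).1, h.2⟩

theorem InCharge.asymm {u v : S} (h : InCharge T F u v) (h' : InCharge T F v u) : False :=
  lt_asymm (h.2.2.2.2 h'.2.2.2.1) (h'.2.2.2.2 h.2.2.2.1)

/-- The surviving face next to two edges that `u` is in charge of is the triangle they span. -/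
theorem InCharge.corner (hS : InGeneralPosition S) (hT : IsTriangulation T)
    (hF : KeepsSurrounded T F) {u x y z : S} (hx : InCharge T F u x) (hy : InCharge T F u y)
    (hxy : 0 < ori u x y) (ht : IsTri T u x z) (hz : s(u, z) ∉ F) : z = y := by
  by_contra hne
  have hx' := keptDarts_adj hx.1
  have hy' := keptDarts_adj hy.1
  have hz' : (T.deleteEdges F).Adj u z := by
    rw [SimpleGraph.deleteEdges_adj]; exact ⟨ht.wu.symm, hz⟩
  -- If `y` comes before `z` around `u`, the edge `u y` enters the face. If `z` comes first, `u z`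
  -- is a kept edge inside the angle of two needed ones.
  rcases lt_or_gt_of_ne (ori_ne_zero hS hz'.ne hy'.ne hne) with h | h
  · refine ht.not_cone hS hT.1 ?_ hxy (by rw [ori_swap_right]; linarith)
    exact (SimpleGraph.deleteEdges_adj.1 hy').1
  · exact needs_not_cone hS (hF.2 u hx.2.2.2.1.1) hx.2.2.2.1 hy.2.2.2.1 hz' ht.pos h hxy

theorem InCharge.corner' (hS : InGeneralPosition S) (hT : IsTriangulation T)
    (hF : KeepsSurrounded T F) {u x y z : S} (hx : InCharge T F u x) (hy : InCharge T F u y)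
    (hxy : 0 < ori u x y) (ht : IsTri T u z y) (hz : s(u, z) ∉ F) : z = x := by
  by_contra hne
  have hx' := keptDarts_adj hx.1
  have hy' := keptDarts_adj hy.1
  have hz' : (T.deleteEdges F).Adj u z := by
    rw [SimpleGraph.deleteEdges_adj]; exact ⟨ht.uv, hz⟩
  rcases lt_or_gt_of_ne (ori_ne_zero hS hz'.ne hx'.ne hne) with h | h
  · exact needs_not_cone hS (hF.2 u hx.2.2.2.1.1) hx.2.2.2.1 hy.2.2.2.1 hz'
      (by rw [ori_swap_right]; linarith) ht.pos hxy
  · exact ht.not_cone hS hT.1 (SimpleGraph.deleteEdges_adj.1 hx').1 h hxy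

/-- The sides of the angle between two edges that a vertex is in charge of. -/
def IsCornerDart (T : SimpleGraph S) (F : Finset (Sym2 S)) (p q : S) : Prop :=
  -- In both alternatives the edge is directed so that the angle is on its left.
  (∃ y, InCharge T F p q ∧ InCharge T F p y ∧ 0 < ori p q y) ∨
    ∃ x, InCharge T F q p ∧ InCharge T F q x ∧ 0 < ori q x p

/-- The directed edges that faces may be charged to. -/
noncomputable def chargeDarts (T : SimpleGraph S) (F : Finset (Sym2 S)) : Finset (S × S) :=
  hullDarts T ∪ (keptDarts T F).filter fun e => IsCubic T F e.1 ↔ IsCubic T F e.2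

noncomputable def cornerDarts (T : SimpleGraph S) (F : Finset (Sym2 S)) : Finset (S × S) :=
  Finset.univ.filter fun e => IsCornerDart T F e.1 e.2

/-- The faces all of whose edges are kept. -/
noncomputable def survivors (T : SimpleGraph S) (F : Finset (Sym2 S)) (d₀ d₁ : ℝ) :
    Finset (S × S × S) :=
  (midFaces T d₀ d₁).filter fun t => s(t.1, t.2.1) ∉ F ∧ s(t.2.1, t.2.2) ∉ F ∧ s(t.2.2, t.1) ∉ F

theorem side_mem (hS : InGeneralPosition S) (hc : 3 ≤ S.card) {u v w : S} (ht : IsTri T u v w)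
    (hF : s(u, v) ∉ F) : (u, v) ∈ hullDarts T ∨ (u, v) ∈ keptDarts T F := by
  have h : (u, v) ∈ leftDarts T := by simpa [leftDarts] using ⟨ht.uv, w, w.2, ht.pos⟩
  rw [(leftDarts_eq hS hc).1, Finset.mem_union] at h
  rcases h with h | h
  · exact Or.inr (mem_keptDarts.2 ⟨h, hF⟩)
  · exact Or.inl h

/-- A surviving face can be charged to one of its sides. -/
theorem exists_charge (hS : InGeneralPosition S) (hc : 3 ≤ S.card) (hT : IsTriangulation T)
    (hF : KeepsSurrounded T F) {u v w : S} (ht : IsTri T u v w) (h1 : s(u, v) ∉ F)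
    (h2 : s(v, w) ∉ F) (h3 : s(w, u) ∉ F) :
    ∃ e, IsSide (u, v, w) e ∧ e ∈ chargeDarts T F ∧ e ∉ cornerDarts T F := by
  -- if two edges at `p` that `p` is in charge of are sides, take the third side
  have opp : ∀ p q r : S, IsTri T p q r → s(p, q) ∉ F → s(q, r) ∉ F → s(r, p) ∉ F →
      InCharge T F p q → InCharge T F p r → (q, r) ∈ chargeDarts T F ∧ (q, r) ∉ cornerDarts T F := by
    intro p q r ht h1 h2 h3 hq hr
    constructor
    · rw [chargeDarts, Finset.mem_union, Finset.mem_filter]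
      rcases side_mem hS hc ht.rotate h2 with h | h
      · exact Or.inl h
      · exact Or.inr ⟨h, iff_of_false hq.2.2.1 hr.2.2.1⟩
    · simp only [cornerDarts, Finset.mem_filter, Finset.mem_univ, true_and]
      rintro (⟨y, a, b, c⟩ | ⟨x, a, b, c⟩)
      · have := InCharge.corner hS hT hF a b c ht.rotate (by rwa [Sym2.eq_swap])
        exact hq.asymm (this ▸ b)
      · have := InCharge.corner' hS hT hF b a c ht.rotate.rotate h3
        exact hr.asymm (this ▸ b)
  have corner : ∀ p q r : S, IsTri T p q r → s(p, q) ∉ F → s(q, r) ∉ F → s(r, p) ∉ F →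
      IsCornerDart T F p q → ∃ e, IsSide (p, q, r) e ∧ e ∈ chargeDarts T F ∧ e ∉ cornerDarts T F := by
    intro p q r ht h1 h2 h3 hpq
    rcases hpq with ⟨y, a, b, c⟩ | ⟨x, a, b, c⟩
    · obtain rfl := InCharge.corner hS hT hF a b c ht (by rwa [Sym2.eq_swap])
      exact ⟨(q, r), Or.inr (Or.inl rfl), opp p q r ht h1 h2 h3 a b⟩
    · obtain rfl := InCharge.corner' hS hT hF b a c ht.rotate h2
      exact ⟨(r, p), Or.inr (Or.inr rfl), opp q r p ht.rotate h2 h3 h1 b a⟩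
  by_cases c1 : IsCornerDart T F u v
  · exact corner u v w ht h1 h2 h3 c1
  by_cases c2 : IsCornerDart T F v w
  · obtain ⟨e, he, h⟩ := corner v w u ht.rotate h2 h3 h1 c2
    exact ⟨e, by unfold IsSide at he ⊢; tauto, h⟩
  by_cases c3 : IsCornerDart T F w u
  · obtain ⟨e, he, h⟩ := corner w u v ht.rotate.rotate h3 h1 h2 c3
    exact ⟨e, by unfold IsSide at he ⊢; tauto, h⟩
  -- No side borders such an angle now. Two of the three vertices agree on being cubic, and the side
  -- between them takes the charge.
  have charge : ∀ p q r : S, IsTri T p q r → s(p, q) ∉ F → (IsCubic T F p ↔ IsCubic T F q) →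
      (p, q) ∈ chargeDarts T F := by
    intro p q r ht h1 hiff
    rw [chargeDarts, Finset.mem_union, Finset.mem_filter]
    exact (side_mem hS hc ht h1).imp id fun h => ⟨h, hiff⟩
  by_cases e1 : IsCubic T F u ↔ IsCubic T F v
  · exact ⟨(u, v), Or.inl rfl, charge u v w ht h1 e1, by simpa [cornerDarts] using c1⟩
  by_cases e2 : IsCubic T F v ↔ IsCubic T F w
  · exact ⟨(v, w), Or.inr (Or.inl rfl), charge v w u ht.rotate h2 e2, by simpa [cornerDarts] using c2⟩
  · exact ⟨(w, u), Or.inr (Or.inr rfl), charge w u v ht.rotate.rotate h3 (by tauto),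
      by simpa [cornerDarts] using c3⟩

theorem card_survivors_le (hS : InGeneralPosition S) (hc : 3 ≤ S.card) (hT : IsTriangulation T)
    (hF : KeepsSurrounded T F) (d₀ d₁ : ℝ) :
    (survivors T F d₀ d₁).card ≤ (chargeDarts T F \ cornerDarts T F).card := by
  refine Finset.card_le_card_of_forall_subsingleton IsSide ?_ ?_
  · rintro ⟨u, v, w⟩ ht
    simp only [survivors, midFaces, Finset.mem_filter, Finset.mem_univ, true_and] at ht
    obtain ⟨e, he, h1, h2⟩ := exists_charge hS hc hT hF ht.1.1 ht.2.1 ht.2.2.1 ht.2.2.2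
    exact ⟨e, Finset.mem_sdiff.2 ⟨h1, h2⟩, he⟩
  · rintro e - t ⟨ht, hte⟩ t' ⟨ht', hte'⟩
    exact midFaces_side_unique hS hT (Finset.filter_subset _ _ ht) (Finset.filter_subset _ _ ht') hte hte'

theorem card_midFaces_le (hS : InGeneralPosition S) (hT : IsTriangulation T) (d₀ d₁ : ℝ) :
    (midFaces T d₀ d₁).card ≤ (survivors T F d₀ d₁).card + (dartsOf F).card := by
  have h1 : ((midFaces T d₀ d₁) \ survivors T F d₀ d₁).card ≤ (dartsOf F).card := by
    refine Finset.card_le_card_of_forall_subsingleton IsSide ?_ ?_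
    · rintro ⟨u, v, w⟩ ht
      rw [Finset.mem_sdiff, survivors, Finset.mem_filter] at ht
      have : s(u, v) ∈ F ∨ s(v, w) ∈ F ∨ s(w, u) ∈ F := by
        by_contra h
        push Not at h
        exact ht.2 ⟨ht.1, h⟩
      rcases this with h | h | h
      · exact ⟨(u, v), by simpa [dartsOf] using h, Or.inl rfl⟩
      · exact ⟨(v, w), by simpa [dartsOf] using h, Or.inr (Or.inl rfl)⟩
      · exact ⟨(w, u), by simpa [dartsOf] using h, Or.inr (Or.inr rfl)⟩
    · rintro e - t ⟨ht, hte⟩ t' ⟨ht', hte'⟩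
      exact midFaces_side_unique hS hT (Finset.sdiff_subset ht) (Finset.sdiff_subset ht') hte hte'
  have h2 := Finset.card_sdiff_add_card_eq_card (s := survivors T F d₀ d₁) (t := midFaces T d₀ d₁)
    (Finset.filter_subset _ _)
  omega

theorem cornerDarts_subset : cornerDarts T F ⊆ chargeDarts T F := by
  rintro ⟨p, q⟩ h
  simp only [cornerDarts, Finset.mem_filter, Finset.mem_univ, true_and] at h
  rw [chargeDarts, Finset.mem_union, Finset.mem_filter]
  right
  rcases h with ⟨y, a, -, -⟩ | ⟨x, a, -, -⟩
  · exact ⟨a.1, iff_of_false a.2.1 a.2.2.1⟩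
  · exact ⟨keptDarts_swap.1 a.1, iff_of_false a.2.2.1 a.2.1⟩

/-- The vertices in charge of two edges. -/
noncomputable def doubles (T : SimpleGraph S) (F : Finset (Sym2 S)) : Finset S :=
  Finset.univ.filter fun u => (Finset.univ.filter fun v => InCharge T F u v).card = 2

/-- Each vertex in charge of two edges contributes the two sides of their angle, directed with the
angle on the left. All these are distinct because an edge has at most one end in charge. -/
theorem card_cornerDarts (hS : InGeneralPosition S) :
    2 * (doubles T F).card ≤ (cornerDarts T F).card := by
  have hex : ∀ u : S, ∃ x y : S, u ∈ doubles T F →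
      InCharge T F u x ∧ InCharge T F u y ∧ 0 < ori u x y := by
    intro u
    by_cases hu : u ∈ doubles T F
    · simp only [doubles, Finset.mem_filter, Finset.mem_univ, true_and] at hu
      obtain ⟨x, y, hxy, he⟩ := Finset.card_eq_two.1 hu
      have hx : InCharge T F u x := by
        have : x ∈ Finset.univ.filter fun v => InCharge T F u v := by rw [he]; simp
        simpa using this
      have hy : InCharge T F u y := by
        have : y ∈ Finset.univ.filter fun v => InCharge T F u v := by rw [he]; simp
        simpa using this
      rcases lt_or_gt_of_ne (ori_ne_zero hS (keptDarts_adj hx.1).ne (keptDarts_adj hy.1).ne hxy) with h | h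
      · exact ⟨y, x, fun _ => ⟨hy, hx, by rw [ori_swap_right]; linarith⟩⟩
      · exact ⟨x, y, fun _ => ⟨hx, hy, h⟩⟩
    · exact ⟨u, u, fun h => absurd h hu⟩
  choose x y hxy using hex
  have h1 : ((doubles T F).image fun u => (u, x u)).card = (doubles T F).card :=
    Finset.card_image_of_injective _ fun a b h => (Prod.mk.inj h).1
  have h2 : ((doubles T F).image fun u => (y u, u)).card = (doubles T F).card :=
    Finset.card_image_of_injective _ fun a b h => (Prod.mk.inj h).2
  have hdis : Disjoint ((doubles T F).image fun u => (u, x u)) ((doubles T F).image fun u => (y u, u)) := by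
    rw [Finset.disjoint_left]
    intro e he he'
    obtain ⟨a, ha, rfl⟩ := Finset.mem_image.1 he
    obtain ⟨b, hb, h⟩ := Finset.mem_image.1 he'
    simp only [Prod.mk.injEq] at h
    have ka := (hxy a ha).1
    have kb := (hxy b hb).2.1
    rw [h.1] at kb
    rw [← h.2] at ka
    exact ka.asymm kb
  rw [two_mul]
  nth_rewrite 1 [← h1]
  rw [← h2, ← Finset.card_union_of_disjoint hdis]
  refine Finset.card_le_card (Finset.union_subset ?_ ?_)
  · intro e he
    obtain ⟨a, ha, rfl⟩ := Finset.mem_image.1 he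
    obtain ⟨k1, k2, k3⟩ := hxy a ha
    exact Finset.mem_filter.2 ⟨Finset.mem_univ _, Or.inl ⟨y a, k1, k2, k3⟩⟩
  · intro e he
    obtain ⟨a, ha, rfl⟩ := Finset.mem_image.1 he
    obtain ⟨k1, k2, k3⟩ := hxy a ha
    exact Finset.mem_filter.2 ⟨Finset.mem_univ _, Or.inr ⟨x a, k2, k1, k3⟩⟩

theorem card_fiber_sum (R : S → S → Prop) : (Finset.univ.filter fun e : S × S => R e.1 e.2).card =
    ∑ u : S, (Finset.univ.filter fun v => R u v).card := by
  rw [Finset.card_filter, Fintype.sum_prod_type]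
  simp only [Finset.card_filter]

theorem card_swap (R : S → S → Prop) : (Finset.univ.filter fun e : S × S => R e.1 e.2).card =
    (Finset.univ.filter fun e : S × S => R e.2 e.1).card :=
  Finset.card_bij (fun e _ => (e.2, e.1)) (by simp)
    (by rintro ⟨a, b⟩ _ ⟨c, d⟩ _ h; simp at h ⊢; tauto)
    (by rintro ⟨a, b⟩ h; exact ⟨(b, a), by simpa using h, rfl⟩)

/-- The directed kept interior edges between vertices that are not cubic. -/
noncomputable def looseDarts (T : SimpleGraph S) (F : Finset (Sym2 S)) : Finset (S × S) :=
  (keptDarts T F).filter fun e => ¬ IsCubic T F e.1 ∧ ¬ IsCubic T F e.2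

/-- By maximality each loose edge has exactly one end in charge. An inner vertex that is not cubic
is in charge of at most one edge, or of two if it is in `doubles`; other vertices are in charge of
none. -/
theorem card_looseDarts (hS : InGeneralPosition S) (hc : 2 ≤ S.card) (hF : KeepsSurrounded T F)
    (hmax : ∀ u v : S, s(u, v) ∈ interiorEdges T → s(u, v) ∉ F →
        Needs (T.deleteEdges F) u v ∨ Needs (T.deleteEdges F) v u) :
    (looseDarts T F).card + 2 * (Finset.univ.filter fun u => IsCubic T F u).card ≤
      2 * (innerPoints S).card + 2 * (doubles T F).card ∧
    (doubles T F).card + (Finset.univ.filter fun u => IsCubic T F u).card ≤ (innerPoints S).card := by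
  have h1 : (looseDarts T F) = (Finset.univ.filter fun e : S × S => InCharge T F e.1 e.2) ∪
      (Finset.univ.filter fun e : S × S => InCharge T F e.2 e.1) := by
    ext ⟨u, v⟩
    simp only [looseDarts, Finset.mem_filter, Finset.mem_union, Finset.mem_univ, true_and]
    constructor
    · rintro ⟨h, hu, hv⟩
      have hk := mem_keptDarts.1 h
      have := hmax u v ((mem_innerDarts_iff hS hc).1 hk.1) hk.2
      have hne : u ≠ v := (keptDarts_adj h).ne
      have hlt : Fintype.equivFin S u < Fintype.equivFin S v ∨
          Fintype.equivFin S v < Fintype.equivFin S u :=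
        lt_or_gt_of_ne (fun h => hne ((Fintype.equivFin S).injective h))
      have h' := keptDarts_swap.1 h
      unfold InCharge
      tauto
    · rintro (h | h)
      · exact ⟨h.1, h.2.1, h.2.2.1⟩
      · exact ⟨keptDarts_swap.1 h.1, h.2.2.1, h.2.1⟩
  have h2 : Disjoint (Finset.univ.filter fun e : S × S => InCharge T F e.1 e.2)
      (Finset.univ.filter fun e : S × S => InCharge T F e.2 e.1) := by
    rw [Finset.disjoint_left]
    rintro ⟨u, v⟩ h h'
    simp only [Finset.mem_filter, Finset.mem_univ, true_and] at h h'
    exact h.asymm h'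
  have h3 : (looseDarts T F).card = 2 * (Finset.univ.filter fun e : S × S => InCharge T F e.1 e.2).card := by
    rw [h1, Finset.card_union_of_disjoint h2, ← card_swap (InCharge T F)]
    ring
  have hinner : ∀ u v, InCharge T F u v → IsInner u ∧ ¬ IsCubic T F u := fun u v h =>
    ⟨h.2.2.2.1.1, h.2.1⟩
  have hpt : ∀ u : S, (Finset.univ.filter fun v => InCharge T F u v).card +
      (if IsCubic T F u then 1 else 0) ≤ (if IsInner u then 1 else 0) + (if u ∈ doubles T F then 1 else 0) ∧
      (if u ∈ doubles T F then 1 else 0) + (if IsCubic T F u then 1 else 0) ≤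
        (if IsInner u then 1 else 0) := by
    intro u
    by_cases hu : IsInner u ∧ ¬ IsCubic T F u
    · have hle : (Finset.univ.filter fun v => InCharge T F u v).card ≤ 2 := by
        refine le_trans (Finset.card_le_card ?_) (card_needs_le_two hS (hF.2 u hu.1)
          (fun h => hu.2 ⟨hu.1, h⟩))
        intro v hv
        simp only [Finset.mem_filter, Finset.mem_univ, true_and] at hv ⊢
        exact hv.2.2.2.1
      rw [if_neg hu.2, if_pos hu.1]
      by_cases hd : u ∈ doubles T F
      · rw [if_pos hd]; omega
      · rw [if_neg hd]
        have : (Finset.univ.filter fun v => InCharge T F u v).card ≠ 2 := by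
          intro h; exact hd (Finset.mem_filter.2 ⟨Finset.mem_univ _, h⟩)
        omega
    · have h0 : (Finset.univ.filter fun v => InCharge T F u v) = ∅ := by
        rw [Finset.filter_eq_empty_iff]
        intro v _ h
        exact hu (hinner u v h)
      have hd : u ∉ doubles T F := by
        simp only [doubles, Finset.mem_filter, Finset.mem_univ, true_and, h0]
        simp
      rw [h0, if_neg hd]
      by_cases hcub : IsCubic T F u
      · simp [hcub, hcub.1]
      · simp [hcub]
  have hI : (innerPoints S).card = ∑ u : S, if IsInner u then 1 else 0 := by
    rw [innerPoints, Finset.card_filter]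
  have hD : (doubles T F).card = ∑ u : S, if u ∈ doubles T F then 1 else 0 := by
    rw [← Finset.card_filter]; congr 1; ext; simp
  have hC : (Finset.univ.filter fun u => IsCubic T F u).card = ∑ u : S, if IsCubic T F u then 1 else 0 :=
    Finset.card_filter _ _
  rw [h3, card_fiber_sum (InCharge T F), hI, hC, hD]
  constructor
  · have := Finset.sum_le_sum fun u (_ : u ∈ Finset.univ) => (hpt u).1
    rw [Finset.sum_add_distrib, Finset.sum_add_distrib] at this
    omega
  · have := Finset.sum_le_sum fun u (_ : u ∈ Finset.univ) => (hpt u).2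
    rw [Finset.sum_add_distrib] at this
    exact this

/-- `m` counts the directed kept edges from cubic to non-cubic vertices and `q` those between cubic
ones. Cubic vertices are inner, so all their three kept edges are interior and are counted in `m +
q`. -/
theorem card_keptDarts :
    ∃ m q : ℕ, (keptDarts T F).card = 2 * m + q + (looseDarts T F).card ∧
      3 * (Finset.univ.filter fun u => IsCubic T F u).card = m + q ∧
      (chargeDarts T F).card ≤ (hullDarts T).card + q + (looseDarts T F).card := by
  let K := keptDarts T F
  refine ⟨(K.filter fun e => IsCubic T F e.1 ∧ ¬ IsCubic T F e.2).card,
    (K.filter fun e => IsCubic T F e.1 ∧ IsCubic T F e.2).card, ?_, ?_, ?_⟩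
  · have hsw : (K.filter fun e => IsCubic T F e.1 ∧ ¬ IsCubic T F e.2).card =
        (K.filter fun e => ¬ IsCubic T F e.1 ∧ IsCubic T F e.2).card := by
      refine Finset.card_bij (fun e _ => (e.2, e.1)) ?_ ?_ ?_
      · rintro ⟨a, b⟩ h
        simp only [Finset.mem_filter] at h ⊢
        exact ⟨keptDarts_swap.1 h.1, h.2.2, h.2.1⟩
      · rintro ⟨a, b⟩ _ ⟨c, d⟩ _ h
        simp only [Prod.mk.injEq] at h ⊢
        tauto
      · rintro ⟨a, b⟩ h
        simp only [Finset.mem_filter] at h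
        exact ⟨(b, a), Finset.mem_filter.2 ⟨keptDarts_swap.1 h.1, h.2.2, h.2.1⟩, rfl⟩
    have e1 := Finset.card_filter_add_card_filter_not (s := K) (fun e => IsCubic T F e.1)
    have e2 := Finset.card_filter_add_card_filter_not (s := K.filter fun e => IsCubic T F e.1)
      (fun e => IsCubic T F e.2)
    have e3 := Finset.card_filter_add_card_filter_not (s := K.filter fun e => ¬ IsCubic T F e.1)
      (fun e => IsCubic T F e.2)
    simp only [Finset.filter_filter] at e2 e3
    have e4 : (looseDarts T F).card = (K.filter fun e => ¬ IsCubic T F e.1 ∧ ¬ IsCubic T F e.2).card := rfl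
    change K.card = _
    omega
  · have e2 := Finset.card_filter_add_card_filter_not (s := K.filter fun e => IsCubic T F e.1)
      (fun e => IsCubic T F e.2)
    simp only [Finset.filter_filter] at e2
    rw [add_comm, e2]
    have : (K.filter fun e => IsCubic T F e.1) =
        Finset.univ.filter fun e : S × S => IsCubic T F e.1 ∧ (T.deleteEdges F).Adj e.1 e.2 := by
      ext ⟨u, v⟩
      simp only [Finset.mem_filter, Finset.mem_univ, true_and]
      constructor
      · rintro ⟨h, hu⟩
        exact ⟨hu, keptDarts_adj h⟩
      · rintro ⟨hu, h⟩
        rw [SimpleGraph.deleteEdges_adj] at h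
        exact ⟨mem_keptDarts.2 ⟨adj_innerDarts hu.1 h.1, h.2⟩, hu⟩
    have e := card_fiber_sum (fun u v => IsCubic T F u ∧ (T.deleteEdges F).Adj u v)
    have e' : (Finset.univ.filter fun e : S × S => IsCubic T F e.1 ∧ (T.deleteEdges F).Adj e.1 e.2).card =
        ∑ u : S, (Finset.univ.filter fun v => IsCubic T F u ∧ (T.deleteEdges F).Adj u v).card := by
      convert e
    rw [this, e', Finset.card_filter, Finset.mul_sum]
    refine Finset.sum_congr rfl fun u _ => ?_
    by_cases hu : IsCubic T F u
    · simp only [hu, true_and, if_true]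
      rw [hu.2, mul_one]
    · simp [hu]
  · rw [chargeDarts]
    refine (Finset.card_union_le _ _).trans ?_
    have : (keptDarts T F).filter (fun e => IsCubic T F e.1 ↔ IsCubic T F e.2) =
        (K.filter fun e => IsCubic T F e.1 ∧ IsCubic T F e.2) ∪ looseDarts T F := by
      ext ⟨u, v⟩
      simp only [looseDarts, K, Finset.mem_filter, Finset.mem_union]
      tauto
    rw [this]
    have := Finset.card_union_le (K.filter fun e => IsCubic T F e.1 ∧ IsCubic T F e.2) (looseDarts T F)
    omega

theorem card_keptDarts_add (hS : InGeneralPosition S) (hc : 2 ≤ S.card)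
    (hF : (F : Set (Sym2 S)) ⊆ interiorEdges T) :
    (keptDarts T F).card + 2 * F.card = (innerDarts T).card := by
  have h1 := card_dartsOf (T := T) (F := F) (fun e he => (hF he).1)
  have h2 := Finset.card_filter_add_card_filter_not (s := innerDarts T) (fun e => s(e.1, e.2) ∈ F)
  have h3 : (innerDarts T).filter (fun e => s(e.1, e.2) ∈ F) = dartsOf F := by
    ext ⟨u, v⟩
    simp only [dartsOf, Finset.mem_filter, Finset.mem_univ, true_and, and_iff_right_iff_imp]
    exact fun h => (mem_innerDarts_iff hS hc).2 (hF h)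
  rw [h3, h1] at h2
  have h4 : keptDarts T F = (innerDarts T).filter fun e => ¬ s(e.1, e.2) ∈ F := rfl
  rw [h4]
  omega

/-- Every triangulation has a large set of edges whose deletion keeps all inner points surrounded. -/
theorem exists_large_keepsSurrounded (hS : InGeneralPosition S) (hc : 3 ≤ S.card)
    (hT : IsTriangulation T) : ∃ F : Finset (Sym2 S), KeepsSurrounded T F ∧
      S.card ≤ 2 * F.card + 4 ∧ (hullVertices S).card ≤ F.card + 3 := by
  obtain ⟨F, hF, hmax⟩ := exists_maximal_keepsSurrounded hS hT
  refine ⟨F, hF, ?_⟩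
  obtain ⟨d₀, d₁, hd⟩ := exists_genericDir S
  have k1 := card_midFaces hS (by omega) hT hd
  have k2 := card_midFaces_le (F := F) hS hT d₀ d₁
  have k3 := card_survivors_le hS hc hT hF d₀ d₁
  have k4 := Finset.card_sdiff_add_card_eq_card (cornerDarts_subset (T := T) (F := F))
  have k5 := card_cornerDarts (T := T) (F := F) hS
  obtain ⟨k6, k6'⟩ := card_looseDarts hS (by omega) hF hmax
  obtain ⟨m, q, k7, k8, k9⟩ := card_keptDarts (T := T) (F := F)
  have k10 := card_keptDarts_add hS (by omega) hF.1
  have k11 := card_innerDarts hS hc hT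
  have k12 := card_hullDarts hS (by omega) hT
  have k13 := card_hullVertices hS (by omega)
  have k14 := card_dartsOf (T := T) (F := F) (fun e he => (hF.1 he).1)
  -- Let `i`, `c`, `d`, `L` count inner points, cubic points, doubles and loose darts. Counting kept
  -- edges gives `2 |F| = 6 i + 2 h - 6 - 6 c + q - L`, and counting faces gives `2 i - 2 ≤ 2 |F| +
  -- q + L - 2 d`. Adding the two and using `L ≤ 2 (i + d - c)` and `c + d ≤ i` yields `4 |F| ≥ 2 N
  -- - 8`. The first count alone, with `q ≥ 0`, yields `|F| ≥ h - 3`.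
  omega

end

/-! ### The lower bound, and points in convex position -/

section
open Classical
variable {S : Finset Plane} {T : SimpleGraph S} {F : Finset (Sym2 S)}

/-- Every triangulation has a ps-flippable set of at least `max (N / 2 - 2) (h - 3)` edges. -/
theorem exists_large_isPsFlippable (hS : InGeneralPosition S) (hc : 2 ≤ S.card)
    (hT : IsTriangulation T) : ∃ F : Finset (Sym2 S), IsPsFlippable T F ∧
      psBound S ≤ (F.card : ℝ) := by
  rcases hc.lt_or_eq with h3 | h2
  · obtain ⟨F, hF, h1, h2⟩ := exists_large_keepsSurrounded hS h3 hT
    refine ⟨F, isPsFlippable_of_surrounded hS hc hT hF.1 hF.2, ?_⟩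
    have h1' : (S.card : ℝ) ≤ 2 * F.card + 4 := by exact_mod_cast h1
    have h2' : ((hullVertices S).card : ℝ) ≤ F.card + 3 := by exact_mod_cast h2
    exact max_le (by linarith) (by linarith)
  -- For two points the bound is negative, so the empty set suffices.
  · refine ⟨∅, isPsFlippable_of_surrounded hS hc hT (by simp) fun v hv => ?_, ?_⟩
    · simpa using IsInner.surrounded hS hT hv
    · have h := card_hullVertices hS hc
      have h' : ((hullVertices S).card : ℝ) ≤ 2 := by
        exact_mod_cast (show (hullVertices S).card ≤ 2 by omega)
      rw [psBound, ← h2]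
      exact max_le (by norm_num) (by norm_num; linarith)

theorem isCrossingFree_bot : IsCrossingFree (⊥ : SimpleGraph S) := by
  constructor <;> simp

theorem exists_isTriangulation {G : SimpleGraph S} (hG : IsCrossingFree G) :
    ∃ T : SimpleGraph S, G ≤ T ∧ IsTriangulation T :=
  (Set.toFinite {G : SimpleGraph S | IsCrossingFree G}).exists_le_maximal hG

theorem InConvexPosition.not_inner (hC : InConvexPosition S) (v : S) : ¬ IsInner v := by
  intro hv
  have h1 := (convexIndependent_iff_notMem_convexHull_sdiff.1 hC) v Set.univ
  have hcl : IsClosed (convexHull ℝ ((fun p : S => (p : Plane)) '' (Set.univ \ {v}))) :=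
    ((Set.toFinite _).isCompact_convexHull (𝕜 := ℝ)).isClosed
  obtain ⟨f, u, hf, hu⟩ := geometric_hahn_banach_closed_point (convex_convexHull ℝ _) hcl h1
  have key : ∀ s : S, s ≠ v → f s < f v := fun s hs =>
    (hf s (subset_convexHull ℝ _ ⟨s, ⟨trivial, hs⟩, rfl⟩)).trans hu
  have hf0 : f ≠ 0 := by
    rintro rfl
    obtain ⟨s, hs⟩ := hv 1 0 (by simp)
    have hsv : s ≠ v := by rintro rfl; simp at hs
    simpa using key s hsv
  obtain ⟨d₀, d₁, hne, hd⟩ := strongDual_eq_dev f hf0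
  obtain ⟨s, hs⟩ := hv d₀ d₁ hne
  have hsv : s ≠ v := by rintro rfl; simp at hs
  rw [← hd] at hs
  linarith [key s hsv]

theorem card_innerPoints_eq_zero (h : ∀ v : S, ¬ IsInner v) : (innerPoints S).card = 0 := by
  rw [Finset.card_eq_zero, innerPoints, Finset.filter_eq_empty_iff]
  exact fun v _ => h v

/-- In a triangulation of points in convex position all interior edges can be flipped at once. -/
theorem isGreatest_psFlippableSizes_of_convex (hS : InGeneralPosition S) (hC : InConvexPosition S)
    (hc : 3 ≤ S.card) (hT : IsTriangulation T) :
    psBound S = ((hullVertices S).card : ℝ) - 3 ∧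
    IsGreatest (psFlippableSizes T) (((hullVertices S).card : ℝ) - 3) ∧
    ∃ F : Finset (Sym2 S), (F : Set (Sym2 S)) = interiorEdges T ∧ IsPsFlippable T F ∧
      (F.card : ℝ) = ((hullVertices S).card : ℝ) - 3 := by
  have h0 := card_innerPoints_eq_zero hC.not_inner
  have h1 := card_hullVertices hS (by omega)
  set E : Finset (Sym2 S) := (Set.toFinite (interiorEdges T)).toFinset with hE
  have hEc : (E : Set (Sym2 S)) = interiorEdges T := by simp [hE]
  have h2 := card_interiorEdges hS hc hT hEc
  have h3 : (hullVertices S).card = E.card + 3 := by omega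
  have h3' : (E.card : ℝ) = ((hullVertices S).card : ℝ) - 3 := by rw [h3]; push_cast; ring
  -- Without inner points the condition on surrounded points is vacuous.
  have hflip : IsPsFlippable T E := isPsFlippable_of_surrounded hS (by omega) hT hEc.le
    fun v hv => absurd hv (hC.not_inner v)
  refine ⟨?_, ⟨⟨E, hflip, h3'.symm⟩, ?_⟩, E, hEc, hflip, h3'⟩
  · have h4 : ((hullVertices S).card : ℝ) = S.card := by exact_mod_cast (by omega)
    have h5 : (3 : ℝ) ≤ S.card := by exact_mod_cast hc
    rw [psBound, max_eq_right]
    rw [h4]; linarith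
  · rintro r ⟨F, hF, rfl⟩
    rw [← h3']
    exact_mod_cast Finset.card_le_card (Finset.coe_subset.1 (hF.1.trans hEc.ge))

/-- The point of the parabola with abscissa `x`, scaled by `r`. -/
noncomputable def parab (r x : ℝ) : Plane := !₂[r * x, r * x ^ 2]

@[simp] theorem parab_zero (r x : ℝ) : parab r x 0 = r * x := rfl

@[simp] theorem parab_one (r x : ℝ) : parab r x 1 = r * x ^ 2 := rfl

theorem ori_parab (r x y z : ℝ) :
    ori (parab r x) (parab r y) (parab r z) = r ^ 2 * ((y - x) * (z - x) * (z - y)) := by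
  simp only [ori, parab_zero, parab_one]; ring

theorem ori_eq_zero_of_collinear {a b c : Plane} (h : Collinear ℝ ({a, b, c} : Set Plane)) :
    ori a b c = 0 := by
  obtain ⟨d, hd⟩ := (collinear_iff_of_mem (p₀ := a) (by simp)).1 h
  obtain ⟨t, rfl⟩ := hd b (by simp)
  obtain ⟨s, rfl⟩ := hd c (by simp)
  simp [ori]; ring

theorem parab_injective {r : ℝ} (hr : r ≠ 0) {x y : ℝ} (h : parab r x = parab r y) : x = y := by
  have := congrArg (fun p : Plane => p 0) h
  simpa [hr] using this

/-- There are sets of any size in general and convex position. -/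
theorem exists_convexPosition (N : ℕ) :
    ∃ S : Finset Plane, InGeneralPosition S ∧ InConvexPosition S ∧ S.card = N := by
  refine ⟨(Finset.range N).image fun i : ℕ => parab 1 i, ?_, ?_, ?_⟩
  · intro a ha b hb c hcc hab hac hbc hcol
    obtain ⟨i, -, rfl⟩ := Finset.mem_image.1 ha
    obtain ⟨j, -, rfl⟩ := Finset.mem_image.1 hb
    obtain ⟨k, -, rfl⟩ := Finset.mem_image.1 hcc
    have h := ori_eq_zero_of_collinear hcol
    rw [ori_parab] at h
    simp only [one_pow, one_mul, mul_eq_zero, sub_eq_zero] at h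
    rcases h with (h | h) | h
    · exact hab (by rw [h])
    · exact hac (by rw [h])
    · exact hbc (by rw [h])
  · refine convexIndependent_iff_notMem_convexHull_sdiff.2 fun v s hv => ?_
    obtain ⟨i, -, hi⟩ := Finset.mem_image.1 v.2
    -- The half-plane is the open side above the tangent at abscissa `i`, which contains all other
    -- points of the parabola.
    have hsub : (Subtype.val '' (s \ {v}) : Set Plane) ⊆ {z : Plane | 2 * i * z 0 - z 1 < (i : ℝ) ^ 2} := by
      rintro _ ⟨w, ⟨-, hw⟩, rfl⟩
      obtain ⟨j, -, hj⟩ := Finset.mem_image.1 w.2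
      simp only [Set.mem_ofPred_eq, ← hj, parab_zero, parab_one]
      have : (i : ℝ) ≠ j := by
        intro h
        refine hw (Subtype.ext ?_)
        rw [← hj, ← hi, h]
      nlinarith [sq_pos_of_ne_zero (sub_ne_zero.2 this)]
    have hconv : Convex ℝ {z : Plane | 2 * i * z 0 - z 1 < (i : ℝ) ^ 2} := by
      intro x hx y hy a b ha hb hab
      simp only [Set.mem_ofPred_eq, PiLp.add_apply, PiLp.smul_apply, smul_eq_mul] at hx hy ⊢
      obtain rfl : b = 1 - a := by linarith
      rcases ha.eq_or_lt with rfl | ha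
      · linarith
      · nlinarith
    have := convexHull_min hsub hconv hv
    simp only [Set.mem_ofPred_eq, ← hi, parab_zero, parab_one] at this
    nlinarith
  · rw [Finset.card_image_of_injective, Finset.card_range]
    intro i j h
    exact_mod_cast parab_injective one_ne_zero h

end

/-! ### Ps-flippable sets leave inner points surrounded -/

section
open Classical
variable {S : Finset Plane} {T : SimpleGraph S} {F : Finset (Sym2 S)}

/-- If the neighbours of `v` lie on one side of a line through `v`, the drawing covers nothing near
`v` on the other side. -/
theorem exists_ball_of_dev_neg (hS : InGeneralPosition S) {G : SimpleGraph S} {v : S} {d₀ d₁ : ℝ}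
    (h : ∀ w : S, G.Adj v w → dev d₀ d₁ v w < 0) :
    ∃ ε > 0, ∀ z ∈ Metric.ball (v : Plane) ε, z ≠ v → 0 ≤ dev d₀ d₁ v z → z ∉ drawing G := by
  -- The edges that do not end at `v` form a closed set, and by general position it misses `v`.
  let D : Set Plane := ⋃ e ∈ {e : S × S | e.1 ≠ v ∧ e.2 ≠ v ∧ G.Adj e.1 e.2},
    segment ℝ (e.1 : Plane) e.2
  have hD : IsClosed D := by
    refine Set.Finite.isClosed_biUnion (Set.toFinite _) fun e _ => ?_
    rw [← convexHull_pair]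
    exact ((Set.toFinite _).isCompact_convexHull (𝕜 := ℝ)).isClosed
  have hvD : (v : Plane) ∈ Dᶜ := by
    intro hv
    obtain ⟨e, ⟨h1, h2, h3⟩, hz⟩ := Set.mem_iUnion₂.1 hv
    rw [← insert_endpoints_openSegment] at hz
    rcases hz with hz | hz | hz
    · exact h1 (Subtype.ext hz.symm)
    · exact h2 (Subtype.ext hz.symm)
    · exact notMem_openSegment hS h3.ne v hz
  obtain ⟨ε, ε0, hε⟩ := Metric.isOpen_iff.1 hD.isOpen_compl v hvD
  refine ⟨ε, ε0, fun z hz hzv hdev hzG => ?_⟩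
  have key : ∀ w : S, G.Adj v w → z ∉ segment ℝ (v : Plane) w := by
    intro w hw hzw
    obtain ⟨s, t, hs, ht, hst, h0, h1⟩ := mem_segment_iff'.1 hzw
    rw [dev_combo hst h0 h1, dev_self] at hdev
    have ht0 : t = 0 := by
      by_contra hne
      have := mul_neg_of_pos_of_neg (lt_of_le_of_ne ht (Ne.symm hne)) (h w hw)
      linarith
    subst ht0
    obtain rfl : s = 1 := by linarith
    exact hzv (plane_ext (by linarith) (by linarith))
  obtain ⟨a, b, hab, hzab⟩ := exists_of_mem_drawing hzG
  by_cases ha : a = v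
  · subst ha
    exact key b hab hzab
  by_cases hb : b = v
  · subst hb
    rw [segment_symm] at hzab
    exact key a hab.symm hzab
  exact hε hz (Set.mem_iUnion₂.2 ⟨(a, b), ⟨ha, hb, hab⟩, hzab⟩)

theorem segment_subset_halfBall {v x m : Plane} {d₀ d₁ ε : ℝ} (hx : x ∈ Metric.ball v ε)
    (hm : m ∈ Metric.ball v ε) (hxv : x ≠ v) (hx0 : dev d₀ d₁ v x = 0) (hm0 : 0 < dev d₀ d₁ v m) :
    segment ℝ x m ⊆ {z | z ∈ Metric.ball v ε ∧ z ≠ v ∧ 0 ≤ dev d₀ d₁ v z} := by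
  intro z hz
  refine ⟨(convex_ball v ε).segment_subset hx hm hz, ?_, ?_⟩
  · rintro rfl
    obtain ⟨s, t, hs, ht, hst, h0, h1⟩ := mem_segment_iff'.1 hz
    have e := dev_combo hst h0 h1 d₀ d₁ z
    rw [dev_self, hx0] at e
    have ht0 : t = 0 := by
      rcases mul_eq_zero.1 (show t * dev d₀ d₁ z m = 0 by linarith) with h | h
      · exact h
      · exact absurd h hm0.ne'
    subst ht0
    obtain rfl : s = 1 := by linarith
    exact hxv (plane_ext (by linarith) (by linarith))
  · obtain ⟨s, t, hs, ht, hst, h0, h1⟩ := mem_segment_iff'.1 hz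
    rw [dev_combo hst h0 h1, hx0]
    have := mul_nonneg ht hm0.le
    linarith

/-- Inner points remain surrounded after the deletion of a ps-flippable set. -/
theorem IsPsFlippable.surrounded (hS : InGeneralPosition S) (hc : 2 ≤ S.card)
    (hT : IsTriangulation T) (hF : IsPsFlippable T F) {v : S} (hv : IsInner v) :
    Surrounded (T.deleteEdges F) v := by
  set G := T.deleteEdges (F : Set (Sym2 S)) with hG
  by_contra hcon
  unfold Surrounded at hcon
  push Not at hcon
  obtain ⟨e₀, e₁, hne, hle⟩ := hcon
  -- After a turn all remaining neighbours of `v` are strictly on one side, so a small half-disc on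
  -- the other side, its diameter included, is undrawn except for `v`.
  obtain ⟨d₀, d₁, hd⟩ := exists_dev_neg hS hne hle
  replace hd : ∀ w : S, G.Adj v w → dev d₀ d₁ v w < 0 := fun w hw => hd w hw hw.ne.symm
  -- The degree condition is essential: an isolated `v` would not be drawn and would not obstruct
  -- convexity.
  obtain ⟨w, hw⟩ := hF.2.2 v
  have hvD : (v : Plane) ∈ drawing G := segment_subset_drawing hw (left_mem_segment ℝ _ _)
  have hD : 0 < d₀ ^ 2 + d₁ ^ 2 := by
    have := hd w hw
    by_contra h
    have h0 : d₀ = 0 := by nlinarith [sq_nonneg d₀, sq_nonneg d₁]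
    have h1 : d₁ = 0 := by nlinarith [sq_nonneg d₀, sq_nonneg d₁]
    simp [dev, h0, h1] at this
  obtain ⟨ε, ε0, hε⟩ := exists_ball_of_dev_neg hS hd
  have hcont : ∀ a b : ℝ, ∀ U ∈ nhds (v : Plane), ∀ᶠ δ : ℝ in nhdsWithin 0 (Set.Ioi 0),
      (v : Plane) + δ • !₂[a, b] ∈ U := by
    intro a b U hU
    have : Continuous fun δ : ℝ => (v : Plane) + δ • (!₂[a, b] : Plane) := by fun_prop
    have h2 := this.tendsto 0
    simp only [zero_smul, add_zero] at h2
    exact (h2.mono_left nhdsWithin_le_nhds) hU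
  have hUb : Metric.ball (v : Plane) ε ∈ nhds (v : Plane) := Metric.ball_mem_nhds _ ε0
  have hUi : interior (convexHull ℝ (S : Set Plane)) ∈ nhds (v : Plane) :=
    isOpen_interior.mem_nhds (hv.mem_interior hS hc)
  obtain ⟨δ, ⟨⟨⟨hx, hy⟩, hm⟩, hxi⟩, δ0⟩ := ((((hcont d₀ d₁ _ hUb).and (hcont (-d₀) (-d₁) _ hUb)).and
    (hcont d₁ (-d₀) _ hUb)).and (hcont d₀ d₁ _ hUi)).and self_mem_nhdsWithin |>.exists
  -- `x` and `y` are opposite each other at `v`, and the path through `m` on the empty side puts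
  -- them in one face. Convexity would put their midpoint `v` in it.
  set x : Plane := (v : Plane) + δ • !₂[d₀, d₁] with hxdef
  set y : Plane := (v : Plane) + δ • !₂[-d₀, -d₁] with hydef
  set m : Plane := (v : Plane) + δ • !₂[d₁, -d₀] with hmdef
  have hx0 : dev d₀ d₁ v x = 0 := by simp [dev, hxdef]; ring
  have hy0 : dev d₀ d₁ v y = 0 := by simp [dev, hydef]; ring
  have hm0 : 0 < dev d₀ d₁ v m := by
    have : dev d₀ d₁ v m = δ * (d₀ ^ 2 + d₁ ^ 2) := by simp [dev, hmdef]; ring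
    rw [this]; positivity
  have hxv : x ≠ v := by
    intro h
    have h0 := congrArg (fun p : Plane => p 0) h
    have h1 := congrArg (fun p : Plane => p 1) h
    simp [hxdef, δ0.ne'] at h0 h1
    simp [h0, h1] at hD
  have hyv : y ≠ v := by
    intro h
    have h0 := congrArg (fun p : Plane => p 0) h
    have h1 := congrArg (fun p : Plane => p 1) h
    simp [hydef, δ0.ne'] at h0 h1
    simp [h0, h1] at hD
  have hsx : segment ℝ x m ⊆ (drawing G)ᶜ := fun z hz =>
    let h := segment_subset_halfBall hx hm hxv hx0 hm0 hz
    hε z h.1 h.2.1 h.2.2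
  have hsy : segment ℝ y m ⊆ (drawing G)ᶜ := fun z hz =>
    let h := segment_subset_halfBall hy hm hyv hy0 hm0 hz
    hε z h.1 h.2.1 h.2.2
  have hxD : x ∈ (drawing G)ᶜ := hsx (left_mem_segment ℝ _ _)
  have hface : IsFace G (connectedComponentIn (drawing G)ᶜ x) := ⟨x, hxD, rfl⟩
  set A := connectedComponentIn (drawing G)ᶜ x with hA
  have hAD : A ⊆ (drawing G)ᶜ := connectedComponentIn_subset _ _
  have hxA : x ∈ A := mem_connectedComponentIn hxD
  have hyA : y ∈ A := by
    have hpre : IsPreconnected (segment ℝ x m ∪ segment ℝ y m) :=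
      (convex_segment x m).isPreconnected.union m (right_mem_segment ℝ _ _) (right_mem_segment ℝ _ _)
        (convex_segment y m).isPreconnected
    exact hpre.subset_connectedComponentIn (Or.inl (left_mem_segment ℝ _ _))
      (Set.union_subset hsx hsy) (Or.inr (left_mem_segment ℝ _ _))
  -- The face contains an interior point of the hull and cannot pass the hull boundary, which is
  -- drawn; hence it is bounded.
  have hAi : A ⊆ interior (convexHull ℝ (S : Set Plane)) := by
    refine isPreconnected_connectedComponentIn.subset_of_closure_inter_subset isOpen_interior
      ⟨x, hxA, hxi⟩ ?_
    rintro z ⟨hz, hzA⟩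
    by_contra hzi
    refine hAD hzA (hullBoundary_subset_drawing hS hc hT hF.1 ?_)
    rw [hullBoundary_eq]
    exact ⟨closure_minimal interior_subset isClosed_hull hz, hzi⟩
  have hAb : Bornology.IsBounded A :=
    ((S.finite_toSet.isCompact_convexHull (𝕜 := ℝ)).isBounded).subset (hAi.trans interior_subset)
  have hconv := hF.2.1 A hface hAb
  refine hAD ?_ hvD
  have : (v : Plane) = (1 / 2 : ℝ) • x + (1 / 2 : ℝ) • y := by
    apply plane_ext <;> simp [hxdef, hydef] <;> ring
  rw [this]
  exact hconv hxA hyA (by norm_num) (by norm_num) (by norm_num)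

/-- With no neighbours besides `x` and `y`, one of the open half-planes bounded by the line `v x`
contains no neighbour. -/
theorem Surrounded.three_le {G : SimpleGraph S} {v : S} (h : Surrounded G v) :
    3 ≤ (Finset.univ.filter fun w => G.Adj v w).card := by
  by_contra hcon
  obtain ⟨x, hx, -⟩ := h 1 0 (by simp)
  have hpair : ∃ y : S, ∀ w : S, G.Adj v w → w = x ∨ w = y := by
    by_contra hno
    push Not at hno
    obtain ⟨y, hy, hyx, -⟩ := hno x
    obtain ⟨z, hz, hzx, hzy⟩ := hno y
    refine hcon (Finset.two_lt_card_iff.2 ⟨x, y, z, ?_, ?_, ?_, hyx.symm, hzx.symm, hzy.symm⟩) <;> simpa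
  obtain ⟨y, hy⟩ := hpair
  have hne := coord_sub_ne_zero hx.ne
  have key : ∀ e₀ e₁ : ℝ, e₀ ≠ 0 ∨ e₁ ≠ 0 → dev e₀ e₁ v x = 0 → 0 < dev e₀ e₁ v y := by
    intro e₀ e₁ he h0
    obtain ⟨w, hw, hw'⟩ := h e₀ e₁ he
    rcases hy w hw with rfl | rfl
    · exact absurd h0 hw'.ne'
    · exact hw'
  have k1 := key _ _ hne (by unfold dev; ring)
  have k2 := key _ _ (hne.imp neg_ne_zero.2 neg_ne_zero.2) (by unfold dev; ring)
  rw [dev_neg] at k2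
  linarith

/-- If all inner points are cubic and pairwise nonadjacent, ps-flippable sets have at most `h - 3`
edges. -/
theorem card_le_of_isPsFlippable (hS : InGeneralPosition S) (hc : 3 ≤ S.card)
    (hT : IsTriangulation T)
    (hdeg : ∀ v : S, IsInner v → (Finset.univ.filter fun w => T.Adj v w).card ≤ 3 ∧
      ∀ w, T.Adj v w → ¬ IsInner w)
    (hF : IsPsFlippable T F) : F.card + 3 ≤ (hullVertices S).card := by
  set E : Finset (Sym2 S) := (Set.toFinite (interiorEdges T)).toFinset with hE
  have hEc : (E : Set (Sym2 S)) = interiorEdges T := by simp [hE]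
  have h1 := card_interiorEdges hS hc hT hEc
  have h2 := card_hullVertices hS (by omega)
  -- The edges at inner points: at least three for each, and none counted twice because inner points
  -- are not adjacent.
  let X : Finset (Σ _ : S, S) := (innerPoints S).sigma fun v => Finset.univ.filter fun w => T.Adj v w
  have hX : (innerPoints S).card * 3 ≤ X.card := by
    rw [Finset.card_sigma, ← smul_eq_mul]
    refine Finset.card_nsmul_le_sum _ _ _ fun v hv => ?_
    have hv' : IsInner v := by simpa [innerPoints] using hv
    exact (hv'.surrounded hS hT).three_le
  have hXmem : ∀ e : Σ _ : S, S, e ∈ X ↔ IsInner e.1 ∧ T.Adj e.1 e.2 := by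
    intro e; simp [X, innerPoints]
  have hinj : Set.InjOn (fun e : Σ _ : S, S => s(e.1, e.2)) X := by
    rintro ⟨a, b⟩ hab ⟨c, d⟩ hcd h
    obtain ⟨ha, hab⟩ := (hXmem _).1 hab
    obtain ⟨hc, hcd⟩ := (hXmem _).1 hcd
    rcases Sym2.eq_iff.1 h with ⟨rfl, rfl⟩ | ⟨rfl, rfl⟩
    · rfl
    · exact absurd hc ((hdeg _ ha).2 _ hab)
  have hsub : F ∪ X.image (fun e => s(e.1, e.2)) ⊆ E := by
    refine Finset.union_subset (Finset.coe_subset.1 (hF.1.trans hEc.ge)) ?_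
    intro e he
    obtain ⟨⟨a, b⟩, hab, rfl⟩ := Finset.mem_image.1 he
    obtain ⟨ha, hab⟩ := (hXmem _).1 hab
    rw [← Finset.mem_coe, hEc]
    exact (mem_interiorEdges_iff hS (by omega)).2 ⟨hab, ha.exists_left hab.ne, ha.exists_right hab.ne⟩
  have hdis : Disjoint F (X.image fun e => s(e.1, e.2)) := by
    rw [Finset.disjoint_right]
    intro e he
    obtain ⟨⟨a, b⟩, hab, rfl⟩ := Finset.mem_image.1 he
    obtain ⟨ha, hab⟩ := (hXmem _).1 hab
    have k := (hF.surrounded hS (by omega) hT ha).three_le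
    have hss : (Finset.univ.filter fun w => (T.deleteEdges F).Adj a w) ⊆
        Finset.univ.filter fun w => T.Adj a w := by
      intro w hw
      simp only [Finset.mem_filter, Finset.mem_univ, true_and, SimpleGraph.deleteEdges_adj] at hw ⊢
      exact hw.1
    -- A surrounded vertex keeps at least three neighbours and `a` has at most three, so none of its
    -- edges is in `F`.
    have heq := Finset.eq_of_subset_of_card_le hss ((hdeg a ha).1.trans k)
    have hb : b ∈ Finset.univ.filter fun w => T.Adj a w := by simpa using hab
    rw [← heq] at hb
    simp only [Finset.mem_filter, Finset.mem_univ, true_and, SimpleGraph.deleteEdges_adj] at hb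
    exact hb.2
  have h3 := Finset.card_le_card hsub
  rw [Finset.card_union_of_disjoint hdis, Finset.card_image_of_injOn hinj] at h3
  omega

end

/-! ### The example with value `N / 2 - 2`: two nested parabolas -/

section
open Classical
variable {S : Finset Plane} {T : SimpleGraph S}

theorem not_adj_of_crossing (hT : IsCrossingFree T) {a b c d : S} (hab : T.Adj a b)
    (hc : 0 < ori a b c) (hd : ori a b d < 0) (ha : ori c d a < 0) (hb : 0 < ori c d b) :
    ¬ T.Adj c d := by
  intro hcd
  set σ := ori a b c - ori a b d with hσ
  have σpos : 0 < σ := by linarith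
  have hσ' : σ = ori c d b - ori c d a := by rw [hσ]; unfold ori; ring
  -- The crossing point divides `c d` in the ratio of the distances of `c` and `d` from the line `a
  -- b`.
  set z : Plane := (-ori a b d / σ) • (c : Plane) + (ori a b c / σ) • (d : Plane) with hz
  have m1 : z ∈ openSegment ℝ (c : Plane) d :=
    ⟨-ori a b d / σ, ori a b c / σ, div_pos (by linarith) σpos, by positivity, by
      rw [← add_div, div_eq_one_iff_eq σpos.ne']; linarith, rfl⟩
  have i0 : -ori a b d * (c : Plane) 0 + ori a b c * (d : Plane) 0 =
      ori c d b * (a : Plane) 0 - ori c d a * (b : Plane) 0 := by unfold ori; ring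
  have i1 : -ori a b d * (c : Plane) 1 + ori a b c * (d : Plane) 1 =
      ori c d b * (a : Plane) 1 - ori c d a * (b : Plane) 1 := by unfold ori; ring
  have m2 : z ∈ openSegment ℝ (a : Plane) b := by
    rw [mem_openSegment_iff']
    refine ⟨ori c d b / σ, -ori c d a / σ, by positivity, div_pos (by linarith) σpos, ?_, ?_, ?_⟩
    · rw [← add_div, div_eq_one_iff_eq σpos.ne']; linarith
    · simp [hz]; field_simp; linear_combination i0
    · simp [hz]; field_simp; linear_combination i1
  have := edge_eq_of_mem hT hab hcd m2 m1
  rw [Sym2.eq_iff] at this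
  rcases this with ⟨rfl, -⟩ | ⟨rfl, -⟩ <;> simp at ha hd

theorem isInner_of_triangle {v x y z : S} (hxy : 0 < ori v x y) (hyz : 0 < ori v y z)
    (hzx : 0 < ori v z x) : IsInner v := by
  intro d₀ d₁ hne
  by_contra hcon
  push Not at hcon
  have e : ori v y z * dev d₀ d₁ v x + ori v z x * dev d₀ d₁ v y + ori v x y * dev d₀ d₁ v z = 0 := by
    unfold ori dev; ring
  have h1 := mul_nonneg hyz.le (neg_nonneg.2 (hcon x))
  have h2 := mul_nonneg hzx.le (neg_nonneg.2 (hcon y))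
  have h3 := mul_nonneg hxy.le (neg_nonneg.2 (hcon z))
  have hx : dev d₀ d₁ v x = 0 := by
    rcases mul_eq_zero.1 (show ori v y z * dev d₀ d₁ v x = 0 by linarith) with h | h
    · linarith
    · exact h
  have hy : dev d₀ d₁ v y = 0 := by
    rcases mul_eq_zero.1 (show ori v z x * dev d₀ d₁ v y = 0 by linarith) with h | h
    · linarith
    · exact h
  have e0 : ori v x y * d₀ = dev d₀ d₁ v x * ((y : Plane) 0 - (v : Plane) 0) -
      dev d₀ d₁ v y * ((x : Plane) 0 - (v : Plane) 0) := by unfold ori dev; ring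
  have e1 : ori v x y * d₁ = dev d₀ d₁ v x * ((y : Plane) 1 - (v : Plane) 1) -
      dev d₀ d₁ v y * ((x : Plane) 1 - (v : Plane) 1) := by unfold ori dev; ring
  rw [hx, hy] at e0 e1
  simp [hxy.ne'] at e0 e1
  rcases hne with h | h
  · exact h e0
  · exact h e1

/-- The star that joins `o` to all other points. -/
def starGraphAt (o : S) : SimpleGraph S := SimpleGraph.fromRel fun u _ => u = o

theorem star_adj {o u : S} (h : u ≠ o) : (starGraphAt o).Adj o u := by
  simp [starGraphAt, h.symm]

theorem exists_of_mem_star {o : S} {e : Sym2 S} (he : e ∈ (starGraphAt o).edgeSet) :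
    ∃ u : S, o ≠ u ∧ e = s(o, u) := by
  induction e with
  | _ a b =>
    simp only [starGraphAt, SimpleGraph.mem_edgeSet, SimpleGraph.fromRel_adj] at he
    rcases he with ⟨hne, rfl | rfl⟩
    · exact ⟨b, hne, rfl⟩
    · exact ⟨a, hne.symm, Sym2.eq_swap⟩

/-- If two of the segments crossed, their common end `o` would lie strictly to one side of a line
through `o`. -/
theorem isCrossingFree_star (hS : InGeneralPosition S) (o : S) : IsCrossingFree (starGraphAt o) := by
  constructor
  · intro e he p hp
    obtain ⟨u, hu, rfl⟩ := exists_of_mem_star he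
    exact notMem_openSegment hS hu ⟨p, hp⟩
  · intro e he e' he' hne
    obtain ⟨u, hu, rfl⟩ := exists_of_mem_star he
    obtain ⟨w, hw, rfl⟩ := exists_of_mem_star he'
    rw [Set.disjoint_left]
    intro z h1 h2
    have := ori_sign_of_crossing hS hu hw hne h1 h2
    simp at this

theorem ori_parab_one_one (r i j a : ℝ) : ori (parab 1 i) (parab 1 j) (parab r a) =
    (j - i) * (r * a * (a - i - j) + i * j) := by
  simp only [ori, parab_zero, parab_one]; ring

theorem ori_parab_one (r i a b : ℝ) : ori (parab 1 i) (parab r a) (parab r b) =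
    r * (b - a) * (i * (i - a - b) + r * a * b) := by
  simp only [ori, parab_zero, parab_one]; ring

/-- Inner points are close enough to the origin to lie on its side of every chord between outer
points with abscissas at least `1`: `i + j ≤ 2 * i * j`, while `r * a < 1 / 4`. -/
theorem chord_pos {r a i j : ℝ} (hr : 0 < r) (ha : 0 < a) (hra : r * a < 1 / 4) (hi : 1 ≤ i)
    (hj : 1 ≤ j) : 0 < r * a * (a - i - j) + i * j := by
  have h0 : 0 < r * a := by positivity
  have h1 : r * a * (i + j) ≤ 1 / 4 * (i + j) := mul_le_mul_of_nonneg_right hra.le (by linarith)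
  have h2 : 0 < r * a * a := by positivity
  nlinarith [mul_nonneg (sub_nonneg.2 hi) (sub_nonneg.2 hj)]

/-- For `1 ≤ i ≤ a + b - 1` one has `i * (a + b - i) ≥ a + b - 1 ≥ b`, whereas the other term is at
most `b / 4`. For the half-integers `a = k + 1 / 2` and `b = l + 1 / 2` the sum is an integer, so
every natural `i` falls under this lemma or the next. -/
theorem chord_neg {r a b i : ℝ} (ha : 1 ≤ a) (hb : 1 ≤ b) (hra : r * a < 1 / 4)
    (hi : 1 ≤ i) (hi' : i ≤ a + b - 1) : i * (i - a - b) + r * a * b < 0 := by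
  have h1 : r * a * b ≤ 1 / 4 * b := mul_le_mul_of_nonneg_right hra.le (by linarith)
  nlinarith [mul_nonneg (sub_nonneg.2 hi) (show 0 ≤ a + b - i - 1 by linarith)]

theorem chord_pos' {r a b i : ℝ} (hr : 0 < r) (ha : 0 < a) (hb : 0 < b) (hi : 0 ≤ i)
    (hi' : i = 0 ∨ a + b ≤ i) : 0 < i * (i - a - b) + r * a * b := by
  have h0 : 0 < r * a * b := by positivity
  rcases hi' with rfl | h
  · linarith
  · nlinarith [mul_nonneg hi (show 0 ≤ i - a - b by linarith)]

/-- The scale of the inner points of `nestedParab`. -/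
noncomputable def innerScale (n : ℕ) : ℝ := 1 / (4 * (n + 1))

/-- The outer points of `nestedParab`: `n + 2` points of a parabola. -/
noncomputable def outerParab (n : ℕ) : Finset Plane :=
  (Finset.range (n + 2)).image fun i : ℕ => parab 1 i

/-- The inner points of `nestedParab`: `n` points of a small copy of the same parabola, in
directions between those of the outer points. -/
noncomputable def innerParab (n : ℕ) : Finset Plane :=
  (Finset.Icc 1 n).image fun k : ℕ => parab (innerScale n) (k + 1 / 2)

/-- A set of `2 n + 2` points, `n` of which are inner points. -/
noncomputable def nestedParab (n : ℕ) : Finset Plane := outerParab n ∪ innerParab n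

theorem innerScale_pos (n : ℕ) : 0 < innerScale n := by unfold innerScale; positivity

theorem innerScale_mul_lt {n k : ℕ} (hk : k ≤ n) : innerScale n * (k + 1 / 2) < 1 / 4 := by
  have : (k : ℝ) ≤ n := by exact_mod_cast hk
  unfold innerScale
  rw [one_div, inv_mul_lt_iff₀ (by positivity)]
  linarith

theorem mem_nestedParab {n : ℕ} {z : Plane} : z ∈ nestedParab n ↔ (∃ i < n + 2, parab 1 (i : ℕ) = z) ∨
    ∃ k : ℕ, (1 ≤ k ∧ k ≤ n) ∧ parab (innerScale n) (k + 1 / 2) = z := by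
  simp [nestedParab, outerParab, innerParab]

theorem ori_outer_outer_ne {n i j k : ℕ} (hij : i ≠ j) (hk : k ≤ n) :
    ori (parab 1 i) (parab 1 j) (parab (innerScale n) (k + 1 / 2)) ≠ 0 := by
  have hr := innerScale_pos n
  have hra := innerScale_mul_lt hk
  rw [ori_parab_one_one]
  refine mul_ne_zero (sub_ne_zero.2 (by exact_mod_cast hij.symm)) ?_
  -- Seen from the origin, inner points have half-integer slopes and outer points integer ones.
  have half : ∀ m : ℕ, (k : ℝ) + 1 / 2 - m ≠ 0 := by
    intro m h
    have h2 : ((2 * k + 1 : ℕ) : ℝ) = ((2 * m : ℕ) : ℝ) := by push_cast; linarith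
    have h3 : 2 * k + 1 = 2 * m := by exact_mod_cast h2
    omega
  have ha : (0 : ℝ) < k + 1 / 2 := by positivity
  rcases Nat.eq_zero_or_pos i with rfl | hi
  · have := half j
    simp only [Nat.cast_zero, sub_zero, zero_mul, add_zero]
    exact mul_ne_zero (by positivity) this
  rcases Nat.eq_zero_or_pos j with rfl | hj
  · have := half i
    simp only [Nat.cast_zero, sub_zero, mul_zero, add_zero]
    exact mul_ne_zero (by positivity) this
  exact (chord_pos hr ha hra (by exact_mod_cast hi) (by exact_mod_cast hj)).ne'

theorem ori_outer_inner_ne {n i k l : ℕ} (hkl : k ≠ l) (hk : 1 ≤ k ∧ k ≤ n) (hl : 1 ≤ l) :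
    ori (parab 1 i) (parab (innerScale n) (k + 1 / 2)) (parab (innerScale n) (l + 1 / 2)) ≠ 0 := by
  have hr := innerScale_pos n
  have hra := innerScale_mul_lt hk.2
  rw [ori_parab_one]
  have hk1 : (1 : ℝ) ≤ k := by exact_mod_cast hk.1
  have hl1 : (1 : ℝ) ≤ l := by exact_mod_cast hl
  refine mul_ne_zero (mul_ne_zero hr.ne' (sub_ne_zero.2 ?_)) ?_
  · intro h
    exact hkl (by exact_mod_cast (show (k : ℝ) = l by linarith))
  · rcases Nat.eq_zero_or_pos i with rfl | hi
    · exact (chord_pos' hr (by linarith) (by linarith) (by simp) (by simp)).ne'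
    · rcases le_or_gt i (k + l) with h | h
      · have h' : (i : ℝ) ≤ k + l := by exact_mod_cast h
        exact (chord_neg (by linarith) (by linarith) hra (by exact_mod_cast hi) (by linarith)).ne
      · have h' : (k : ℝ) + l + 1 ≤ i := by exact_mod_cast h
        exact (chord_pos' hr (by linarith) (by linarith) (by linarith) (Or.inr (by linarith))).ne'

theorem inGeneralPosition_nestedParab (n : ℕ) : InGeneralPosition (nestedParab n) := by
  intro a ha b hb c hcc hab hac hbc hcol
  have h := ori_eq_zero_of_collinear hcol
  have hr := innerScale_pos n
  have same : ∀ r : ℝ, 0 < r → ∀ x y z : ℝ, x ≠ y → x ≠ z → y ≠ z →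
      ori (parab r x) (parab r y) (parab r z) ≠ 0 := by
    intro r hr x y z hxy hxz hyz
    rw [ori_parab]
    exact mul_ne_zero (by positivity) (mul_ne_zero (mul_ne_zero (sub_ne_zero.2 hxy.symm)
      (sub_ne_zero.2 hxz.symm)) (sub_ne_zero.2 hyz.symm))
  rcases mem_nestedParab.1 ha with ⟨i, -, rfl⟩ | ⟨i, hi, rfl⟩ <;>
    rcases mem_nestedParab.1 hb with ⟨j, -, rfl⟩ | ⟨j, hj, rfl⟩ <;>
    rcases mem_nestedParab.1 hcc with ⟨k, -, rfl⟩ | ⟨k, hk, rfl⟩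
  · exact same 1 one_pos _ _ _ (fun h => hab (by rw [h])) (fun h => hac (by rw [h]))
      (fun h => hbc (by rw [h])) h
  · exact ori_outer_outer_ne (fun h => hab (by rw [h])) hk.2 h
  · rw [← ori_rotate, ← ori_rotate] at h
    exact ori_outer_outer_ne (fun h => hac (by rw [h])) hj.2 h
  · exact ori_outer_inner_ne (fun h => hbc (by rw [h])) hj hk.1 h
  · rw [← ori_rotate] at h
    exact ori_outer_outer_ne (fun h => hbc (by rw [h])) hi.2 h
  · rw [← ori_rotate] at h
    exact ori_outer_inner_ne (fun h => hac (by rw [h])) hk hi.1 h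
  · rw [← ori_rotate, ← ori_rotate] at h
    exact ori_outer_inner_ne (fun h => hab (by rw [h])) hi hj.1 h
  · exact same _ hr _ _ _ (fun h => hab (by rw [h])) (fun h => hac (by rw [h]))
      (fun h => hbc (by rw [h])) h

theorem card_outerParab (n : ℕ) : (outerParab n).card = n + 2 := by
  rw [outerParab, Finset.card_image_of_injective, Finset.card_range]
  intro i j h
  exact_mod_cast parab_injective one_ne_zero h

theorem card_nestedParab (n : ℕ) : (nestedParab n).card = 2 * n + 2 := by
  have h1 : (innerParab n).card = n := by
    rw [innerParab, Finset.card_image_of_injective, Nat.card_Icc, Nat.add_sub_cancel]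
    intro i j h
    have := parab_injective (innerScale_pos n).ne' h
    exact_mod_cast (show (i : ℝ) = j by linarith)
  rw [nestedParab, Finset.card_union_of_disjoint, card_outerParab, h1]
  · ring
  · rw [Finset.disjoint_left]
    intro z hz hz'
    obtain ⟨i, -, rfl⟩ := Finset.mem_image.1 hz
    obtain ⟨k, hk, h⟩ := Finset.mem_image.1 hz'
    have h0 := congrArg (fun p : Plane => p 0) h
    simp only [parab_zero, one_mul] at h0
    have hlt := innerScale_mul_lt (Finset.mem_Icc.1 hk).2
    have hpos : 0 < innerScale n * (k + 1 / 2) := mul_pos (innerScale_pos n) (by positivity)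
    rw [h0] at hlt hpos
    have h2 : 0 < i := by exact_mod_cast hpos
    have h3 : (1 : ℝ) ≤ i := by exact_mod_cast h2
    linarith

theorem innerScale_le_one (n : ℕ) : innerScale n ≤ 1 := by
  unfold innerScale
  rw [div_le_one (by positivity)]
  have : (0 : ℝ) ≤ n := by positivity
  linarith

/-- No point lies below the tangent to the outer parabola at abscissa `i`, whose direction is `(1, 2
* i)`. -/
theorem not_isInner_outer {n i : ℕ} {v : nestedParab n} (hv : parab 1 i = v) : ¬ IsInner v := by
  intro h
  obtain ⟨s, hs⟩ := h 1 (2 * i) (by simp)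
  have hr := innerScale_pos n
  have hr1 := innerScale_le_one n
  rcases mem_nestedParab.1 s.2 with ⟨j, -, hj⟩ | ⟨k, hk, hj⟩ <;>
    simp only [dev, ← hj, ← hv, parab_zero, parab_one] at hs
  · nlinarith [sq_nonneg ((i : ℝ) - j)]
  · nlinarith [mul_nonneg hr.le (sq_nonneg ((i : ℝ) - (k + 1 / 2))),
      mul_nonneg (sub_nonneg.2 hr1) (sq_nonneg (i : ℝ))]

/-- The point `i` of the outer parabola. -/
noncomputable def outerPoint {n : ℕ} (i : ℕ) (hi : i < n + 2) : nestedParab n :=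
  ⟨parab 1 i, mem_nestedParab.2 (Or.inl ⟨i, hi, rfl⟩)⟩

/-- The triangle of the origin and the outer points `k`, `k + 1` works: their slopes enclose `k + 1
/ 2`, and `chord_pos` places `v` on the near side of the chord. -/
theorem isInner_inner {n k : ℕ} (hk : 1 ≤ k ∧ k ≤ n) {v : nestedParab n}
    (hv : parab (innerScale n) (k + 1 / 2) = v) : IsInner v := by
  have hr := innerScale_pos n
  have hra := innerScale_mul_lt hk.2
  have hk1 : (1 : ℝ) ≤ k := by exact_mod_cast hk.1
  refine isInner_of_triangle (x := outerPoint 0 (by omega)) (y := outerPoint k (by omega))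
    (z := outerPoint (k + 1) (by omega)) ?_ ?_ ?_
  · rw [← ori_rotate, ← hv]
    simp only [outerPoint]
    rw [ori_parab_one_one]
    simp only [Nat.cast_zero]
    have : 0 < (k : ℝ) * (innerScale n * (k + 1 / 2) * (1 / 2)) := by positivity
    linarith
  · rw [← ori_rotate, ← hv]
    simp only [outerPoint]
    rw [ori_parab_one_one]
    push_cast
    have := chord_pos (j := k + 1) hr (show (0 : ℝ) < k + 1 / 2 by linarith) hra hk1 (by linarith)
    linarith
  · rw [← ori_rotate, ← hv]
    simp only [outerPoint]
    rw [ori_parab_one_one]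
    push_cast
    have : 0 < ((k : ℝ) + 1) * (innerScale n * (k + 1 / 2) * (1 / 2)) := by positivity
    linarith

theorem hullVertices_nestedParab (n : ℕ) : hullVertices (nestedParab n) = outerParab n := by
  have hc : 2 ≤ (nestedParab n).card := by rw [card_nestedParab]; omega
  have hS := inGeneralPosition_nestedParab n
  ext z
  rw [hullVertices, Finset.mem_filter]
  constructor
  · rintro ⟨hz, hb⟩
    have hni := (mem_hullBoundary_iff_not_inner hS hc ⟨z, hz⟩).1 hb
    rcases mem_nestedParab.1 hz with ⟨i, hi, rfl⟩ | ⟨k, hk, hkz⟩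
    · exact Finset.mem_image.2 ⟨i, Finset.mem_range.2 hi, rfl⟩
    · exact absurd (isInner_inner hk hkz) hni
  · intro hz
    have hzS : z ∈ nestedParab n := Finset.mem_union_left _ hz
    obtain ⟨i, -, hiz⟩ := Finset.mem_image.1 hz
    exact ⟨hzS, (mem_hullBoundary_iff_not_inner hS hc ⟨z, hzS⟩).2 (not_isInner_outer hiz)⟩

theorem ori_zero_one (r i a : ℝ) : ori (parab 1 (0 : ℕ)) (parab 1 i) (parab r a) = r * i * a * (a - i) := by
  simp only [ori, parab_zero, parab_one, Nat.cast_zero]; ring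

theorem ori_zero_scale (r s a b : ℝ) : ori (parab 1 (0 : ℕ)) (parab r a) (parab s b) =
    r * s * a * b * (b - a) := by
  simp only [ori, parab_zero, parab_one, Nat.cast_zero]; ring

/-- In a triangulation that contains the star at the origin, the neighbours of an inner point are the
vertices of the triangle of the star that contains it. -/
theorem adj_inner {n : ℕ} {T : SimpleGraph (nestedParab n)} (hT : IsCrossingFree T)
    (hstar : starGraphAt (outerPoint 0 (by omega)) ≤ T) {k : ℕ} (hk : 1 ≤ k ∧ k ≤ n) {v w : nestedParab n}
    (hv : parab (innerScale n) (k + 1 / 2) = v) (hvw : T.Adj v w) :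
    w = outerPoint 0 (by omega) ∨ w = outerPoint k (by omega) ∨ w = outerPoint (k + 1) (by omega) := by
  have hr := innerScale_pos n
  have hra := innerScale_mul_lt hk.2
  have hk1 : (1 : ℝ) ≤ k := by exact_mod_cast hk.1
  have ha : (0 : ℝ) < k + 1 / 2 := by linarith
  have hray : ∀ i (hi : i < n + 2), 0 < i → T.Adj (outerPoint 0 (by omega)) (outerPoint i hi) := by
    intro i hi hi0
    refine hstar (star_adj fun h => ?_)
    have := parab_injective one_ne_zero (congrArg Subtype.val h)
    simp at this
    omega
  have hlo := hray k (by omega) (by omega)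
  have hhi := hray (k + 1) (by omega) (by omega)
  have vlo : 0 < ori (outerPoint 0 (by omega) : nestedParab n) (outerPoint k (by omega) : nestedParab n) v := by
    rw [← hv]; simp only [outerPoint]; rw [ori_zero_one]
    have : (0 : ℝ) < k + 1 / 2 - k := by linarith
    positivity
  have vhi : ori (outerPoint 0 (by omega) : nestedParab n)
      (outerPoint (k + 1) (by omega) : nestedParab n) v < 0 := by
    rw [← hv]; simp only [outerPoint]; rw [ori_zero_one]
    push_cast
    have : 0 < innerScale n * (k + 1) * (k + 1 / 2) * (1 / 2) := by positivity
    linarith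
  -- Any neighbour other than the three listed has slope below `k` or above `k + 1`, so the edge to
  -- it would cross the star edge to the outer point `k` or `k + 1`.
  rcases mem_nestedParab.1 w.2 with ⟨j, hj, hw⟩ | ⟨l, hl, hw⟩
  · by_contra hne
    push Not at hne
    have hj' : ∀ i (hi : i < n + 2), w ≠ outerPoint i hi → j ≠ i := by
      rintro i hi h rfl
      exact h (Subtype.ext hw.symm)
    have h0 := hj' _ _ hne.1
    have h1 := hj' _ _ hne.2.1
    have h2 := hj' _ _ hne.2.2
    have hj1 : (1 : ℝ) ≤ j := by exact_mod_cast (show 1 ≤ j by omega)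
    rcases lt_or_ge j k with hjk | hjk
    · have hjk' : (j : ℝ) + 1 ≤ k := by exact_mod_cast hjk
      refine not_adj_of_crossing hT hlo vlo ?_ ?_ ?_ hvw
      · rw [← hw]; simp only [outerPoint]; rw [ori_zero_one]
        have : (0 : ℝ) < k - j := by linarith
        have : 0 < 1 * (k : ℝ) * j * (k - j) := by positivity
        linarith
      · rw [ori_rotate, ← hv, ← hw]; simp only [outerPoint]; rw [ori_zero_scale]
        have : (0 : ℝ) < k + 1 / 2 - j := by linarith
        have : 0 < innerScale n * 1 * (k + 1 / 2) * j * (k + 1 / 2 - j) := by positivity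
        linarith
      · rw [← ori_rotate, ← hv, ← hw]; simp only [outerPoint]; rw [ori_parab_one_one]
        exact mul_pos (by linarith) (chord_pos hr ha hra hj1 hk1)
    · have hjk' : (k : ℝ) + 2 ≤ j := by exact_mod_cast (show k + 2 ≤ j by omega)
      refine not_adj_of_crossing hT hhi ?_ vhi ?_ ?_ hvw.symm
      · rw [← hw]; simp only [outerPoint]; rw [ori_zero_one]
        push_cast
        have : (0 : ℝ) < j - (k + 1) := by linarith
        positivity
      · rw [ori_rotate, ← hv, ← hw]; simp only [outerPoint]; rw [ori_zero_one]
        have : (0 : ℝ) < j - (k + 1 / 2) := by linarith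
        have : 0 < innerScale n * j * (k + 1 / 2) * (j - (k + 1 / 2)) := by positivity
        linarith
      · rw [ori_rotate, ← hv, ← hw]; simp only [outerPoint]; rw [ori_parab_one_one]
        push_cast
        exact mul_pos (by linarith) (chord_pos hr ha hra (by linarith) hj1)
  · exfalso
    have hl1 : (1 : ℝ) ≤ l := by exact_mod_cast hl.1
    rcases lt_trichotomy l k with hlk | rfl | hlk
    · have hlk' : (l : ℝ) + 1 ≤ k := by exact_mod_cast hlk
      refine not_adj_of_crossing hT hlo vlo ?_ ?_ ?_ hvw
      · rw [← hw]; simp only [outerPoint]; rw [ori_zero_one]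
        have : (0 : ℝ) < k - (l + 1 / 2) := by linarith
        have : 0 < innerScale n * k * (l + 1 / 2) * (k - (l + 1 / 2)) := by positivity
        linarith
      · rw [ori_rotate, ← hv, ← hw]; simp only [outerPoint]; rw [ori_zero_scale]
        have : (0 : ℝ) < k - l := by linarith
        have : 0 < innerScale n * innerScale n * (k + 1 / 2) * (l + 1 / 2) * (k - l) := by positivity
        linarith
      · rw [ori_rotate, ← hv, ← hw]; simp only [outerPoint]; rw [ori_parab_one]
        exact mul_pos_of_neg_of_neg (mul_neg_of_pos_of_neg hr (by linarith))
          (chord_neg (by linarith) (by linarith) hra hk1 (by linarith))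
    · exact hvw.ne (Subtype.ext (hv.symm.trans hw))
    · have hlk' : (k : ℝ) + 1 ≤ l := by exact_mod_cast hlk
      refine not_adj_of_crossing hT hhi ?_ vhi ?_ ?_ hvw.symm
      · rw [← hw]; simp only [outerPoint]; rw [ori_zero_one]
        push_cast
        have : (0 : ℝ) < l + 1 / 2 - (k + 1) := by linarith
        positivity
      · rw [ori_rotate, ← hv, ← hw]; simp only [outerPoint]; rw [ori_zero_scale]
        have : (0 : ℝ) < l - k := by linarith
        have : 0 < innerScale n * innerScale n * (l + 1 / 2) * (k + 1 / 2) * (l - k) := by positivity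
        linarith
      · rw [ori_rotate, ← hv, ← hw]; simp only [outerPoint]; rw [ori_parab_one]
        push_cast
        exact mul_pos_of_neg_of_neg (mul_neg_of_pos_of_neg hr (by linarith))
          (chord_neg (by linarith) (by linarith) (innerScale_mul_lt hl.2) (by linarith) (by linarith))

/-- For every even `N` there is a triangulation of `N` points whose largest ps-flippable set has
`N / 2 - 2` edges. -/
theorem exists_isGreatest_psFlippableSizes (N : ℕ) (hN : 4 ≤ N) (hE : Even N) :
    ∃ S : Finset Plane, InGeneralPosition S ∧ S.card = N ∧
      ∃ T : SimpleGraph S, IsTriangulation T ∧ psBound S = (N : ℝ) / 2 - 2 ∧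
        IsGreatest (psFlippableSizes T) ((N : ℝ) / 2 - 2) := by
  obtain ⟨m, hm⟩ := hE
  obtain ⟨n, rfl⟩ : ∃ n, m = n + 1 := ⟨m - 1, by omega⟩
  have hn : 1 ≤ n := by omega
  -- With `n` inner and `n + 2` outer points both terms of the bound equal `n - 1`.
  obtain rfl : N = 2 * n + 2 := by omega
  have hS := inGeneralPosition_nestedParab n
  have hcard := card_nestedParab n
  have hull : (hullVertices (nestedParab n)).card = n + 2 := by
    rw [hullVertices_nestedParab, card_outerParab]
  obtain ⟨T, hle, hT⟩ := exists_isTriangulation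
    (isCrossingFree_star hS (outerPoint (n := n) 0 (by omega)))
  have hval : ((2 * n + 2 : ℕ) : ℝ) / 2 - 2 = n - 1 := by push_cast; ring
  have hps : psBound (nestedParab n) = n - 1 := by
    rw [psBound, hcard, hull, hval]
    push_cast
    rw [max_eq_left (by linarith)]
  have hdeg : ∀ v : nestedParab n, IsInner v → (Finset.univ.filter fun w => T.Adj v w).card ≤ 3 ∧
      ∀ w, T.Adj v w → ¬ IsInner w := by
    intro v hv
    obtain ⟨k, hk, hkv⟩ : ∃ k : ℕ, (1 ≤ k ∧ k ≤ n) ∧ parab (innerScale n) (k + 1 / 2) = v := by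
      rcases mem_nestedParab.1 v.2 with ⟨i, -, hi⟩ | h
      · exact absurd hv (not_isInner_outer hi)
      · exact h
    have hadj := fun w => adj_inner (w := w) hT.1 hle hk hkv
    refine ⟨(Finset.card_le_card (t := {outerPoint 0 (by omega), outerPoint k (by omega),
      outerPoint (k + 1) (by omega)}) fun w hw => ?_).trans Finset.card_le_three, fun w hw => ?_⟩
    · simpa using hadj w (Finset.mem_filter.1 hw).2
    · rcases hadj w hw with rfl | rfl | rfl <;> exact not_isInner_outer rfl
  have hup : ∀ F : Finset (Sym2 (nestedParab n)), IsPsFlippable T F → (F.card : ℝ) ≤ n - 1 := by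
    intro F hF
    have := card_le_of_isPsFlippable hS (by omega) hT hdeg hF
    rw [hull] at this
    have h : (F.card : ℝ) + 3 ≤ n + 2 := by exact_mod_cast this
    linarith
  refine ⟨nestedParab n, hS, hcard, T, hT, hps.trans hval.symm, ?_⟩
  rw [hval]
  obtain ⟨F, hF, hFc⟩ := exists_large_isPsFlippable hS (by omega) hT
  refine ⟨⟨F, hF, le_antisymm (hps ▸ hFc) (hup F hF)⟩, ?_⟩
  rintro r ⟨F', hF', rfl⟩
  exact hup F' hF'

end

theorem lemma1p3 :
    -- the lower bound
    (∀ S : Finset Plane, InGeneralPosition S → 2 ≤ S.card →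
      ∀ T : SimpleGraph S, IsTriangulation T →
        ∃ F : Finset (Sym2 S), IsPsFlippable T F ∧
          psBound S ≤ (F.card : ℝ)) ∧
    -- the bound is attained with value `N / 2 - 2`
    (∀ N : ℕ, 4 ≤ N → Even N →
      ∃ S : Finset Plane, InGeneralPosition S ∧ S.card = N ∧
        ∃ T : SimpleGraph S, IsTriangulation T ∧
          psBound S = (N : ℝ) / 2 - 2 ∧
          IsGreatest (psFlippableSizes T) ((N : ℝ) / 2 - 2)) ∧
    -- the bound is attained with value `h - 3`, by all triangulations of sets in convex position
    (∀ N : ℕ, 3 ≤ N →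
      ∃ S : Finset Plane, InGeneralPosition S ∧ InConvexPosition S ∧ S.card = N) ∧
    (∀ S : Finset Plane, InGeneralPosition S → InConvexPosition S → 3 ≤ S.card →
      (∃ T : SimpleGraph S, IsTriangulation T) ∧
      ∀ T : SimpleGraph S, IsTriangulation T →
        psBound S = ((hullVertices S).card : ℝ) - 3 ∧
        IsGreatest (psFlippableSizes T) (((hullVertices S).card : ℝ) - 3) ∧
        ∃ F : Finset (Sym2 S), (F : Set (Sym2 S)) = interiorEdges T ∧ IsPsFlippable T F ∧
          (F.card : ℝ) = ((hullVertices S).card : ℝ) - 3) := by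
  refine ⟨fun S hS hc T hT => exists_large_isPsFlippable hS hc hT,
    exists_isGreatest_psFlippableSizes, fun N _ => exists_convexPosition N, fun S hS hC hc => ⟨?_, ?_⟩⟩
  · obtain ⟨T, -, hT⟩ := exists_isTriangulation (isCrossingFree_bot (S := S))
    exact ⟨T, hT⟩
  · exact fun T hT => isGreatest_psFlippableSizes_of_convex hS hC hc hT
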